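/- Let $K$ be a field, $V$ a finite-dimensional $K$-vector space, and $E=\bigwedge V$ its exterior algebra, graded with $V=E_1$ in degree $1$. Let $\mathfrak m$ be the maximal ideal of $E$ generated by $V$, let $I\subseteq E$ be a homogeneous ideal, and give $(E/I)^*=\operatorname{Hom}_K(E/I,K)$ its natural graded $E$-module structure, in which the dual of $(E/I)_p$ has degree $-p$. A finitely generated graded $E$-module $M$ has a linear free resolution if, for some $s\in\mathbb Z$, there are integers $\beta_d\ge 0$ and an exact sequence of graded modules and degree-preserving maps $$\cdots\to E(-s-2)^{\beta_2}\to E(-s-1)^{\beta_1}\to E(-s)^{\beta_0}\to M\to 0 .$$ A sequence of linearly independent linear forms $f_1,\dots,f_s\in E_1$ ($s\ge 0$) is regular on $M$ if for every $i$ the annihilator of $f_i$ in $M/(f_1,\dots,f_{i-1})M$ equals $f_i\cdot M/(f_1,\dots,f_{i-1})M$; it is maximal if there is no $f_{s+1}\in E_1$ such that $f_1,\dots,f_{s+1}$ is again regular on $M$. We say that $I$ reduces to a power of the maximal ideal modulo $f_1,\dots,f_s$ if the image of $I$ in $E/(f_1,\dots,f_s)$ equals $\overline{\mathfrak m}^{\,k}$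 for some $k\ge 0$, where $\overline{\mathfrak m}$ is the image of $\mathfrak m$. **Theorem 3.4.** Consider the following conditions. 1. Both $I$ and $(E/I)^*$ have linear free resolutions over $E$. 2. $I$ reduces to a power of the maximal ideal modulo some maximal $E/I$-regular sequence of linear forms. 3. $I$ reduces to a power of the maximal ideal modulo every maximal $E/I$-regular sequence of linear forms. Over every field $K$, each of (2) and (3) implies (1). If $K$ is infinite, then (1), (2) and (3) are equivalent. -/

import Mathlib

open scoped ExteriorAlgebra

namespace ExteriorLinear

variable (K : Type*) [Field K] {V : Type*} [AddCommGroup V] [Module K V]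

/-- The grading of the exterior algebra `E` of `V` (elements of `V` have degree `1`), with indices
extended to `ℤ` by zero: the component of degree `j` is `⋀^p V` if `j = p ≥ 0`, and `0` if
`j < 0`. -/
def extGrading (V : Type*) [AddCommGroup V] [Module K V] (j : ℤ) :
    Submodule K (ExteriorAlgebra K V) :=
  if 0 ≤ j then ⋀[K]^(j.toNat) V else ⊥

/-- The graded left `E`-module `M`, with homogeneous components `𝓜 j`, has a linear free
resolution: for some degree `s` there is an exact complex of graded left `E`-modules
`⋯ → E(-s-2)^(β 2) → E(-s-1)^(β 1) → E(-s)^(β 0) → M → 0`.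
The maps preserve degrees: the basis of the module in homological position `0` goes to elements of
degree `s` of `M`, and all entries of the matrices of the differentials lie in `E_1 = ⋀^1 V`. -/
def HasLinearFreeResolution {M : Type*} [AddCommGroup M] [Module K M]
    [Module (ExteriorAlgebra K V) M] (𝓜 : ℤ → Submodule K M) : Prop :=
  ∃ (s : ℤ) (β : ℕ → ℕ)
    (ε : (Fin (β 0) → ExteriorAlgebra K V) →ₗ[ExteriorAlgebra K V] M)
    (δ : ∀ d : ℕ, (Fin (β (d + 1)) → ExteriorAlgebra K V) →ₗ[ExteriorAlgebra K V]
      (Fin (β d) → ExteriorAlgebra K V)),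
    (∀ i, ε (Pi.single i 1) ∈ 𝓜 s) ∧
    (∀ d i j, δ d (Pi.single i 1) j ∈ ⋀[K]^1 V) ∧
    Function.Surjective ε ∧
    Function.Exact (δ 0) ε ∧
    ∀ d, Function.Exact (δ (d + 1)) (δ d)

section Ideals

variable {K}

/-- The grading that a homogeneous ideal of `E` inherits from `E`. -/
def idealGrading (I : Ideal (ExteriorAlgebra K V)) (j : ℤ) : Submodule K I :=
  (extGrading K V j).comap (I.subtype.restrictScalars K)

/-- The grading of `E/I`, for a homogeneous ideal `I`. -/
def quotientGrading (I : Ideal (ExteriorAlgebra K V)) (j : ℤ) :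
    Submodule K (ExteriorAlgebra K V ⧸ I) :=
  (extGrading K V j).map (I.mkQ.restrictScalars K)

/-- The `K`-dual `(E/I)^* = Hom_K(E/I, K)`. -/
def QuotientDual (I : Ideal (ExteriorAlgebra K V)) : Type _ :=
  Module.Dual K (ExteriorAlgebra K V ⧸ I)

noncomputable instance (I : Ideal (ExteriorAlgebra K V)) : AddCommGroup (QuotientDual I) :=
  inferInstanceAs (AddCommGroup (Module.Dual K (ExteriorAlgebra K V ⧸ I)))

noncomputable instance (I : Ideal (ExteriorAlgebra K V)) : Module K (QuotientDual I) :=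
  inferInstanceAs (Module K (Module.Dual K (ExteriorAlgebra K V ⧸ I)))

instance (I : Ideal (ExteriorAlgebra K V)) :
    FunLike (QuotientDual I) (ExteriorAlgebra K V ⧸ I) K :=
  inferInstanceAs (FunLike (Module.Dual K (ExteriorAlgebra K V ⧸ I)) (ExteriorAlgebra K V ⧸ I) K)

/-- The left `E`-module structure of `(E/I)^*`, dual to the right multiplication of `E` on `E/I`:
`(e • φ) a = φ (a * e)`. -/
noncomputable instance (I : Ideal (ExteriorAlgebra K V)) [I.IsTwoSided] :
    Module (ExteriorAlgebra K V) (QuotientDual I) where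
  smul e φ := (show Module.Dual K (ExteriorAlgebra K V ⧸ I) from φ) ∘ₗ
    LinearMap.mulRight K (Ideal.Quotient.mk I e)
  one_smul φ := LinearMap.ext fun a => congrArg φ (mul_one a)
  mul_smul e e' φ := LinearMap.ext fun a => congrArg φ
    (show a * Ideal.Quotient.mk I (e * e') = a * Ideal.Quotient.mk I e * Ideal.Quotient.mk I e' by
      rw [map_mul, mul_assoc])
  smul_zero _ := rfl
  smul_add _ _ _ := rfl
  add_smul e e' φ := LinearMap.ext fun a =>
    (congrArg φ (show a * Ideal.Quotient.mk I (e + e') =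
      a * Ideal.Quotient.mk I e + a * Ideal.Quotient.mk I e' by rw [map_add, mul_add])).trans
      (LinearMap.map_add (show Module.Dual K (ExteriorAlgebra K V ⧸ I) from φ) _ _)
  zero_smul φ := LinearMap.ext fun a =>
    (congrArg φ (show a * Ideal.Quotient.mk I 0 = 0 by rw [map_zero, mul_zero])).trans
      (LinearMap.map_zero (show Module.Dual K (ExteriorAlgebra K V ⧸ I) from φ))

theorem quotientDual_smul_apply (I : Ideal (ExteriorAlgebra K V)) [I.IsTwoSided]
    (e : ExteriorAlgebra K V) (φ : QuotientDual I) (a : ExteriorAlgebra K V ⧸ I) :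
    (e • φ) a = φ (a * Ideal.Quotient.mk I e) := rfl

/-- The grading of `(E/I)^*`: the component of degree `j` is the dual of `(E/I)_{-j}`, that is, it
consists of the functionals that vanish on `(E/I)_i` for all `i ≠ -j`. -/
def quotientDualGrading (I : Ideal (ExteriorAlgebra K V)) (j : ℤ) :
    Submodule K (QuotientDual I) where
  carrier := {φ | ∀ i : ℤ, i ≠ -j → ∀ a ∈ quotientGrading I i, φ a = 0}
  zero_mem' := fun _ _ _ _ => rfl
  add_mem' := fun {φ ψ} hφ hψ i hi a ha =>
    show φ a + ψ a = 0 by rw [hφ i hi a ha, hψ i hi a ha, add_zero]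
  smul_mem' := fun c φ hφ i hi a ha => show c • φ a = 0 by rw [hφ i hi a ha, smul_zero]

variable (K V) in
/-- The maximal ideal `𝔪` of `E`, generated by `V = E_1`. -/
def maxIdeal : Ideal (ExteriorAlgebra K V) :=
  Ideal.span (Set.range (ExteriorAlgebra.ι K))

variable (K) in
/-- The ideal of `E` generated by a set of linear forms. -/
def linIdeal (S : Set V) : Ideal (ExteriorAlgebra K V) :=
  Ideal.span (ExteriorAlgebra.ι K '' S)

/-- An ideal that is generated on the left by linear forms is two-sided. -/
instance linIdeal_isTwoSided (S : Set V) : (linIdeal K S).IsTwoSided := by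
  have key : ∀ b : ExteriorAlgebra K V, ∀ a ∈ linIdeal K S, a * b ∈ linIdeal K S := by
    intro b
    induction b using ExteriorAlgebra.induction with
    | algebraMap r =>
      intro a ha
      rw [← Algebra.commutes]
      exact Ideal.mul_mem_left _ _ ha
    | ι w =>
      intro a ha
      refine Submodule.span_induction ?_ ?_ ?_ ?_ ha
      · rintro _ ⟨v, hv, rfl⟩
        have h : ExteriorAlgebra.ι K v * ExteriorAlgebra.ι K w =
            -(ExteriorAlgebra.ι K w * ExteriorAlgebra.ι K v) :=
          eq_neg_of_add_eq_zero_left (ExteriorAlgebra.ι_add_mul_swap v w)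
        rw [h]
        exact neg_mem (Ideal.mul_mem_left _ _ (Ideal.subset_span ⟨v, hv, rfl⟩))
      · rw [zero_mul]
        exact zero_mem _
      · intro x y _ _ hx hy
        rw [add_mul]
        exact add_mem hx hy
      · intro c x _ hx
        rw [smul_eq_mul, mul_assoc]
        exact Ideal.mul_mem_left _ _ hx
    | mul x y hx hy =>
      intro a ha
      rw [← mul_assoc]
      exact hy _ (hx _ ha)
    | add x y hx hy =>
      intro a ha
      rw [mul_add]
      exact add_mem (hx _ ha) (hy _ ha)
  exact ⟨fun {a} b ha => key b a ha⟩

end Ideals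

/-- The linear form `v` is regular on the `E`-module `M`: the annihilator of `v` in `M` is `vM`. -/
def IsRegularForm (M : Type*) [AddCommGroup M] [Module (ExteriorAlgebra K V) M] (v : V) : Prop :=
  ∀ m : M, ExteriorAlgebra.ι K v • m = 0 ↔ ∃ m' : M, ExteriorAlgebra.ι K v • m' = m

/-- The linear forms `f_1, …, f_s` form a regular sequence on the `E`-module `M`: they are linearly
independent, and each `f_i` is regular on `M / (f_1, …, f_{i-1})M`.
(For `M ≠ 0` finitely generated the independence follows from the other condition.) -/
def IsRegularSequence (M : Type*) [AddCommGroup M] [Module (ExteriorAlgebra K V) M] {s : ℕ}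
    (f : Fin s → V) : Prop :=
  LinearIndependent K f ∧
    ∀ i : Fin s,
      IsRegularForm K (M ⧸ (linIdeal K (f '' {j | j < i}) • (⊤ : Submodule (ExteriorAlgebra K V) M)))
        (f i)

/-- A regular sequence of linear forms on `M` that cannot be prolonged. -/
def IsMaximalRegularSequence (M : Type*) [AddCommGroup M] [Module (ExteriorAlgebra K V) M] {s : ℕ}
    (f : Fin s → V) : Prop :=
  IsRegularSequence K M f ∧
    ∀ v : V, ¬ IsRegularSequence K M (Fin.snoc f v : Fin (s + 1) → V)

variable {K}

/-- The ideal `I` reduces to a power of the maximal ideal modulo `f_1, …, f_s`: the image of `I` in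
the ring `E/(f_1, …, f_s)` is `𝔪̄ ^ k` for some `k ≥ 0`, where `𝔪̄` is the maximal ideal
of `E/(f_1, …, f_s)`, the image of `𝔪`. -/
def ReducesToPower (I : Ideal (ExteriorAlgebra K V)) {s : ℕ} (f : Fin s → V) : Prop :=
  ∃ k : ℕ, I.map (Ideal.Quotient.mk (linIdeal K (Set.range f))) =
    ((maxIdeal K V).map (Ideal.Quotient.mk (linIdeal K (Set.range f)))) ^ k

/-- Both `I` and `(E/I)^*` have linear free resolutions over `E`. -/
def BothLinear (I : Ideal (ExteriorAlgebra K V)) [I.IsTwoSided] : Prop :=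
  HasLinearFreeResolution (V := V) K (idealGrading I) ∧
    HasLinearFreeResolution (V := V) K (quotientDualGrading I)

/-- `I` reduces to a power of the maximal ideal modulo some maximal `E/I`-regular sequence of linear
forms. -/
def ReducesForSome (I : Ideal (ExteriorAlgebra K V)) : Prop :=
  ∃ (s : ℕ) (f : Fin s → V),
    IsMaximalRegularSequence K (ExteriorAlgebra K V ⧸ I) f ∧ ReducesToPower I f

/-- `I` reduces to a power of the maximal ideal modulo every maximal `E/I`-regular sequence of
linear forms. -/
def ReducesForAll (I : Ideal (ExteriorAlgebra K V)) : Prop :=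
  ∀ (s : ℕ) (f : Fin s → V),
    IsMaximalRegularSequence K (ExteriorAlgebra K V ⧸ I) f → ReducesToPower I f

end ExteriorLinear

open scoped ExteriorAlgebra

set_option linter.unusedSectionVars false

/-! Linearity of a resolution is read off from the Cartan complex. For linear forms `v_i` it
consists of families `z` in `M` indexed by multi-exponents, with `(Dz)(a) = ∑ v_i z(a + e_i)`; the
total degree of the exponent is the homological position. For a basis of `V` its homology is
`Tor^E(K, M)`. Hence `M` has a linear resolution exactly when this homology, graded by the degree of
the coefficients in `M`, sits in a single degree: `HasLinearFreeResolution.cartanExact` and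
`hasLinearFreeResolution_of_cartanExact`.

Let `F` be the product of a regular sequence `f` on `M`. Then `M/(f)M ≅ FM`, and removing `f` from
the list of forms replaces `M` by `FM` with a shift of degree (`GradedRegularSeq.cartanExact_iff`).
A sequence of independent forms that is regular on `E/I` is also regular on `E`, on `I` and on
`(E/I)^*`. After completing `f` to a basis `f ++ g`, only the Cartan complexes of `FI`, `FE` and
`F(E/I)^*` over `g` matter.

Reduction to a power implies linearity: `I` reduces to the `k`-th power modulo `f` iff `FI` is the
part of `FE` coming from `E_p`, `p ≥ k` (`reducesToPower_iff`). Then `FI` vanishes below this bound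
and agrees with `FE` above it, and `F(E/I)^*` is cut out of `FE^*` in the same way. Since `FE` and
`FE^*` have homology in one extreme degree only, `FI` and `F(E/I)^*` have homology only at the cut.

Converse, for infinite `K`: where the Cartan complex is exact, multiplication by a generic
combination of its forms is exact too (`CartanExact.exists_polynomial`). If `I` is generated in
degree `k` and `(E/I)^*` in degree `t`, a generic `v` is therefore exact on `F(E/I)` in all degrees
but one by duality. In the remaining degree the sequence `0 → FI → FE → F(E/I) → 0` helps, unless
`-t` is `|f|` or `k + |f| - 1` (`RegularSeq.exists_concat`). So a maximal sequence falls under one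
of these two cases or has `F ∈ I`, and each time the degrees force `I` to reduce to a power of the
maximal ideal (`exists_isPowerModulo_of_bothLinear`). -/

namespace ExteriorLinear

/-! ### Generic exactness of complexes that depend linearly on parameters. -/

section Generic

open MvPolynomial

variable {K : Type*} [Field K] {r a b c : ℕ}

/-- The matrix of linear forms `∑ i, X i • A i`. -/
noncomputable def linMatrix (A : Fin r → Matrix (Fin b) (Fin a) K) :
    Matrix (Fin b) (Fin a) (MvPolynomial (Fin r) K) :=
  fun k l => ∑ i, monomial (Finsupp.single i 1) (A i k l)

theorem linMatrix_map_eval (A : Fin r → Matrix (Fin b) (Fin a) K) (v : Fin r → K) :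
    (linMatrix A).map (eval v) = ∑ i, v i • A i := by
  ext k l
  simp [linMatrix, Matrix.sum_apply, eval_monomial, mul_comm]

theorem single_vecMul_linMatrix (A : Fin r → Matrix (Fin b) (Fin a) K) (α : Fin r →₀ ℕ)
    (k : Fin b) :
    Matrix.vecMul (Pi.single k (monomial α 1)) (linMatrix A) =
      ∑ i, ∑ l, A i k l • (Pi.single l (monomial (α + Finsupp.single i 1) 1) :
        Fin a → MvPolynomial (Fin r) K) := by
  ext1 l
  have h : Matrix.vecMul (Pi.single k (monomial α 1)) (linMatrix A) l =
      monomial α 1 * ∑ i, monomial (Finsupp.single i 1) (A i k l) := by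
    rw [Matrix.single_vecMul]
    rfl
  rw [h, Finset.mul_sum, Finset.sum_apply]
  refine Finset.sum_congr rfl fun i _ => ?_
  rw [Finset.sum_apply, Finset.sum_eq_single l, monomial_mul, one_mul, Pi.smul_apply,
    Pi.single_eq_same, smul_monomial, smul_eq_mul, mul_one]
  · intro m _ hm
    rw [Pi.smul_apply, Pi.single_eq_of_ne hm.symm, smul_zero]
  · simp

/-- Exactness for multi-indexed sequences dualizes to exactness over the polynomial ring. -/
theorem exists_vecMul_eq_of_sequence_exact {A : Fin r → Matrix (Fin b) (Fin a) K}
    {B : Fin r → Matrix (Fin c) (Fin b) K}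
    (h : ∀ z : (Fin r →₀ ℕ) → Fin b → K,
      (∀ α, ∑ i, (B i).mulVec (z (α + Finsupp.single i 1)) = 0) →
      ∃ w : (Fin r →₀ ℕ) → Fin a → K,
        ∀ α, ∑ i, (A i).mulVec (w (α + Finsupp.single i 1)) = z α)
    (p : Fin b → MvPolynomial (Fin r) K) (hp : Matrix.vecMul p (linMatrix A) = 0) :
    ∃ q, Matrix.vecMul q (linMatrix B) = p := by
  by_contra hne
  let LB := (Matrix.vecMulLinear (linMatrix B)).restrictScalars K
  let LA := (Matrix.vecMulLinear (linMatrix A)).restrictScalars K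
  obtain ⟨φ, hφ, hφ'⟩ := Submodule.exists_dual_map_eq_bot_of_notMem
    (p := LinearMap.range LB) (x := p) (by rintro ⟨q, hq⟩; exact hne ⟨q, hq⟩) inferInstance
  have hφB : ∀ q, φ (LB q) = 0 := fun q => (Submodule.mem_bot K).1
    (hφ' ▸ Submodule.mem_map_of_mem ⟨q, rfl⟩)
  -- A functional on the free polynomial module is the family of its values on monomials; that `φ`
  -- kills the image of `B` says that this family is a cycle.
  obtain ⟨w, hw⟩ := h (fun α m => φ (Pi.single m (monomial α 1))) (fun α => by
    ext l
    have h1 := hφB (Pi.single l (monomial α 1))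
    have h2 : LB (Pi.single l (monomial α 1)) = _ := single_vecMul_linMatrix B α l
    rw [h2] at h1
    simp only [map_sum, map_smul, smul_eq_mul] at h1
    simpa [Finset.sum_apply, Matrix.mulVec, dotProduct] using h1)
  let ψ : (Fin a → MvPolynomial (Fin r) K) →ₗ[K] K :=
    ∑ l, ((basisMonomials (Fin r) K).constr K fun α => w α l) ∘ₗ LinearMap.proj l
  have hψ : ∀ l α, ψ (Pi.single l (monomial α 1)) = w α l := fun l α => by
    simp only [ψ, LinearMap.sum_apply, LinearMap.comp_apply, LinearMap.proj_apply]
    rw [Finset.sum_eq_single l, Pi.single_eq_same]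
    · have h1 := (basisMonomials (Fin r) K).constr_basis K (fun α => w α l) α
      rwa [coe_basisMonomials] at h1
    · intro m _ hm
      rw [Pi.single_eq_of_ne hm, map_zero]
    · simp
  -- The family `w` defines `ψ` with `φ = ψ ∘ A`, so `φ p = ψ (p A) = 0`, whereas `φ` was chosen
  -- with `φ p ≠ 0`.
  have hcomp : φ = ψ ∘ₗ LA := by
    refine LinearMap.pi_ext' fun m => (basisMonomials (Fin r) K).ext fun α => ?_
    rw [coe_basisMonomials]
    have h2 : LA (Pi.single m (monomial α 1)) = _ := single_vecMul_linMatrix A α m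
    have h3 := congrFun (hw α) m
    simp only [LinearMap.comp_apply, LinearMap.single_apply]
    rw [h2]
    simp only [map_sum, map_smul, hψ, smul_eq_mul]
    rw [← h3]
    simp [Finset.sum_apply, Matrix.mulVec, dotProduct]
  refine hφ ?_
  rw [hcomp, LinearMap.comp_apply]
  have : LA p = 0 := hp
  rw [this, map_zero]

theorem exists_generalized_inverse {F : Type*} [Field F] (A : Matrix (Fin b) (Fin a) F) :
    ∃ H : Matrix (Fin a) (Fin b) F, A * H * A = A := by
  obtain ⟨r, hr⟩ := LinearMap.exists_rightInverse_of_surjective A.mulVecLin.rangeRestrict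
    (LinearMap.range_rangeRestrict _)
  obtain ⟨h, hh⟩ := LinearMap.exists_extend r
  refine ⟨LinearMap.toMatrix' h, ?_⟩
  refine Matrix.mulVec_injective (funext fun x => ?_)
  rw [← Matrix.mulVec_mulVec, ← Matrix.mulVec_mulVec, LinearMap.toMatrix'_mulVec]
  have h1 : h (A.mulVec x) = r (A.mulVecLin.rangeRestrict x) :=
    LinearMap.congr_fun hh (A.mulVecLin.rangeRestrict x)
  rw [h1]
  exact congrArg Subtype.val (LinearMap.congr_fun hr (A.mulVecLin.rangeRestrict x))

/-- The hypothesis passes to the fraction field by clearing denominators. There `A H A = A` for a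
generalized inverse `H`, so the rows of `1 - A H` are killed by `A` and hence are combinations `G B`
of the rows of `B`. A common denominator of `H` and `G` is the required `g`. -/
theorem exists_contraction {R : Type*} [CommRing R] [IsDomain R]
    {A : Matrix (Fin b) (Fin a) R} {B : Matrix (Fin c) (Fin b) R}
    (h : ∀ p : Fin b → R, Matrix.vecMul p A = 0 → ∃ q, Matrix.vecMul q B = p) :
    ∃ (g : R) (H : Matrix (Fin a) (Fin b) R) (G : Matrix (Fin b) (Fin c) R),
      g ≠ 0 ∧ A * H + G * B = g • (1 : Matrix (Fin b) (Fin b) R) := by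
  let F := FractionRing R
  let i : R →+* F := algebraMap R F
  have hi : Function.Injective i := IsFractionRing.injective R F
  have hF : ∀ p : Fin b → F, Matrix.vecMul p (A.map i) = 0 →
      ∃ q, Matrix.vecMul q (B.map i) = p := by
    intro p hp
    obtain ⟨s, hs⟩ := IsLocalization.exist_integer_multiples_of_finite (nonZeroDivisors R) p
    choose p' hp' using hs
    have hs0 : i s ≠ 0 := by
      rw [Ne, map_eq_zero_iff i hi]
      exact nonZeroDivisors.ne_zero s.2
    have hp'' : (fun k => i (p' k)) = i s • p := by
      ext k
      rw [Pi.smul_apply, smul_eq_mul, ← Algebra.smul_def]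
      exact hp' k
    obtain ⟨q, hq⟩ := h p' (by
      ext l
      apply hi
      rw [RingHom.map_vecMul, Pi.zero_apply, map_zero]
      have : (i ∘ p') = i s • p := hp''
      rw [this, Matrix.smul_vecMul, hp, smul_zero, Pi.zero_apply])
    refine ⟨(i s)⁻¹ • (i ∘ q), ?_⟩
    rw [Matrix.smul_vecMul]
    ext l
    rw [Pi.smul_apply, ← RingHom.map_vecMul, hq, smul_eq_mul, inv_mul_eq_iff_eq_mul₀ hs0]
    exact congrFun hp'' l
  obtain ⟨H, hH⟩ := exists_generalized_inverse (A.map i)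
  choose G hG using fun k => hF ((1 - A.map i * H : Matrix (Fin b) (Fin b) F) k) (by
    have : (1 - A.map i * H) * A.map i = 0 := by
      rw [Matrix.sub_mul, Matrix.one_mul, hH, sub_self]
    exact congrFun this k)
  have hHG : A.map i * H + (Matrix.of G) * B.map i = 1 := by
    have : (Matrix.of G) * B.map i = 1 - A.map i * H := by
      ext k l
      exact congrFun (hG k) l
    rw [this, add_sub_cancel]
  obtain ⟨s, hs⟩ := IsLocalization.exist_integer_multiples_of_finite (nonZeroDivisors R)
    (Sum.elim (fun x : Fin a × Fin b => H x.1 x.2) (fun x : Fin b × Fin c => G x.1 x.2))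
  choose T hT using hs
  refine ⟨s, Matrix.of fun k l => T (Sum.inl (k, l)), Matrix.of fun k l => T (Sum.inr (k, l)),
    nonZeroDivisors.ne_zero s.2, ?_⟩
  have h1 : (Matrix.of fun k l => T (Sum.inl (k, l))).map i = i s • H := by
    ext k l
    exact (hT (Sum.inl (k, l))).trans (Algebra.smul_def _ _)
  have h2 : (Matrix.of fun k l => T (Sum.inr (k, l))).map i = i s • Matrix.of G := by
    ext k l
    exact (hT (Sum.inr (k, l))).trans (Algebra.smul_def _ _)
  apply Matrix.map_injective hi
  beta_reduce
  rw [Matrix.map_add _ (map_add i), Matrix.map_mul, Matrix.map_mul, h1, h2, Matrix.mul_smul,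
    Matrix.smul_mul, ← smul_add, hHG]
  ext k l
  simp [Matrix.one_apply, apply_ite i]

/-- Generic exactness of a complex of matrices of linear forms. -/
theorem exists_polynomial_of_sequence_exact_matrix {A : Fin r → Matrix (Fin b) (Fin a) K}
    {B : Fin r → Matrix (Fin c) (Fin b) K}
    (h : ∀ z : (Fin r →₀ ℕ) → Fin b → K,
      (∀ α, ∑ i, (B i).mulVec (z (α + Finsupp.single i 1)) = 0) →
      ∃ w : (Fin r →₀ ℕ) → Fin a → K,
        ∀ α, ∑ i, (A i).mulVec (w (α + Finsupp.single i 1)) = z α) :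
    ∃ g : MvPolynomial (Fin r) K, g ≠ 0 ∧ ∀ v : Fin r → K, eval v g ≠ 0 →
      ∀ x, (∑ i, v i • B i).mulVec x = 0 → ∃ u, (∑ i, v i • A i).mulVec u = x := by
  -- At a point `v` with `g(v) ≠ 0` the identity `A H + G B = g` specializes to a homotopy: if `B(v)
  -- x = 0`, then `x = A(v) (g(v)⁻¹ H(v) x)`.
  obtain ⟨g, H, G, hg, hHG⟩ := exists_contraction (exists_vecMul_eq_of_sequence_exact h)
  refine ⟨g, hg, fun v hv x hx => ?_⟩
  have h1 := congrArg (fun M => M.map (eval v)) hHG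
  simp only [Matrix.map_add _ (map_add (eval v)), Matrix.map_mul, linMatrix_map_eval] at h1
  refine ⟨(eval v g)⁻¹ • (H.map (eval v)).mulVec x, ?_⟩
  have h2 := congrArg (fun M => M.mulVec x) h1
  simp only [Matrix.add_mulVec, ← Matrix.mulVec_mulVec, hx, Matrix.mulVec_zero, add_zero] at h2
  rw [Matrix.mulVec_smul, h2]
  have h3 : (g • (1 : Matrix (Fin b) (Fin b) (MvPolynomial (Fin r) K))).map (eval v) =
      eval v g • 1 := by
    ext k l
    simp [Matrix.one_apply, apply_ite (eval v)]
  rw [h3, Matrix.smul_mulVec, Matrix.one_mulVec, smul_smul, inv_mul_cancel₀ hv, one_smul]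

/-- Generic exactness of a complex of vector spaces whose maps depend linearly on parameters. -/
theorem exists_polynomial_of_sequence_exact {U W X : Type*} [AddCommGroup U] [Module K U]
    [AddCommGroup W] [Module K W] [AddCommGroup X] [Module K X] [FiniteDimensional K U]
    [FiniteDimensional K W] [FiniteDimensional K X] (A : Fin r → U →ₗ[K] W)
    (B : Fin r → W →ₗ[K] X)
    (h : ∀ z : (Fin r →₀ ℕ) → W, (∀ α, ∑ i, B i (z (α + Finsupp.single i 1)) = 0) →
      ∃ w : (Fin r →₀ ℕ) → U, ∀ α, ∑ i, A i (w (α + Finsupp.single i 1)) = z α) :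
    ∃ g : MvPolynomial (Fin r) K, g ≠ 0 ∧ ∀ v : Fin r → K, eval v g ≠ 0 →
      ∀ x, ∑ i, v i • B i x = 0 → ∃ u, ∑ i, v i • A i u = x := by
  let bU := Module.finBasis K U
  let bW := Module.finBasis K W
  let bX := Module.finBasis K X
  have hA : ∀ i u, (LinearMap.toMatrix bU bW (A i)).mulVec (bU.equivFun u) = bW.equivFun (A i u) :=
    fun i u => LinearMap.toMatrix_mulVec_repr bU bW (A i) u
  have hB : ∀ i u, (LinearMap.toMatrix bW bX (B i)).mulVec (bW.equivFun u) = bX.equivFun (B i u) :=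
    fun i u => LinearMap.toMatrix_mulVec_repr bW bX (B i) u
  obtain ⟨g, hg, hg'⟩ := exists_polynomial_of_sequence_exact_matrix
    (A := fun i => LinearMap.toMatrix bU bW (A i)) (B := fun i => LinearMap.toMatrix bW bX (B i))
    (fun z hz => by
      obtain ⟨w, hw⟩ := h (fun α => bW.equivFun.symm (z α)) (fun α => by
        apply bX.equivFun.injective
        rw [map_zero, ← hz α, map_sum]
        exact Finset.sum_congr rfl fun i _ => by
          rw [← hB, LinearEquiv.apply_symm_apply])
      refine ⟨fun α => bU.equivFun (w α), fun α => ?_⟩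
      rw [← bW.equivFun.apply_symm_apply (z α), ← hw α, map_sum]
      exact Finset.sum_congr rfl fun i _ => hA _ _)
  refine ⟨g, hg, fun v hv x hx => ?_⟩
  obtain ⟨u, hu⟩ := hg' v hv (bW.equivFun x) (by
    rw [Matrix.sum_mulVec, ← map_zero bX.equivFun, ← hx, map_sum]
    exact Finset.sum_congr rfl fun i _ => by rw [Matrix.smul_mulVec, hB, map_smul])
  refine ⟨bU.equivFun.symm u, ?_⟩
  apply bW.equivFun.injective
  rw [← hu, Matrix.sum_mulVec, map_sum]
  exact Finset.sum_congr rfl fun i _ => by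
    rw [Matrix.smul_mulVec, map_smul, ← hA, LinearEquiv.apply_symm_apply]

end Generic

open ExteriorAlgebra (ι)

/-! ### Graded modules and homogeneous preimages. -/

section Graded

variable {K : Type*} [Field K] {V : Type*} [AddCommGroup V] [Module K V]
variable {M : Type*} [AddCommGroup M] [Module K M]
variable {N : Type*} [AddCommGroup N] [Module K N]

/-- A family of subspaces has projections onto each member that kill all the other members. -/
def HasProjections (𝓜 : ℤ → Submodule K M) : Prop :=
  ∀ j, ∃ π : M →ₗ[K] M, (∀ x, π x ∈ 𝓜 j) ∧ (∀ x ∈ 𝓜 j, π x = x) ∧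
    ∀ i, i ≠ j → ∀ x ∈ 𝓜 i, π x = 0

/-- A preimage of a homogeneous element under a homogeneous linear map can be chosen
homogeneous. -/
theorem exists_homogeneous_preimage {𝓜 : ℤ → Submodule K M} (hM : ⨆ j, 𝓜 j = ⊤)
    {𝓝 : ℤ → Submodule K N} (hN : HasProjections 𝓝) (T : M →ₗ[K] N) {d : ℤ}
    (hT : ∀ i, ∀ x ∈ 𝓜 i, T x ∈ 𝓝 (i + d)) {j : ℤ} (y : M) (hy : T y ∈ 𝓝 (j + d)) :
    ∃ y' ∈ 𝓜 j, T y' = T y := by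
  obtain ⟨π, -, h2, h3⟩ := hN (j + d)
  suffices h : ∃ y' ∈ 𝓜 j, T y' = π (T y) by rwa [h2 _ hy] at h
  clear hy
  have hy : y ∈ ⨆ j, 𝓜 j := hM ▸ Submodule.mem_top
  induction hy using Submodule.iSup_induction' with
  | mem i x hx =>
    by_cases hij : i = j
    · subst hij
      exact ⟨x, hx, (h2 _ (hT _ _ hx)).symm⟩
    · exact ⟨0, zero_mem _, by rw [h3 (i + d) (by omega) _ (hT _ _ hx), map_zero]⟩
  | zero => exact ⟨0, zero_mem _, by simp⟩
  | add x y _ _ hx hy =>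
    obtain ⟨a, ha, ha'⟩ := hx
    obtain ⟨b, hb, hb'⟩ := hy
    exact ⟨a + b, add_mem ha hb, by simp [ha', hb']⟩

/-- A linear map compatible with given projections commutes with them. -/
theorem map_proj_eq {𝓜 : ℤ → Submodule K M} (hM : ⨆ j, 𝓜 j = ⊤)
    {𝓝 : ℤ → Submodule K N} (T : M →ₗ[K] N) {d : ℤ}
    (hT : ∀ i, ∀ x ∈ 𝓜 i, T x ∈ 𝓝 (i + d)) {j : ℤ} {π : M →ₗ[K] M} {ρ : N →ₗ[K] N}
    (hπ : (∀ x ∈ 𝓜 j, π x = x) ∧ ∀ i, i ≠ j → ∀ x ∈ 𝓜 i, π x = 0)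
    (hρ : (∀ x ∈ 𝓝 (j + d), ρ x = x) ∧ ∀ i, i ≠ j + d → ∀ x ∈ 𝓝 i, ρ x = 0) (y : M) :
    T (π y) = ρ (T y) := by
  have hy : y ∈ ⨆ j, 𝓜 j := hM ▸ Submodule.mem_top
  induction hy using Submodule.iSup_induction' with
  | mem i x hx =>
    by_cases hij : i = j
    · subst hij
      rw [hπ.1 _ hx, hρ.1 _ (hT _ _ hx)]
    · rw [hπ.2 _ hij _ hx, hρ.2 (i + d) (by omega) _ (hT _ _ hx), map_zero]
  | zero => simp
  | add x y _ _ hx hy => simp [hx, hy]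

variable [Module (ExteriorAlgebra K V) M]

variable (V) in
/-- `𝓜` is a grading of the `E`-module `M`, bounded below. -/
structure IsGradedModule (𝓜 : ℤ → Submodule K M) : Prop where
  smul_mem : ∀ (v : V) (j : ℤ), ∀ x ∈ 𝓜 j, ι K v • x ∈ 𝓜 (j + 1)
  iSup_eq_top : ⨆ j, 𝓜 j = ⊤
  hasProjections : HasProjections 𝓜
  bddBelow : ∃ j₀, ∀ j, j < j₀ → 𝓜 j = ⊥

end Graded

/-! ### Products of linear forms. -/

section FormProd

variable {K : Type*} [Field K] {V : Type*} [AddCommGroup V] [Module K V]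

variable (K) in
/-- The product of the linear forms of a list, with the last form of the list on the left. -/
noncomputable def formProd (l : List V) : ExteriorAlgebra K V :=
  (l.reverse.map (ι K)).prod

@[simp] theorem formProd_nil : formProd K ([] : List V) = 1 := rfl

theorem formProd_concat (l : List V) (v : V) :
    formProd K (l ++ [v]) = ι K v * formProd K l := by
  simp [formProd]

theorem formProd_cons (l : List V) (v : V) :
    formProd K (v :: l) = formProd K l * ι K v := by
  simp [formProd]

theorem ι_mul_ι_swap (v w : V) : ι K v * ι K w = -(ι K w * ι K v) :=
  eq_neg_of_add_eq_zero_left (ExteriorAlgebra.ι_add_mul_swap v w)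

theorem ι_mul_formProd (v : V) (l : List V) :
    ι K v * formProd K l = (-1 : K) ^ l.length • (formProd K l * ι K v) := by
  induction l with
  | nil => simp
  | cons w l ih =>
    rw [formProd_cons, ← mul_assoc, ih, smul_mul_assoc, mul_assoc, ι_mul_ι_swap, mul_neg,
      ← mul_assoc, List.length_cons, pow_succ]
    simp

theorem ι_mul_formProd_of_mem {v : V} {l : List V} (h : v ∈ l) :
    ι K v * formProd K l = 0 := by
  induction l with
  | nil => simp at h
  | cons w l ih =>
    rw [formProd_cons, ← mul_assoc]
    rcases List.mem_cons.1 h with rfl | h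
    · rw [ι_mul_formProd, smul_mul_assoc, mul_assoc, ExteriorAlgebra.ι_sq_zero, mul_zero, smul_zero]
    · rw [ih h, zero_mul]

theorem formProd_mul_ι_of_mem {v : V} {l : List V} (h : v ∈ l) :
    formProd K l * ι K v = 0 := by
  have := ι_mul_formProd (K := K) v l
  rw [ι_mul_formProd_of_mem h] at this
  rcases smul_eq_zero.1 this.symm with h' | h'
  · exact absurd h' (pow_ne_zero _ (by simp))
  · exact h'

theorem exists_formProd_mul_eq (l : List V) (a : ExteriorAlgebra K V) :
    ∃ a', formProd K l * a = a' * formProd K l := by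
  induction a using ExteriorAlgebra.induction with
  | algebraMap r => exact ⟨algebraMap _ _ r, (Algebra.commutes _ _).symm⟩
  | ι v =>
    refine ⟨(-1 : K) ^ l.length • ι K v, ?_⟩
    rw [smul_mul_assoc, ι_mul_formProd, smul_smul, ← mul_pow]
    simp
  | mul a b ha hb =>
    obtain ⟨a', ha⟩ := ha
    obtain ⟨b', hb⟩ := hb
    exact ⟨a' * b', by rw [← mul_assoc, ha, mul_assoc, hb, mul_assoc]⟩
  | add a b ha hb =>
    obtain ⟨a', ha⟩ := ha
    obtain ⟨b', hb⟩ := hb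
    exact ⟨a' + b', by rw [mul_add, ha, hb, add_mul]⟩

end FormProd

/-! ### The grading of the exterior algebra. -/

section ExtGrading

variable {K : Type*} [Field K] {V : Type*} [AddCommGroup V] [Module K V]

@[simp] theorem extGrading_natCast (p : ℕ) : extGrading K V (p : ℤ) = ⋀[K]^p V := by
  simp [extGrading]

theorem extGrading_of_neg {j : ℤ} (hj : j < 0) : extGrading K V j = ⊥ := by
  simp [extGrading, hj]

theorem mul_mem_extGrading {i j : ℤ} {x y : ExteriorAlgebra K V} (hx : x ∈ extGrading K V i)
    (hy : y ∈ extGrading K V j) : x * y ∈ extGrading K V (i + j) := by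
  rcases lt_or_ge i 0 with hi | hi
  · rw [extGrading_of_neg hi, Submodule.mem_bot] at hx
    simp [hx]
  rcases lt_or_ge j 0 with hj | hj
  · rw [extGrading_of_neg hj, Submodule.mem_bot] at hy
    simp [hy]
  lift i to ℕ using hi
  lift j to ℕ using hj
  rw [← Nat.cast_add, extGrading_natCast] at *
  exact SetLike.mul_mem_graded hx hy

theorem ι_mem_exteriorPower_one (v : V) : ι K v ∈ ⋀[K]^1 V := by
  rw [ExteriorAlgebra.exteriorPower, pow_one]
  exact LinearMap.mem_range_self _ _

theorem ι_mem_extGrading (v : V) : ι K v ∈ extGrading K V 1 := by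
  have := extGrading_natCast (K := K) (V := V) 1
  rw [Nat.cast_one] at this
  rw [this]
  exact ι_mem_exteriorPower_one v

theorem one_mem_extGrading : (1 : ExteriorAlgebra K V) ∈ extGrading K V 0 := by
  have := extGrading_natCast (K := K) (V := V) 0
  rw [Nat.cast_zero] at this
  rw [this, ExteriorAlgebra.exteriorPower, pow_zero]
  exact Submodule.one_le.1 le_rfl

theorem mem_extGrading_zero {x : ExteriorAlgebra K V} (hx : x ∈ extGrading K V 0) :
    ∃ c : K, x = algebraMap K _ c := by
  have := extGrading_natCast (K := K) (V := V) 0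
  rw [Nat.cast_zero] at this
  rw [this, ExteriorAlgebra.exteriorPower, pow_zero, Submodule.mem_one] at hx
  obtain ⟨c, rfl⟩ := hx
  exact ⟨c, rfl⟩

theorem formProd_mem_extGrading (l : List V) :
    formProd K l ∈ extGrading K V (l.length : ℤ) := by
  induction l with
  | nil => exact one_mem_extGrading
  | cons v l ih =>
    rw [formProd_cons, List.length_cons, Nat.cast_add, Nat.cast_one]
    exact mul_mem_extGrading ih (ι_mem_extGrading v)

theorem iSup_extGrading : ⨆ j, extGrading K V j = ⊤ := by
  rw [eq_top_iff, ← (DirectSum.Decomposition.isInternal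
    (fun p : ℕ => ⋀[K]^p V)).submodule_iSup_eq_top]
  refine iSup_le fun p => ?_
  rw [← extGrading_natCast]
  exact le_iSup _ _

/-- The projection of `E` onto the component of degree `j`. -/
noncomputable def extProj (K : Type*) [Field K] (V : Type*) [AddCommGroup V] [Module K V] (j : ℤ) :
    ExteriorAlgebra K V →ₗ[K] ExteriorAlgebra K V :=
  if 0 ≤ j then GradedAlgebra.proj (fun p : ℕ => ⋀[K]^p V) j.toNat else 0

theorem extProj_mem (j : ℤ) (x : ExteriorAlgebra K V) : extProj K V j x ∈ extGrading K V j := by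
  unfold extProj extGrading
  split_ifs
  · exact SetLike.coe_mem _
  · simp

theorem extProj_of_mem {j : ℤ} {x : ExteriorAlgebra K V} (hx : x ∈ extGrading K V j) :
    extProj K V j x = x := by
  unfold extProj extGrading at *
  split_ifs at *
  · rw [GradedAlgebra.proj_apply]
    exact DirectSum.decompose_of_mem_same _ hx
  · simp_all

theorem extProj_of_mem_ne {i j : ℤ} (hij : i ≠ j) {x : ExteriorAlgebra K V}
    (hx : x ∈ extGrading K V i) : extProj K V j x = 0 := by
  unfold extProj extGrading at *
  split_ifs at hx ⊢
  · rw [GradedAlgebra.proj_apply]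
    exact DirectSum.decompose_of_mem_ne _ hx (by omega)
  · rw [(Submodule.mem_bot K).1 hx, map_zero]
  · simp
  · simp

theorem hasProjections_extGrading : HasProjections (extGrading K V) := fun j =>
  ⟨extProj K V j, extProj_mem j, fun _ => extProj_of_mem, fun _ h _ => extProj_of_mem_ne h⟩

variable (K V) in
theorem isGradedModule_extGrading : IsGradedModule V (extGrading K V) where
  smul_mem v j x hx := by
    rw [add_comm]
    exact mul_mem_extGrading (ι_mem_extGrading v) hx
  iSup_eq_top := iSup_extGrading
  hasProjections := hasProjections_extGrading
  bddBelow := ⟨0, fun _ => extGrading_of_neg⟩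

theorem mul_ι_eq {p : ℕ} {x : ExteriorAlgebra K V} (hx : x ∈ ⋀[K]^p V) (v : V) :
    x * ι K v = (-1 : K) ^ p • (ι K v * x) := by
  induction hx using Submodule.pow_induction_on_left' with
  | algebraMap r => simp [Algebra.commutes]
  | add x y i _ _ hx hy => rw [add_mul, hx, hy, mul_add, smul_add]
  | mem_mul m hm i x _ ih =>
    obtain ⟨w, rfl⟩ := hm
    rw [mul_assoc, ih, mul_smul_comm, ← mul_assoc, ι_mul_ι_swap, neg_mul, mul_assoc, pow_succ]
    simp

theorem exists_mul_formProd_eq_smul (j : ℤ) (l : List V) : ∃ c : K, c ≠ 0 ∧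
    ∀ x ∈ extGrading K V j, x * formProd K l = c • (formProd K l * x) := by
  rcases lt_or_ge j 0 with hj | hj
  · refine ⟨1, one_ne_zero, fun x hx => ?_⟩
    rw [extGrading_of_neg hj, Submodule.mem_bot] at hx
    simp [hx]
  lift j to ℕ using hj
  simp_rw [extGrading_natCast]
  induction l with
  | nil => exact ⟨1, one_ne_zero, fun x _ => by simp⟩
  | cons v l ih =>
    obtain ⟨c, hc, h⟩ := ih
    refine ⟨c * (-1) ^ j, mul_ne_zero hc (pow_ne_zero _ (by simp)), fun x hx => ?_⟩
    rw [formProd_cons, ← mul_assoc, h x hx, smul_mul_assoc, mul_assoc, mul_ι_eq hx, mul_smul_comm,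
      smul_smul, mul_assoc]

theorem extGrading_eq_bot_of_gt [FiniteDimensional K V] {j : ℤ}
    (hj : (Module.finrank K V : ℤ) < j) : extGrading K V j = ⊥ := by
  lift j to ℕ using (by omega)
  rw [extGrading_natCast]
  have h := exteriorPower.finrank_eq (R := K) (M := V) j
  rw [Nat.choose_eq_zero_of_lt (by omega)] at h
  exact Submodule.finrank_eq_zero.1 h

instance finiteDimensional_exteriorAlgebra [FiniteDimensional K V] :
    FiniteDimensional K (ExteriorAlgebra K V) := by
  rw [FiniteDimensional, Module.finite_def]
  have h : ⨆ i : Fin (Module.finrank K V + 1), ⋀[K]^(i : ℕ) V = ⊤ := by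
    rw [eq_top_iff, ← iSup_extGrading (K := K) (V := V)]
    refine iSup_le fun j => ?_
    rcases lt_or_ge j 0 with hj | hj
    · simp [extGrading_of_neg hj]
    rcases lt_or_ge (Module.finrank K V : ℤ) j with hj' | hj'
    · simp [extGrading_eq_bot_of_gt hj']
    lift j to ℕ using hj
    rw [extGrading_natCast]
    exact le_iSup (fun i : Fin (Module.finrank K V + 1) => ⋀[K]^(i : ℕ) V)
      ⟨j, by omega⟩
  rw [← h]
  exact Submodule.fg_iSup _ fun i => Module.Finite.iff_fg.1 inferInstance

end ExtGrading

/-! ### The Cartan complex, and the removal of one regular form. -/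

section Cartan

variable {K : Type*} [Field K] {V : Type*} [AddCommGroup V] [Module K V]
variable {M : Type*} [AddCommGroup M] [Module K M] [Module (ExteriorAlgebra K V) M]
variable {N : Type*} [AddCommGroup N] [Module K N] [Module (ExteriorAlgebra K V) N]

variable (K) in
/-- The differential of the Cartan complex of the `E`-module `M` with respect to a list of linear
forms, in the monomial basis of the divided power algebra. -/
noncomputable def cartanD (l : List V) :
    ((Fin l.length →₀ ℕ) → M) →+ ((Fin l.length →₀ ℕ) → M) where
  toFun z a := ∑ i, ι K (l.get i) • z (a + Finsupp.single i 1)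
  map_zero' := by ext; simp
  map_add' z w := by ext; simp [Finset.sum_add_distrib]

theorem cartanD_apply (l : List V) (z : (Fin l.length →₀ ℕ) → M) (a : Fin l.length →₀ ℕ) :
    cartanD K l z a = ∑ i, ι K (l.get i) • z (a + Finsupp.single i 1) := rfl

theorem cartanD_nil (z : (Fin ([] : List V).length →₀ ℕ) → M) : cartanD K [] z = 0 := by
  ext a
  rw [cartanD_apply, Pi.zero_apply]
  exact Finset.sum_eq_zero fun i => i.elim0

theorem cartanD_map (l : List V) (T : M →ₗ[ExteriorAlgebra K V] N)
    (z : (Fin l.length →₀ ℕ) → M) :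
    cartanD K l (fun a => T (z a)) = fun a => T (cartanD K l z a) := by
  ext a
  simp [cartanD_apply]

theorem cartanD_cons_apply (v : V) (l : List V) (z : (Fin (l.length + 1) →₀ ℕ) → M) (c : ℕ)
    (a : Fin l.length →₀ ℕ) :
    cartanD K (v :: l) z (Finsupp.cons c a) =
      ι K v • z (Finsupp.cons (c + 1) a) + cartanD K l (fun b => z (Finsupp.cons c b)) a := by
  have h0 : Finsupp.cons c a + Finsupp.single 0 1 = Finsupp.cons (c + 1) a := by
    ext i
    refine Fin.cases ?_ (fun i => ?_) i <;> simp
  have h1 : ∀ i : Fin l.length, Finsupp.cons c a + Finsupp.single i.succ 1 =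
      Finsupp.cons c (a + Finsupp.single i 1) := fun i => by
    ext k
    refine Fin.cases ?_ (fun k => ?_) k
    · simp
    · simp [Finsupp.single_apply]
  rw [cartanD_apply, cartanD_apply]
  refine (Fin.sum_univ_succ _).trans ?_
  congr 1
  · rw [← h0]; rfl
  · refine Finset.sum_congr rfl fun i _ => ?_
    rw [← h1]; rfl

theorem cartanD_ι_smul (l : List V) (v : V) (z : (Fin l.length →₀ ℕ) → M) :
    cartanD K l (fun a => ι K v • z a) = fun a => -(ι K v • cartanD K l z a) := by
  ext a
  rw [cartanD_apply, cartanD_apply, Finset.smul_sum, ← Finset.sum_neg_distrib]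
  refine Finset.sum_congr rfl fun i _ => ?_
  rw [smul_smul, ι_mul_ι_swap, neg_smul, mul_smul]

theorem ι_smul_ι_smul (v : V) (m : M) : ι K v • ι K v • m = 0 := by
  rw [smul_smul, ExteriorAlgebra.ι_sq_zero, zero_smul]

/-- The family `z(a + e_i + e_j)` is symmetric in `i` and `j` while `v_i v_j` is alternating, so no
signs are needed in the differential. -/
theorem cartanD_cartanD (l : List V) (z : (Fin l.length →₀ ℕ) → M) :
    cartanD K l (cartanD K l z) = 0 := by
  induction l with
  | nil => rw [cartanD_nil]
  | cons v l ih =>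
    ext a
    obtain ⟨c, b, rfl⟩ : ∃ c b, a = Finsupp.cons c b := ⟨_, _, (Finsupp.cons_tail a).symm⟩
    rw [cartanD_cons_apply, cartanD_cons_apply]
    simp_rw [cartanD_cons_apply]
    have h := map_add (cartanD K l) (fun b => ι K v • z (Finsupp.cons (c + 1) b))
      (cartanD K l (fun b => z (Finsupp.cons c b)))
    rw [ih, cartanD_ι_smul] at h
    have h' := congrFun h b
    simp only [Pi.add_apply, Pi.zero_apply, add_zero] at h'
    rw [Pi.zero_apply, smul_add, ι_smul_ι_smul, zero_add, ← add_neg_cancel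
      (ι K v • cartanD K l (fun b => z (Finsupp.cons (c + 1) b)) b), ← h']
    rfl

/-- The Cartan complex is exact in all homological positions at the component of degree `j`. -/
def CartanExact (l : List V) (𝓜 : ℤ → Submodule K M) (j : ℤ) : Prop :=
  ∀ z : (Fin l.length →₀ ℕ) → M, (∀ a, z a ∈ 𝓜 j) → cartanD K l z = 0 →
    ∃ w : (Fin l.length →₀ ℕ) → M, (∀ a, w a ∈ 𝓜 (j - 1)) ∧ cartanD K l w = z

theorem cartanD_mem {𝓜 : ℤ → Submodule K M}
    (hM : ∀ (v : V) (j : ℤ), ∀ x ∈ 𝓜 j, ι K v • x ∈ 𝓜 (j + 1)) {l : List V} {j : ℤ}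
    {z : (Fin l.length →₀ ℕ) → M} (hz : ∀ a, z a ∈ 𝓜 j) (a) : cartanD K l z a ∈ 𝓜 (j + 1) := by
  rw [cartanD_apply]
  exact sum_mem fun _ _ => hM _ _ _ (hz _)

/-- Here `𝓜'` grades `vM ≅ M/vM`. Sort a family by the exponent `c` of `v`: the differential becomes
`(Dz)_c = v z_{c+1} + D_l z_c`. Regularity of `v` allows this to be solved for the part of index `c
+ 1` once the part of index `c` is known, so only the part of index `0` carries homology. -/
theorem cartanExact_cons_iff {𝓜 𝓜' : ℤ → Submodule K M} {v : V} (l : List V)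
    (hM : ∀ (v : V) (j : ℤ), ∀ x ∈ 𝓜 j, ι K v • x ∈ 𝓜 (j + 1))
    (hreg : ∀ j, ∀ x ∈ 𝓜 j, ι K v • x = 0 → ∃ y ∈ 𝓜 (j - 1), ι K v • y = x)
    (hM' : ∀ j x, x ∈ 𝓜' (j + 1) ↔ ∃ y ∈ 𝓜 j, ι K v • y = x) (j : ℤ) :
    CartanExact (v :: l) 𝓜 j ↔ CartanExact l 𝓜' (j + 1) := by
  constructor
  · intro H z' hz' hz0
    choose y₀ hy₀ hy₀' using fun a => (hM' j _).1 (hz' a)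
    -- The property `P y` is what permits solving `D_l y + v y' = 0`, and it is inherited by `y'`.
    -- Iterating from a lift `y₀` of `z'` produces a cycle of the full complex.
    let P : ((Fin l.length →₀ ℕ) → M) → Prop := fun y =>
      (∀ a, y a ∈ 𝓜 j) ∧ ∀ a, ι K v • cartanD K l y a = 0
    have step : ∀ y : {y // P y}, ∃ y' : {y // P y}, ∀ a, cartanD K l y.1 a + ι K v • y'.1 a = 0 := by
      rintro ⟨y, hy, hy'⟩
      choose u hu hu' using fun a => hreg _ _ (cartanD_mem hM hy a) (hy' a)
      simp only [add_sub_cancel_right] at hu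
      refine ⟨⟨fun a => -u a, fun a => neg_mem (hu a), fun a => ?_⟩, fun a => ?_⟩
      · have h1 := cartanD_ι_smul (K := K) l v (fun a => -u a)
        have h2 : (fun a => ι K v • -u a) = -cartanD K l y := by
          ext a; simp [hu']
        rw [h2, map_neg, cartanD_cartanD, neg_zero] at h1
        have := congrFun h1 a
        simpa using this.symm
      · simp [hu']
    choose next hnext using step
    have hP₀ : P y₀ := by
      refine ⟨hy₀, fun a => ?_⟩
      have h1 := cartanD_ι_smul (K := K) l v y₀
      have h2 : (fun a => ι K v • y₀ a) = z' := funext hy₀'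
      rw [h2, hz0] at h1
      simpa using (congrFun h1 a).symm
    let Y : ℕ → {y // P y} := fun c => next^[c] ⟨y₀, hP₀⟩
    have hY : ∀ c a, cartanD K l (Y c).1 a + ι K v • (Y (c + 1)).1 a = 0 := fun c a => by
      simp only [Y, Function.iterate_succ_apply']
      exact hnext _ a
    obtain ⟨w, hw, hw'⟩ := H (fun a => (Y (a 0)).1 (Finsupp.tail a)) (fun a => (Y _).2.1 _) (by
      ext a
      obtain ⟨c, b, rfl⟩ : ∃ c b, a = Finsupp.cons c b := ⟨_, _, (Finsupp.cons_tail a).symm⟩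
      rw [cartanD_cons_apply]
      simp only [Finsupp.cons_zero, Finsupp.tail_cons]
      rw [add_comm]
      exact hY c b)
    -- With `y₀ = v w_1 + D_l w_0` one gets `z' = v y₀ = v D_l w_0 = -D_l (v w_0)`.
    refine ⟨fun b => -(ι K v • w (Finsupp.cons 0 b)), fun b => ?_, ?_⟩
    · rw [show j + 1 - 1 = j - 1 + 1 by ring]
      exact neg_mem ((hM' _ _).2 ⟨_, hw _, rfl⟩)
    · ext b
      have h1 := congrFun hw' (Finsupp.cons 0 b)
      rw [cartanD_cons_apply] at h1
      simp only [Finsupp.cons_zero, Finsupp.tail_cons] at h1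
      have h2 := cartanD_ι_smul (K := K) l v (fun b => w (Finsupp.cons 0 b))
      have h3 := map_neg (cartanD K l) (fun b => ι K v • w (Finsupp.cons 0 b))
      rw [h2] at h3
      have h4 := congrFun h3 b
      rw [Pi.neg_apply, neg_neg] at h4
      refine h4.trans ?_
      have h5 : (Y 0).1 b = y₀ b := rfl
      rw [← hy₀', ← h5, ← h1, smul_add, ι_smul_ι_smul, zero_add]
  · intro H z hz hz0
    have hz0' : ∀ c b, ι K v • z (Finsupp.cons (c + 1) b) +
        cartanD K l (fun b => z (Finsupp.cons c b)) b = 0 := fun c b => by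
      rw [← cartanD_cons_apply, hz0]; rfl
    -- The part `z_c - D_l w_c` must be killed by `v` in order to equal `v w_{c+1}`. The initial
    -- `w_0` comes from bounding the cycle `v z_0` inside `vM`.
    let P : ℕ → ((Fin l.length →₀ ℕ) → M) → Prop := fun c w =>
      (∀ a, w a ∈ 𝓜 (j - 1)) ∧ ∀ b, ι K v • (z (Finsupp.cons c b) - cartanD K l w b) = 0
    have step : ∀ c (w : {w // P c w}), ∃ w' : {w // P (c + 1) w},
        ∀ b, z (Finsupp.cons c b) - cartanD K l w.1 b = ι K v • w'.1 b := by
      rintro c ⟨w, hw, hw'⟩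
      have hmem : ∀ b, z (Finsupp.cons c b) - cartanD K l w b ∈ 𝓜 j := fun b => by
        refine sub_mem (hz _) ?_
        have := cartanD_mem hM hw b
        rwa [sub_add_cancel] at this
      choose u hu hu' using fun b => hreg _ _ (hmem b) (hw' b)
      refine ⟨⟨u, hu, fun b => ?_⟩, fun b => (hu' b).symm⟩
      have h1 := congrFun (cartanD_ι_smul (K := K) l v u) b
      have h2 : (fun b => ι K v • u b) = (fun b => z (Finsupp.cons c b)) - cartanD K l w :=
        funext hu'
      rw [h2, map_sub, cartanD_cartanD, sub_zero] at h1
      rw [smul_sub, sub_eq_add_neg, ← h1]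
      exact hz0' c b
    obtain ⟨w₀, hw₀⟩ : ∃ w₀, P 0 w₀ := by
      obtain ⟨w', hw', hw''⟩ := H (fun b => ι K v • z (Finsupp.cons 0 b))
        (fun b => (hM' _ _).2 ⟨_, hz _, rfl⟩) (by
          rw [cartanD_ι_smul]
          ext b
          rw [← smul_neg, ← eq_neg_of_add_eq_zero_left (hz0' 0 b), ι_smul_ι_smul]
          rfl)
      rw [show j + 1 - 1 = j - 1 + 1 by ring] at hw'
      choose u hu hu' using fun b => (hM' _ _).1 (hw' b)
      refine ⟨fun b => -u b, fun b => neg_mem (hu b), fun b => ?_⟩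
      have h1 := cartanD_ι_smul (K := K) l v u
      rw [funext hu', hw''] at h1
      have h2 := map_neg (cartanD K l) u
      have h3 := congrFun h1 b
      have h4 := congrFun h2 b
      have h5 : cartanD K l (fun b => -u b) b = -cartanD K l u b := h4
      rw [h5, smul_sub, smul_neg, h3, sub_self]
    choose next hnext using step
    let W : ∀ c, {w // P c w} := fun c => Nat.rec ⟨w₀, hw₀⟩ next c
    have hW : ∀ c b, z (Finsupp.cons c b) - cartanD K l (W c).1 b = ι K v • (W (c + 1)).1 b :=
      fun c b => hnext c (W c) b
    refine ⟨fun a => (W (a 0)).1 (Finsupp.tail a), fun a => (W _).2.1 _, ?_⟩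
    ext a
    obtain ⟨c, b, rfl⟩ : ∃ c b, a = Finsupp.cons c b := ⟨_, _, (Finsupp.cons_tail a).symm⟩
    rw [cartanD_cons_apply]
    simp only [Finsupp.cons_zero, Finsupp.tail_cons]
    rw [← hW c b]
    exact sub_add_cancel _ _

/-- A cycle is bounded after transport to `N`, and the bounding family lives in degree `j - 1`; so
surjectivity is needed in that degree alone. -/
theorem CartanExact.of_map {l : List V} {𝓜 : ℤ → Submodule K M} {𝓝 : ℤ → Submodule K N} {j : ℤ}
    (h : CartanExact l 𝓝 j) (T : M →ₗ[ExteriorAlgebra K V] N) (hT : Function.Injective T)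
    (hj : ∀ x ∈ 𝓜 j, T x ∈ 𝓝 j) (hj' : ∀ y ∈ 𝓝 (j - 1), ∃ x ∈ 𝓜 (j - 1), T x = y) :
    CartanExact l 𝓜 j := by
  intro z hz hz0
  obtain ⟨w, hw, hw'⟩ := h (fun a => T (z a)) (fun a => hj _ (hz a)) (by
    rw [cartanD_map, hz0]; ext; simp)
  choose u hu hu' using fun a => hj' _ (hw a)
  refine ⟨u, hu, funext fun a => hT ?_⟩
  have := congrFun (cartanD_map l T u) a
  rw [← this, funext hu', hw']

theorem cartanExact_of_eq_bot {l : List V} {𝓜 : ℤ → Submodule K M} {j : ℤ} (h : 𝓜 j = ⊥) :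
    CartanExact l 𝓜 j := by
  intro z hz _
  refine ⟨0, fun _ => zero_mem _, ?_⟩
  ext a
  have := hz a
  rw [h, Submodule.mem_bot] at this
  rw [this, map_zero]; rfl

theorem cartanExact_nil_iff {𝓜 : ℤ → Submodule K M} {j : ℤ} :
    CartanExact ([] : List V) 𝓜 j ↔ 𝓜 j = ⊥ := by
  refine ⟨fun h => ?_, cartanExact_of_eq_bot⟩
  rw [eq_bot_iff]
  intro x hx
  obtain ⟨w, -, hw⟩ := h (fun _ => x) (fun _ => hx) (cartanD_nil _)
  rw [cartanD_nil] at hw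
  exact (congrFun hw 0).symm

end Cartan

/-! ### Removal of a whole regular sequence from the Cartan complex. -/

section Transfer

variable {K : Type*} [Field K] {V : Type*} [AddCommGroup V] [Module K V]
variable {M : Type*} [AddCommGroup M] [Module K M] [Module (ExteriorAlgebra K V) M]
  [IsScalarTower K (ExteriorAlgebra K V) M]

/-- The grading of `F M`, where `F ∈ E` is homogeneous of degree `d`. -/
def smulGrading (F : ExteriorAlgebra K V) (d : ℤ) (𝓜 : ℤ → Submodule K M) (j : ℤ) :
    Submodule K M :=
  (𝓜 (j - d)).map (Algebra.lsmul K K M F)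

theorem mem_smulGrading {F : ExteriorAlgebra K V} {d : ℤ} {𝓜 : ℤ → Submodule K M} {j : ℤ} {x : M} :
    x ∈ smulGrading F d 𝓜 j ↔ ∃ y ∈ 𝓜 (j - d), F • y = x := Iff.rfl

/-- The linear form `v` is regular on `F M`, compatibly with the grading of `M`. -/
def GradedRegular (F : ExteriorAlgebra K V) (v : V) (𝓜 : ℤ → Submodule K M) : Prop :=
  ∀ j, ∀ x ∈ 𝓜 j, ι K v • F • x = 0 → ∃ y ∈ 𝓜 (j - 1), ι K v • F • y = F • x

/-- A list of linear forms is a regular sequence on the graded module `M`. -/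
def GradedRegularSeq (f : List V) (𝓜 : ℤ → Submodule K M) : Prop :=
  ∀ l₁ v l₂, f = l₁ ++ v :: l₂ → GradedRegular (formProd K l₁) v 𝓜

theorem ι_smul_mem_smulGrading {𝓜 : ℤ → Submodule K M}
    (hM : ∀ (v : V) (j : ℤ), ∀ x ∈ 𝓜 j, ι K v • x ∈ 𝓜 (j + 1)) (l : List V) (v : V) (j : ℤ) (x : M)
    (hx : x ∈ smulGrading (formProd K l) l.length 𝓜 j) :
    ι K v • x ∈ smulGrading (formProd K l) l.length 𝓜 (j + 1) := by
  obtain ⟨y, hy, rfl⟩ := mem_smulGrading.1 hx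
  refine mem_smulGrading.2 ⟨(-1 : K) ^ l.length • ι K v • y, ?_, ?_⟩
  · rw [show j + 1 - (l.length : ℤ) = j - l.length + 1 by ring]
    exact Submodule.smul_mem _ _ (hM _ _ _ hy)
  · rw [smul_smul (ι K v), ι_mul_formProd, smul_assoc, mul_smul,
      smul_algebra_smul_comm ((-1 : K) ^ l.length) (formProd K l)]

theorem smulGrading_one_zero (𝓜 : ℤ → Submodule K M) :
    smulGrading (1 : ExteriorAlgebra K V) 0 𝓜 = 𝓜 := by
  ext j x
  rw [mem_smulGrading]
  simp

/-- Passing to `F M`, where `F` is the product of a regular sequence, does not change the homology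
of the Cartan complex. -/
theorem GradedRegularSeq.cartanExact_iff {𝓜 : ℤ → Submodule K M} {f : List V}
    (hf : GradedRegularSeq f 𝓜)
    (hM : ∀ (v : V) (j : ℤ), ∀ x ∈ 𝓜 j, ι K v • x ∈ 𝓜 (j + 1)) (g : List V) (j : ℤ) :
    CartanExact (f ++ g) 𝓜 j ↔
      CartanExact g (smulGrading (formProd K f) f.length 𝓜) (j + f.length) := by
  -- The induction moves the forms one at a time from the list of the complex into the product that
  -- multiplies `M`.
  suffices H : ∀ l₂ l₁ : List V, f = l₁ ++ l₂ → ∀ j,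
      (CartanExact (l₂ ++ g) (smulGrading (formProd K l₁) l₁.length 𝓜) j ↔
        CartanExact g (smulGrading (formProd K f) f.length 𝓜) (j + l₂.length)) by
    have := H f [] rfl j
    simpa only [formProd_nil, List.length_nil, Nat.cast_zero, smulGrading_one_zero] using this
  intro l₂
  induction l₂ with
  | nil =>
    rintro l₁ rfl j
    simp
  | cons v l₂ ih =>
    intro l₁ h j
    have h' : f = (l₁ ++ [v]) ++ l₂ := by simp [h]
    have key := ih _ h' (j + 1)
    have hreg := hf l₁ v l₂ h
    rw [show j + 1 + (l₂.length : ℤ) = j + (v :: l₂).length by simp; ring] at key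
    rw [← key, List.cons_append]
    refine cartanExact_cons_iff _ (ι_smul_mem_smulGrading hM l₁) ?_ ?_ j
    · rintro j x hx hx0
      obtain ⟨y, hy, rfl⟩ := mem_smulGrading.1 hx
      obtain ⟨u, hu, hu'⟩ := hreg _ y hy hx0
      refine ⟨formProd K l₁ • u, mem_smulGrading.2 ⟨u, ?_, rfl⟩, hu'⟩
      rwa [show j - 1 - (l₁.length : ℤ) = j - l₁.length - 1 by ring]
    · intro j x
      rw [mem_smulGrading, formProd_concat, List.length_append, List.length_singleton,
        show j + 1 - ((l₁.length + 1 : ℕ) : ℤ) = j - l₁.length by push_cast; ring]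
      simp_rw [mem_smulGrading, mul_smul]
      constructor
      · rintro ⟨y, hy, rfl⟩
        exact ⟨_, ⟨y, hy, rfl⟩, rfl⟩
      · rintro ⟨_, ⟨y, hy, rfl⟩, rfl⟩
        exact ⟨y, hy, rfl⟩

end Transfer

/-! ### The gradings of `I`, of `E/I` and of its dual. -/

section Gradings

variable {K : Type*} [Field K] {V : Type*} [AddCommGroup V] [Module K V]

theorem IsGradedModule.formProd_smul_mem {M : Type*} [AddCommGroup M] [Module K M]
    [Module (ExteriorAlgebra K V) M] {𝓜 : ℤ → Submodule K M} (h𝓜 : IsGradedModule V 𝓜)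
    (l : List V) {j : ℤ} {x : M} (hx : x ∈ 𝓜 j) : formProd K l • x ∈ 𝓜 (j + l.length) := by
  induction l using List.reverseRecOn with
  | nil => simpa using hx
  | append_singleton l v ih =>
    rw [formProd_concat, mul_smul, List.length_append, List.length_singleton, Nat.cast_add,
      ← add_assoc]
    exact h𝓜.smul_mem _ _ _ ih

theorem sum_extProj [FiniteDimensional K V] (x : ExteriorAlgebra K V) :
    ∑ p ∈ Finset.range (Module.finrank K V + 1), extProj K V p x = x := by
  have hx : x ∈ ⨆ j, extGrading K V j := iSup_extGrading (K := K) (V := V) ▸ Submodule.mem_top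
  induction hx using Submodule.iSup_induction' with
  | mem j x hx =>
    rcases lt_or_ge j 0 with hj | hj
    · rw [extGrading_of_neg hj, Submodule.mem_bot] at hx
      simp [hx]
    rcases lt_or_ge (Module.finrank K V : ℤ) j with hj' | hj'
    · rw [extGrading_eq_bot_of_gt hj', Submodule.mem_bot] at hx
      simp [hx]
    lift j to ℕ using hj
    rw [Finset.sum_eq_single j, extProj_of_mem hx]
    · intro p _ hp
      exact extProj_of_mem_ne (by exact_mod_cast hp.symm) hx
    · intro h
      simp at h
      omega
  | zero => simp
  | add x y _ _ hx hy => simp_rw [map_add, Finset.sum_add_distrib, hx, hy]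

theorem extProj_mem_ideal {I : Ideal (ExteriorAlgebra K V)}
    (hI : I.IsHomogeneous (fun p : ℕ => ⋀[K]^p V)) (j : ℤ) {x : ExteriorAlgebra K V}
    (hx : x ∈ I) : extProj K V j x ∈ I := by
  unfold extProj
  split_ifs
  · exact hI _ hx
  · simp

variable [FiniteDimensional K V] {I : Ideal (ExteriorAlgebra K V)}

theorem mem_idealGrading {j : ℤ} {x : I} :
    x ∈ idealGrading I j ↔ (x : ExteriorAlgebra K V) ∈ extGrading K V j := Iff.rfl

theorem mem_quotientGrading {j : ℤ} {x : ExteriorAlgebra K V ⧸ I} :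
    x ∈ quotientGrading I j ↔ ∃ y ∈ extGrading K V j, Submodule.Quotient.mk y = x := Iff.rfl

theorem isGradedModule_idealGrading (hI : I.IsHomogeneous (fun p : ℕ => ⋀[K]^p V)) :
    IsGradedModule V (idealGrading I) := by
  let π : ℤ → I →ₗ[K] I := fun j =>
    { toFun := fun x => ⟨extProj K V j x, extProj_mem_ideal hI j x.2⟩
      map_add' := fun x y => Subtype.ext (by simp)
      map_smul' := fun c x => Subtype.ext (by simp) }
  refine ⟨fun v j x hx => (isGradedModule_extGrading K V).smul_mem v j _ hx, ?_,
    fun j => ⟨π j, fun x => extProj_mem j _, fun x hx => Subtype.ext (extProj_of_mem hx),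
      fun i hij x hx => Subtype.ext (extProj_of_mem_ne hij hx)⟩,
    ⟨0, fun j hj => ?_⟩⟩
  · rw [eq_top_iff]
    intro x _
    have h : x = ∑ p ∈ Finset.range (Module.finrank K V + 1), π p x :=
      Subtype.ext (by rw [AddSubmonoidClass.coe_finsetSum]; exact (sum_extProj _).symm)
    rw [h]
    exact sum_mem fun p _ => Submodule.mem_iSup_of_mem (p : ℤ) (extProj_mem _ _)
  · rw [eq_bot_iff]
    intro x hx
    rw [mem_idealGrading, extGrading_of_neg hj, Submodule.mem_bot] at hx
    exact Subtype.ext hx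

/-- The projection of `E/I` onto its component of degree `j`. -/
noncomputable def quotientProj (hI : I.IsHomogeneous (fun p : ℕ => ⋀[K]^p V)) (j : ℤ) :
    (ExteriorAlgebra K V ⧸ I) →ₗ[K] ExteriorAlgebra K V ⧸ I :=
  (Submodule.Quotient.restrictScalarsEquiv K I).toLinearMap ∘ₗ
    Submodule.mapQ (I.restrictScalars K) (I.restrictScalars K) (extProj K V j)
      (fun _ hx => extProj_mem_ideal hI j hx) ∘ₗ
    (Submodule.Quotient.restrictScalarsEquiv K I).symm.toLinearMap

theorem quotientProj_mk (hI : I.IsHomogeneous (fun p : ℕ => ⋀[K]^p V)) (j : ℤ)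
    (x : ExteriorAlgebra K V) :
    quotientProj hI j (Submodule.Quotient.mk x) = Submodule.Quotient.mk (extProj K V j x) := rfl

theorem quotientProj_mem (hI : I.IsHomogeneous (fun p : ℕ => ⋀[K]^p V)) (j : ℤ)
    (x : ExteriorAlgebra K V ⧸ I) : quotientProj hI j x ∈ quotientGrading I j := by
  obtain ⟨x, rfl⟩ := Submodule.Quotient.mk_surjective _ x
  exact mem_quotientGrading.2 ⟨_, extProj_mem j x, rfl⟩

theorem quotientProj_of_mem (hI : I.IsHomogeneous (fun p : ℕ => ⋀[K]^p V)) {j : ℤ}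
    {x : ExteriorAlgebra K V ⧸ I} (hx : x ∈ quotientGrading I j) : quotientProj hI j x = x := by
  obtain ⟨y, hy, rfl⟩ := mem_quotientGrading.1 hx
  rw [quotientProj_mk, extProj_of_mem hy]

theorem quotientProj_of_mem_ne (hI : I.IsHomogeneous (fun p : ℕ => ⋀[K]^p V)) {i j : ℤ}
    (hij : i ≠ j) {x : ExteriorAlgebra K V ⧸ I} (hx : x ∈ quotientGrading I i) :
    quotientProj hI j x = 0 := by
  obtain ⟨y, hy, rfl⟩ := mem_quotientGrading.1 hx
  rw [quotientProj_mk, extProj_of_mem_ne hij hy, Submodule.Quotient.mk_zero]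

theorem sum_quotientProj (hI : I.IsHomogeneous (fun p : ℕ => ⋀[K]^p V))
    (x : ExteriorAlgebra K V ⧸ I) :
    ∑ p ∈ Finset.range (Module.finrank K V + 1), quotientProj hI p x = x := by
  obtain ⟨x, rfl⟩ := Submodule.Quotient.mk_surjective _ x
  simp_rw [quotientProj_mk]
  conv_rhs => rw [← sum_extProj x]
  exact (map_sum I.mkQ _ _).symm

theorem isGradedModule_quotientGrading (hI : I.IsHomogeneous (fun p : ℕ => ⋀[K]^p V)) :
    IsGradedModule V (quotientGrading I) := by
  refine ⟨fun v j x hx => ?_, ?_, fun j => ⟨quotientProj hI j, quotientProj_mem hI j,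
    fun x hx => quotientProj_of_mem hI hx, fun i hij x hx => quotientProj_of_mem_ne hI hij hx⟩,
    ⟨0, fun j hj => ?_⟩⟩
  · obtain ⟨y, hy, rfl⟩ := mem_quotientGrading.1 hx
    exact mem_quotientGrading.2 ⟨_, (isGradedModule_extGrading K V).smul_mem v j y hy, rfl⟩
  · rw [eq_top_iff]
    intro x _
    rw [← sum_quotientProj hI x]
    exact sum_mem fun p _ => Submodule.mem_iSup_of_mem (p : ℤ) (quotientProj_mem _ _ _)
  · rw [quotientGrading, extGrading_of_neg hj, Submodule.map_bot]

section Dual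

theorem quotientDual_ext {φ ψ : QuotientDual I}
    (h : ∀ x : ExteriorAlgebra K V, φ (Submodule.Quotient.mk x) = ψ (Submodule.Quotient.mk x)) :
    φ = ψ :=
  LinearMap.ext fun a => by
    obtain ⟨x, rfl⟩ := Submodule.Quotient.mk_surjective _ a
    exact h x

/-- The functional `φ` restricted to the component of degree `p` of `E/I`. -/
noncomputable def quotientDualProj (hI : I.IsHomogeneous (fun p : ℕ => ⋀[K]^p V)) (p : ℤ) :
    QuotientDual I →ₗ[K] QuotientDual I where
  toFun φ := (show Module.Dual K (ExteriorAlgebra K V ⧸ I) from φ) ∘ₗ quotientProj hI p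
  map_add' _ _ := rfl
  map_smul' _ _ := rfl

theorem quotientDualProj_apply (hI : I.IsHomogeneous (fun p : ℕ => ⋀[K]^p V)) (p : ℤ)
    (φ : QuotientDual I) (a : ExteriorAlgebra K V ⧸ I) :
    quotientDualProj hI p φ a = φ (quotientProj hI p a) := rfl

theorem quotientDualProj_mem (hI : I.IsHomogeneous (fun p : ℕ => ⋀[K]^p V)) (p : ℤ)
    (φ : QuotientDual I) : quotientDualProj hI p φ ∈ quotientDualGrading I (-p) := by
  intro i hi a ha
  rw [quotientDualProj_apply, quotientProj_of_mem_ne hI (by simpa using hi) ha]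
  exact LinearMap.map_zero (show Module.Dual K (ExteriorAlgebra K V ⧸ I) from φ)

theorem mem_quotientDualGrading {j : ℤ} {φ : QuotientDual I} :
    φ ∈ quotientDualGrading I j ↔
      ∀ i : ℤ, i ≠ -j → ∀ x ∈ extGrading K V i, φ (Submodule.Quotient.mk x) = 0 :=
  ⟨fun h i hi x hx => h i hi _ (mem_quotientGrading.2 ⟨x, hx, rfl⟩), fun h i hi a ha => by
    obtain ⟨x, hx, rfl⟩ := mem_quotientGrading.1 ha
    exact h i hi x hx⟩

variable [I.IsTwoSided]

theorem quotientDual_smul_mk (e : ExteriorAlgebra K V) (φ : QuotientDual I)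
    (x : ExteriorAlgebra K V) :
    (e • φ) (Submodule.Quotient.mk x) = φ (Submodule.Quotient.mk (x * e)) := rfl

instance : IsScalarTower K (ExteriorAlgebra K V) (QuotientDual I) :=
  ⟨fun c e φ => quotientDual_ext fun x => by
    rw [quotientDual_smul_mk, mul_smul_comm]
    exact LinearMap.map_smul (show Module.Dual K (ExteriorAlgebra K V ⧸ I) from φ) c
      (Submodule.Quotient.mk (x * e))⟩

instance : FiniteDimensional K (QuotientDual I) :=
  inferInstanceAs (FiniteDimensional K (Module.Dual K (ExteriorAlgebra K V ⧸ I)))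

theorem isGradedModule_quotientDualGrading (hI : I.IsHomogeneous (fun p : ℕ => ⋀[K]^p V)) :
    IsGradedModule V (quotientDualGrading I) := by
  have φ_zero : ∀ φ : QuotientDual I, φ 0 = 0 := fun φ =>
    LinearMap.map_zero (show Module.Dual K (ExteriorAlgebra K V ⧸ I) from φ)
  have hsum : ∀ φ : QuotientDual I,
      φ = ∑ p ∈ Finset.range (Module.finrank K V + 1), quotientDualProj hI p φ := by
    intro φ
    refine LinearMap.ext fun a => ?_
    have h1 := congrArg φ (sum_quotientProj hI a).symm
    refine (h1.trans (map_sum (show Module.Dual K (ExteriorAlgebra K V ⧸ I) from φ) _ _)).trans ?_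
    exact (LinearMap.sum_apply (M₂ := K) _ (fun p : ℕ =>
      (show Module.Dual K (ExteriorAlgebra K V ⧸ I) from quotientDualProj hI p φ)) a).symm
  have heq : ∀ (φ ψ : QuotientDual I), (∀ p : ℤ, ∀ a ∈ quotientGrading I p, φ a = ψ a) → φ = ψ := by
    intro φ ψ h
    refine LinearMap.ext_on_range (v := fun a : Σ p, quotientGrading I p => a.2.1) ?_
      fun a => h _ _ a.2.2
    rw [eq_top_iff, ← (isGradedModule_quotientGrading hI).iSup_eq_top]
    exact iSup_le fun p a ha => Submodule.subset_span ⟨⟨p, a, ha⟩, rfl⟩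
  refine ⟨fun v j φ hφ i hi a ha => ?_, ?_, fun j => ⟨quotientDualProj hI (-j), fun φ => ?_,
    fun φ hφ => ?_, fun i hij φ hφ => ?_⟩, ⟨-(Module.finrank K V : ℤ), fun j hj => ?_⟩⟩
  · obtain ⟨x, hx, rfl⟩ := mem_quotientGrading.1 ha
    exact hφ (i + 1) (by omega) _
      (mem_quotientGrading.2 ⟨_, mul_mem_extGrading hx (ι_mem_extGrading v), rfl⟩)
  · rw [eq_top_iff]
    intro φ _
    rw [hsum φ]
    exact sum_mem fun p _ => Submodule.mem_iSup_of_mem (-p : ℤ) (quotientDualProj_mem hI _ _)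
  · simpa using quotientDualProj_mem hI (-j) φ
  · refine heq _ _ fun p a ha => ?_
    rw [quotientDualProj_apply]
    by_cases hp : p = -j
    · subst hp
      rw [quotientProj_of_mem hI ha]
    · rw [quotientProj_of_mem_ne hI hp ha, φ_zero, hφ p hp a ha]
  · refine heq _ _ fun p a ha => ?_
    rw [quotientDualProj_apply]
    by_cases hp : p = -j
    · subst hp
      rw [quotientProj_of_mem hI ha, hφ _ (by omega) a ha]
      rfl
    · rw [quotientProj_of_mem_ne hI hp ha, φ_zero]
      rfl
  · rw [eq_bot_iff]
    intro φ hφ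
    refine heq _ _ fun p a ha => ?_
    by_cases hp : p = -j
    · obtain ⟨x, hx, rfl⟩ := mem_quotientGrading.1 ha
      rw [extGrading_eq_bot_of_gt (by omega), Submodule.mem_bot] at hx
      rw [hx, Submodule.Quotient.mk_zero, φ_zero]
      rfl
    · exact hφ p hp a ha

end Dual

end Gradings

/-! ### Predicates on a list entry and the entries before it. -/

section Split

variable {α : Type*}

/-- The predicate holds for each element of the list, together with the elements preceding it. -/
def ForallSplit (P : List α → α → Prop) (f : List α) : Prop :=
  ∀ l₁ v l₂, f = l₁ ++ v :: l₂ → P l₁ v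

theorem forallSplit_nil (P : List α → α → Prop) : ForallSplit P [] := by
  intro l₁ v l₂ h
  simp at h

theorem forallSplit_concat {P : List α → α → Prop} {f : List α} {v : α} :
    ForallSplit P (f ++ [v]) ↔ ForallSplit P f ∧ P f v := by
  refine ⟨fun h => ⟨fun l₁ w l₂ hl => h l₁ w (l₂ ++ [v]) (by simp [hl]), h f v [] rfl⟩, ?_⟩
  rintro ⟨h, hv⟩ l₁ w l₂ hl
  rcases List.eq_nil_or_concat l₂ with rfl | ⟨l, u, rfl⟩
  · obtain ⟨rfl, h2⟩ := List.append_inj' hl rfl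
    obtain rfl : v = w := by simpa using h2
    exact hv
  · rw [List.concat_eq_append, ← List.cons_append, ← List.append_assoc] at hl
    obtain ⟨h1, -⟩ := List.append_inj' hl rfl
    exact h l₁ w l h1

theorem forallSplit_ofFn {P : List α → α → Prop} {s : ℕ} {f : Fin s → α} :
    ForallSplit P (List.ofFn f) ↔ ∀ i : Fin s, P ((List.ofFn f).take i) (f i) := by
  constructor
  · intro h i
    refine h _ _ ((List.ofFn f).drop (i + 1)) ?_
    have hi : (i : ℕ) < (List.ofFn f).length := by simp
    conv_lhs => rw [← List.take_append_drop i (List.ofFn f), List.drop_eq_getElem_cons hi]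
    simp
  · intro h l₁ v l₂ hl
    have hlen : l₁.length < s := by
      have := congrArg List.length hl
      simp at this
      omega
    have h1 := h ⟨l₁.length, hlen⟩
    have h2 : f ⟨l₁.length, hlen⟩ = v := by
      have h3 : (List.ofFn f)[l₁.length]'(by simpa using hlen) = f ⟨l₁.length, hlen⟩ := by simp
      rw [← h3]
      simp [hl]
    rw [h2, hl] at h1
    simpa using h1

theorem setOf_mem_take_ofFn {s : ℕ} (f : Fin s → α) (i : Fin s) :
    {w | w ∈ (List.ofFn f).take i} = f '' {j | j < i} := by
  ext w
  simp only [Set.mem_ofPred_eq, Set.mem_image, List.mem_take_iff_getElem, List.getElem_ofFn,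
    List.length_ofFn]
  constructor
  · rintro ⟨j, hj, rfl⟩
    exact ⟨⟨j, by omega⟩, Fin.lt_def.2 (by simp; omega), rfl⟩
  · rintro ⟨j, hj, rfl⟩
    exact ⟨j, by have := Fin.lt_def.1 hj; omega, rfl⟩

end Split

/-! ### Regular sequences on `M`, `E`, `I` and `(E/I)^*`. -/

section Regular

variable {K : Type*} [Field K] {V : Type*} [AddCommGroup V] [Module K V]

variable (K) in
/-- The linear forms of the list `f` form a regular sequence on `M`, in terms of the submodules
`F M`, where `F` is a product of the first forms. -/
def RegularSeq (M : Type*) [AddCommGroup M] [Module (ExteriorAlgebra K V) M] (f : List V) : Prop :=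
  ForallSplit (fun l v => ∀ x : M, ι K v • formProd K l • x = 0 →
    ∃ y : M, ι K v • formProd K l • y = formProd K l • x) f

section Module

variable {M : Type*} [AddCommGroup M] [Module (ExteriorAlgebra K V) M]

theorem formProd_smul_eq_zero_of_mem {f : List V} {x : M}
    (hx : x ∈ linIdeal K {w | w ∈ f} • (⊤ : Submodule (ExteriorAlgebra K V) M)) :
    formProd K f • x = 0 := by
  refine Submodule.smul_induction_on hx (fun r hr m _ => ?_) fun x y hx hy => by
    rw [smul_add, hx, hy, add_zero]
  suffices h : formProd K f * r = 0 by rw [smul_smul, h, zero_smul]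
  refine Submodule.span_induction ?_ (mul_zero _) (fun a b _ _ ha hb => by
    rw [mul_add, ha, hb, add_zero]) (fun a b _ hb => ?_) hr
  · rintro _ ⟨w, hw, rfl⟩
    exact formProd_mul_ι_of_mem hw
  · obtain ⟨a', ha'⟩ := exists_formProd_mul_eq f a
    rw [smul_eq_mul, ← mul_assoc, ha', mul_assoc, hb, mul_zero]

theorem formProd_smul_ι_smul (f : List V) (v : V) :
    (∀ x : M, formProd K f • ι K v • x = ι K v • formProd K f • x) ∨
      ∀ x : M, formProd K f • ι K v • x = -(ι K v • formProd K f • x) := by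
  simp_rw [smul_smul, ι_mul_formProd]
  rcases neg_one_pow_eq_or K f.length with h | h <;> simp [h]

theorem formProd_smul_ι_smul_eq_zero_iff {f : List V} {v : V} {x : M} :
    formProd K f • ι K v • x = 0 ↔ ι K v • formProd K f • x = 0 := by
  rcases formProd_smul_ι_smul (K := K) (M := M) f v with h | h <;> simp [h]

theorem exists_formProd_smul_ι_smul_iff {f : List V} {v : V} {x : M} :
    (∃ y : M, formProd K f • ι K v • y = x) ↔ ∃ y : M, ι K v • formProd K f • y = x := by
  rcases formProd_smul_ι_smul (K := K) (M := M) f v with h | h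
  · simp [h]
  · constructor <;> rintro ⟨y, rfl⟩ <;> exact ⟨-y, by simp [h]⟩

/-- This is the isomorphism `M/(f)M ≅ FM`. If `v F' x = 0`, regularity gives `F' x = F' (v y)` for
some `y`, so `x - v y` is killed by the shorter product `F'`, and induction applies. -/
theorem RegularSeq.formProd_smul_eq_zero_iff {f : List V} (hf : RegularSeq K M f) {x : M} :
    formProd K f • x = 0 ↔
      x ∈ linIdeal K {w | w ∈ f} • (⊤ : Submodule (ExteriorAlgebra K V) M) := by
  refine ⟨?_, formProd_smul_eq_zero_of_mem⟩
  induction f using List.reverseRecOn generalizing x with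
  | nil =>
    intro h
    rw [formProd_nil, one_smul] at h
    rw [h]
    exact zero_mem _
  | append_singleton l v ih =>
    obtain ⟨hl, hv⟩ := forallSplit_concat.1 hf
    intro h
    rw [formProd_concat, mul_smul] at h
    obtain ⟨y, hy⟩ := exists_formProd_smul_ι_smul_iff.2 (hv x h)
    have hmono : linIdeal K {w | w ∈ l} ≤ linIdeal K {w | w ∈ l ++ [v]} :=
      Ideal.span_mono (Set.image_mono fun w hw => by simp_all)
    have h0 : formProd K l • (ι K v • y - x) = 0 := by
      rw [smul_sub, hy, sub_self]
    have h1 := Submodule.smul_mono_left hmono (ih hl h0)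
    have h2 : ι K v • y ∈ linIdeal K {w | w ∈ l ++ [v]} •
        (⊤ : Submodule (ExteriorAlgebra K V) M) :=
      Submodule.smul_mem_smul (Ideal.subset_span ⟨v, by simp, rfl⟩) Submodule.mem_top
    have h3 := sub_mem h2 h1
    rwa [sub_sub_cancel] at h3

/-- The condition is carried along the isomorphism `x ↦ Fx` from `M/(f)M` to `FM`, which commutes
with `v` up to sign. -/
theorem isRegularForm_quotient_iff {f : List V} (hf : RegularSeq K M f) (v : V) :
    IsRegularForm K (M ⧸ (linIdeal K {w | w ∈ f} • (⊤ : Submodule (ExteriorAlgebra K V) M))) v ↔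
      ∀ x : M, ι K v • formProd K f • x = 0 →
        ∃ y : M, ι K v • formProd K f • y = formProd K f • x := by
  have hl : ∀ x y : M, (ι K v • (Submodule.Quotient.mk x : M ⧸ (linIdeal K {w | w ∈ f} •
      (⊤ : Submodule (ExteriorAlgebra K V) M))) = Submodule.Quotient.mk y ↔
      formProd K f • ι K v • x = formProd K f • y) := fun x y => by
    rw [← Submodule.Quotient.mk_smul, Submodule.Quotient.eq, ← hf.formProd_smul_eq_zero_iff,
      smul_sub, sub_eq_zero]
  simp_rw [← exists_formProd_smul_ι_smul_iff, ← formProd_smul_ι_smul_eq_zero_iff]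
  constructor
  · intro h x hx
    obtain ⟨m, hm⟩ := (h (Submodule.Quotient.mk x)).1 (by
      rw [← Submodule.Quotient.mk_zero, hl, smul_zero, hx])
    obtain ⟨y, rfl⟩ := Submodule.Quotient.mk_surjective _ m
    exact ⟨y, (hl _ _).1 hm⟩
  · intro h m
    obtain ⟨x, rfl⟩ := Submodule.Quotient.mk_surjective _ m
    constructor
    · intro hm
      rw [← Submodule.Quotient.mk_zero, hl, smul_zero] at hm
      obtain ⟨y, hy⟩ := h x hm
      exact ⟨Submodule.Quotient.mk y, (hl _ _).2 hy⟩
    · rintro ⟨m', h'⟩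
      rw [← h', smul_smul, ExteriorAlgebra.ι_sq_zero, zero_smul]

theorem regularSeq_iff {f : List V} :
    RegularSeq K M f ↔ ForallSplit (fun l v =>
      IsRegularForm K (M ⧸ (linIdeal K {w | w ∈ l} • (⊤ : Submodule (ExteriorAlgebra K V) M))) v)
      f := by
  induction f using List.reverseRecOn with
  | nil => exact ⟨fun _ => forallSplit_nil _, fun _ => forallSplit_nil _⟩
  | append_singleton l v ih =>
    rw [RegularSeq, forallSplit_concat, forallSplit_concat, ← ih]
    exact and_congr_right fun hl => (isRegularForm_quotient_iff hl v).symm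

theorem isRegularSequence_iff {s : ℕ} {f : Fin s → V} :
    IsRegularSequence K M f ↔ LinearIndependent K f ∧ RegularSeq K M (List.ofFn f) := by
  rw [regularSeq_iff, forallSplit_ofFn, IsRegularSequence]
  refine and_congr_right fun _ => forall_congr' fun i => ?_
  rw [setOf_mem_take_ofFn]

/-- A regular sequence on a graded module is compatible with the grading. -/
theorem RegularSeq.graded [Module K M] [IsScalarTower K (ExteriorAlgebra K V) M] {f : List V}
    (hf : RegularSeq K M f) {𝓜 : ℤ → Submodule K M} (h𝓜 : IsGradedModule V 𝓜) :
    GradedRegularSeq f 𝓜 := by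
  intro l₁ v l₂ h j x hx hx0
  obtain ⟨y, hy⟩ := hf l₁ v l₂ h x hx0
  have key : ∀ z : M, Algebra.lsmul K K M (ι K v * formProd K l₁) z =
    ι K v • formProd K l₁ • z := fun z => mul_smul _ _ _
  obtain ⟨y', hy', hyy⟩ := exists_homogeneous_preimage h𝓜.iSup_eq_top h𝓜.hasProjections
    (Algebra.lsmul K K M (ι K v * formProd K l₁)) (d := (l₁.length : ℤ) + 1) (fun i z hz => by
      rw [key, ← add_assoc]
      exact h𝓜.smul_mem _ _ _ (h𝓜.formProd_smul_mem _ hz)) (j := j - 1) y (by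
      rw [key, hy, show j - 1 + ((l₁.length : ℤ) + 1) = j + l₁.length by ring]
      exact h𝓜.formProd_smul_mem _ hx)
  rw [key, key, hy] at hyy
  exact ⟨y', hy', hyy⟩

end Module

section Exterior

theorem exists_dual_of_linearIndependent {f l₁ l₂ : List V} {v : V}
    (hf : LinearIndependent K f.get) (h : f = l₁ ++ v :: l₂) :
    ∃ d : Module.Dual K V, d v = 1 ∧ ∀ w ∈ l₁, d w = 0 := by
  subst h
  have hlt : l₁.length < (l₁ ++ v :: l₂).length := by simp
  have h1 := hf.notMem_span_image (s := {j | j < ⟨l₁.length, hlt⟩}) (x := ⟨l₁.length, hlt⟩)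
    (by simp)
  obtain ⟨d, hd, hd'⟩ := Submodule.exists_dual_map_eq_bot_of_notMem h1 inferInstance
  have hv : (l₁ ++ v :: l₂).get ⟨l₁.length, hlt⟩ = v := by simp
  rw [hv] at hd
  refine ⟨(d v)⁻¹ • d, by simp [hd], fun w hw => ?_⟩
  suffices h : d w = 0 by simp [h]
  obtain ⟨k, hk, rfl⟩ := List.getElem_of_mem hw
  refine (Submodule.mem_bot K).1 (hd' ▸ Submodule.mem_map_of_mem (Submodule.subset_span
    ⟨⟨k, by simp; omega⟩, by simpa using hk, ?_⟩))
  simp [hk]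

open CliffordAlgebra in
theorem contractLeft_formProd_mul (d : Module.Dual K V) {l : List V} (h : ∀ w ∈ l, d w = 0) :
    ∃ c : K, ∀ x : ExteriorAlgebra K V, contractLeft d (formProd K l * x) =
      formProd K l * c • (contractLeft d x : ExteriorAlgebra K V) := by
  induction l using List.reverseRecOn with
  | nil => exact ⟨1, fun x => by simp⟩
  | append_singleton l v ih =>
    obtain ⟨c, hc⟩ := ih fun w hw => h w (by simp [hw])
    refine ⟨-c, fun x => ?_⟩
    rw [formProd_concat, mul_assoc]
    refine (contractLeft_ι_mul d v _).trans ?_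
    rw [h v (by simp), hc]
    simp [mul_assoc]

/-- Linearly independent linear forms are a regular sequence on the exterior algebra. -/
theorem regularSeq_exteriorAlgebra {f : List V} (hf : LinearIndependent K f.get) :
    RegularSeq K (ExteriorAlgebra K V) f := by
  intro l₁ v l₂ h x hx
  obtain ⟨d, hd, hd'⟩ := exists_dual_of_linearIndependent hf h
  obtain ⟨c, hc⟩ := contractLeft_formProd_mul d hd'
  refine ⟨c • CliffordAlgebra.contractLeft d x, ?_⟩
  -- Contraction with `d` is a homotopy for multiplication by `v`: since `d v = 1`, the contraction
  -- of `v F x` is `F x` minus `v` times the contraction of `F x`. As `d` kills the factors of `F`,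
  -- it passes `F` up to a scalar.
  have h1 := CliffordAlgebra.contractLeft_ι_mul (Q := 0) d v (formProd K l₁ * x)
  simp only [smul_eq_mul] at hx ⊢
  rw [← hc x]
  have hx' : CliffordAlgebra.ι (0 : QuadraticForm K V) v * (formProd K l₁ * x) = 0 := hx
  rw [hx', map_zero, hd, one_smul] at h1
  exact (sub_eq_zero.1 h1.symm).symm

end Exterior

section Ideal

variable {I : Ideal (ExteriorAlgebra K V)}

/-- This says `I ∩ FE = FI`. If `v F' x ∈ I`, regularity on `E/I` gives `F' x ≡ v F' u` modulo `I`.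
Thus `F' (x ∓ v u) ∈ I`, induction replaces `x ∓ v u` by an element of `I`, and a further
multiplication by `v` kills the term with `u`. -/
theorem RegularSeq.exists_mem_of_formProd_mul_mem {f : List V}
    (hf : RegularSeq K (ExteriorAlgebra K V ⧸ I) f) {x : ExteriorAlgebra K V}
    (hx : formProd K f * x ∈ I) : ∃ y ∈ I, formProd K f * y = formProd K f * x := by
  induction f using List.reverseRecOn generalizing x with
  | nil => exact ⟨x, by simpa using hx, rfl⟩
  | append_singleton l v ih =>
    obtain ⟨hl, hv⟩ := forallSplit_concat.1 hf
    rw [formProd_concat] at hx ⊢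
    obtain ⟨m, hm⟩ := hv (Submodule.Quotient.mk x) (by
      rw [← Submodule.Quotient.mk_smul, ← Submodule.Quotient.mk_smul,
        Submodule.Quotient.mk_eq_zero, smul_smul]
      exact hx)
    obtain ⟨u, rfl⟩ := Submodule.Quotient.mk_surjective _ m
    rw [← Submodule.Quotient.mk_smul, ← Submodule.Quotient.mk_smul, ← Submodule.Quotient.mk_smul,
      Submodule.Quotient.eq, smul_smul, ι_mul_formProd, smul_eq_mul, smul_eq_mul] at hm
    obtain ⟨y, hy, hy'⟩ := ih hl (x := x - (-1 : K) ^ l.length • (ι K v * u)) (by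
      rw [mul_sub, mul_smul_comm, ← mul_assoc, ← smul_mul_assoc, ← neg_sub]
      exact neg_mem hm)
    refine ⟨y, hy, ?_⟩
    have h0 : ι K v * (formProd K l * (ι K v * u)) = 0 := by
      rw [← mul_assoc, ι_mul_formProd, smul_mul_assoc, mul_assoc, ← mul_assoc (ι K v),
        ExteriorAlgebra.ι_sq_zero, zero_mul, mul_zero, smul_zero]
    rw [mul_assoc, hy', mul_sub, mul_sub, mul_smul_comm, mul_smul_comm, h0, smul_zero, sub_zero,
      mul_assoc]

/-- The equation is solved in `E`; then `I ∩ vFE = vFI` moves the solution into `I`. -/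
theorem RegularSeq.ideal {f : List V} (hf : RegularSeq K (ExteriorAlgebra K V ⧸ I) f)
    (hf' : RegularSeq K (ExteriorAlgebra K V) f) : RegularSeq K I f := by
  induction f using List.reverseRecOn with
  | nil => exact forallSplit_nil _
  | append_singleton l v ih =>
    obtain ⟨hl, hv⟩ := forallSplit_concat.1 hf
    obtain ⟨hl', hv'⟩ := forallSplit_concat.1 hf'
    refine forallSplit_concat.2 ⟨ih hl hl', fun x hx => ?_⟩
    obtain ⟨y, hy⟩ := hv' (x : ExteriorAlgebra K V) (congrArg Subtype.val hx)
    obtain ⟨z, hz, hz'⟩ := hf.exists_mem_of_formProd_mul_mem (x := y) (by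
      rw [formProd_concat, mul_assoc]
      have : ι K v * (formProd K l * y) = formProd K l * x := hy
      rw [this]
      exact I.mul_mem_left _ x.2)
    rw [formProd_concat, mul_assoc, mul_assoc] at hz'
    exact ⟨⟨z, hz⟩, Subtype.ext (hz'.trans hy)⟩

variable [FiniteDimensional K V]

/-- The rule `x A ↦ φ (x B)` is well defined modulo `I` exactly because of `h`. It extends to `E/I`
since a functional vanishing on the kernel of a linear map factors through that map; composing with
a projection makes the extension homogeneous. -/
theorem exists_quotientDual_of_ker_le (hI : I.IsHomogeneous (fun p : ℕ => ⋀[K]^p V)) {j i : ℤ}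
    {J : Ideal (ExteriorAlgebra K V)}
    (φ : QuotientDual J) (A B : ExteriorAlgebra K V)
    (hA : ∀ x ∈ extGrading K V (-i), x * A ∈ extGrading K V (-j))
    (h : ∀ x ∈ extGrading K V (-i), x * A ∈ I → φ (Submodule.Quotient.mk (x * B)) = 0) :
    ∃ ψ ∈ quotientDualGrading I j, ∀ x ∈ extGrading K V (-i),
      ψ (Submodule.Quotient.mk (x * A)) = φ (Submodule.Quotient.mk (x * B)) := by
  let mk : ∀ L : Ideal (ExteriorAlgebra K V), ExteriorAlgebra K V →ₗ[K] ExteriorAlgebra K V ⧸ L :=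
    fun L => L.mkQ.restrictScalars K
  let T : extGrading K V (-i) →ₗ[K] ExteriorAlgebra K V ⧸ I :=
    mk I ∘ₗ LinearMap.mulRight K A ∘ₗ (extGrading K V (-i)).subtype
  let θ : Module.Dual K (extGrading K V (-i)) :=
    (show Module.Dual K (ExteriorAlgebra K V ⧸ J) from φ) ∘ₗ
      mk J ∘ₗ LinearMap.mulRight K B ∘ₗ (extGrading K V (-i)).subtype
  have hθ : θ ∈ LinearMap.range T.dualMap := by
    rw [LinearMap.range_dualMap_eq_dualAnnihilator_ker, Submodule.mem_dualAnnihilator]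
    intro x hx
    exact h x x.2 ((Submodule.Quotient.mk_eq_zero _).1 (LinearMap.mem_ker.1 hx))
  obtain ⟨ψ, hψ⟩ := hθ
  have φ_zero : ψ 0 = 0 := LinearMap.map_zero ψ
  refine ⟨ψ ∘ₗ quotientProj hI (-j), fun k hk a ha => ?_, fun x hx => ?_⟩
  · exact (congrArg ψ (quotientProj_of_mem_ne hI hk ha)).trans φ_zero
  · refine (congrArg ψ ((quotientProj_mk hI _ _).trans
      (congrArg Submodule.Quotient.mk (extProj_of_mem (hA x hx))))).trans ?_
    exact LinearMap.congr_fun hψ ⟨x, hx⟩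

theorem quotientDual_eq_of_forall_mem [I.IsTwoSided] {j : ℤ} {φ ψ : QuotientDual I}
    (hI : I.IsHomogeneous (fun p : ℕ => ⋀[K]^p V))
    (hφ : φ ∈ quotientDualGrading I j) (hψ : ψ ∈ quotientDualGrading I j)
    (h : ∀ x ∈ extGrading K V (-j),
      φ (Submodule.Quotient.mk x) = ψ (Submodule.Quotient.mk x)) : φ = ψ := by
  refine LinearMap.ext_on_range (v := fun a : Σ p, quotientGrading I p => a.2.1) ?_ ?_
  · rw [eq_top_iff, ← (isGradedModule_quotientGrading hI).iSup_eq_top]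
    exact iSup_le fun p a ha => Submodule.subset_span ⟨⟨p, a, ha⟩, rfl⟩
  · rintro ⟨p, a, ha⟩
    obtain ⟨x, hx, rfl⟩ := mem_quotientGrading.1 ha
    by_cases hp : p = -j
    · subst hp
      exact h x hx
    · exact (hφ p hp _ ha).trans (hψ p hp _ ha).symm

/-- A regular sequence on `E/I` is a regular sequence on the dual of `E/I`. -/
theorem RegularSeq.quotientDual [I.IsTwoSided] (hI : I.IsHomogeneous (fun p : ℕ => ⋀[K]^p V))
    {f : List V} (hf : RegularSeq K (ExteriorAlgebra K V ⧸ I) f) :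
    GradedRegularSeq f (quotientDualGrading I) := by
  intro l v l' h j φ hφ hφ0
  have hg := isGradedModule_quotientDualGrading hI
  have hmem := hg.formProd_smul_mem l hφ
  have hdeg : ∀ i, ∀ x ∈ extGrading K V i, x * (ι K v * formProd K l) ∈
      extGrading K V (i + l.length + 1) := fun i x hx => by
    rw [add_assoc]
    refine mul_mem_extGrading hx ?_
    rw [add_comm]
    exact mul_mem_extGrading (ι_mem_extGrading v) (formProd_mem_extGrading l)
  -- The functional `ψ` must satisfy `ψ (x v F) = φ (x F)`. This is consistent: if `x v F ∈ I`,
  -- regularity on `E/I` gives `F x ≡ v F y` modulo `I`, so `φ (x F)` is a multiple of `(v F φ)(y) =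
  -- 0`.
  obtain ⟨ψ, hψ, hψ'⟩ := exists_quotientDual_of_ker_le hI (i := j + l.length) (j := j - 1) φ
    (ι K v * formProd K l) (formProd K l)
    (fun x hx => by convert hdeg _ x hx using 2; ring) (fun x hx hxI => by
      obtain ⟨c, hc, hc'⟩ := exists_mul_formProd_eq_smul (K := K) (-(j + l.length)) (l ++ [v])
      obtain ⟨d, hd, hd'⟩ := exists_mul_formProd_eq_smul (K := K) (-(j + l.length)) l
      rw [← formProd_concat, hc' x hx, formProd_concat, mul_assoc] at hxI
      have hxI' : ι K v * (formProd K l * x) ∈ I := by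
        have := (I.restrictScalars K).smul_mem c⁻¹ hxI
        rwa [smul_smul, inv_mul_cancel₀ hc, one_smul] at this
      obtain ⟨m, hm⟩ := hf l v l' h (Submodule.Quotient.mk x) (by
        rw [← Submodule.Quotient.mk_smul, ← Submodule.Quotient.mk_smul,
          Submodule.Quotient.mk_eq_zero]
        exact hxI')
      obtain ⟨y, rfl⟩ := Submodule.Quotient.mk_surjective _ m
      obtain ⟨y', hy', hyy⟩ := exists_homogeneous_preimage
        (isGradedModule_extGrading K V).iSup_eq_top
        (isGradedModule_quotientGrading hI).hasProjections
        (I.mkQ.restrictScalars K ∘ₗ LinearMap.mulLeft K (ι K v * formProd K l))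
        (d := (l.length : ℤ) + 1) (fun i z hz => by
          refine mem_quotientGrading.2 ⟨_, ?_, rfl⟩
          rw [LinearMap.mulLeft_apply, mul_assoc, ← add_assoc]
          exact (isGradedModule_extGrading K V).smul_mem _ _ _
            ((isGradedModule_extGrading K V).formProd_smul_mem l hz))
        (j := -(j + l.length) - 1) y (by
          have h1 : (I.mkQ.restrictScalars K ∘ₗ LinearMap.mulLeft K (ι K v * formProd K l)) y =
              Submodule.Quotient.mk (formProd K l * x) := by
            rw [← smul_eq_mul (formProd K l) x, Submodule.Quotient.mk_smul, ← hm,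
              ← Submodule.Quotient.mk_smul, ← Submodule.Quotient.mk_smul, smul_smul]
            rfl
          rw [h1]
          refine mem_quotientGrading.2 ⟨_, ?_, rfl⟩
          rw [← smul_eq_mul]
          convert (isGradedModule_extGrading K V).formProd_smul_mem l hx using 2
          ring)
      obtain ⟨e, he, he'⟩ := exists_mul_formProd_eq_smul (K := K) (-(j + l.length) - 1) (l ++ [v])
      have h2 : (Submodule.Quotient.mk (x * formProd K l) : ExteriorAlgebra K V ⧸ I) =
          Submodule.Quotient.mk (((d * e⁻¹) • y') * (ι K v * formProd K l)) := by
        have h3 : ι K v * formProd K l * y' = e⁻¹ • (y' * (ι K v * formProd K l)) := by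
          rw [← formProd_concat, he' y' hy', smul_smul, inv_mul_cancel₀ he, one_smul]
        have h4 : (Submodule.Quotient.mk (formProd K l * x) : ExteriorAlgebra K V ⧸ I) =
            Submodule.Quotient.mk (ι K v * formProd K l * y') := by
          rw [← smul_eq_mul, Submodule.Quotient.mk_smul, ← hm, ← Submodule.Quotient.mk_smul,
              ← Submodule.Quotient.mk_smul, smul_smul]
          exact hyy.symm
        rw [hd' x hx, Submodule.Quotient.mk_smul, h4, h3, ← Submodule.Quotient.mk_smul, smul_smul,
          smul_mul_assoc]
      rw [h2]
      have h5 : (ι K v • formProd K l • φ) (Submodule.Quotient.mk ((d * e⁻¹) • y')) = 0 := by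
        rw [hφ0]; rfl
      rw [quotientDual_smul_mk, quotientDual_smul_mk] at h5
      rw [← mul_assoc]
      exact h5)
  refine ⟨ψ, hψ, ?_⟩
  have hψm := hg.smul_mem v _ _ (hg.formProd_smul_mem l hψ)
  rw [show j - 1 + (l.length : ℤ) + 1 = j + l.length by ring] at hψm
  refine quotientDual_eq_of_forall_mem hI hψm hmem fun x hx => ?_
  rw [quotientDual_smul_mk, quotientDual_smul_mk, quotientDual_smul_mk, mul_assoc]
  exact hψ' x hx

end Ideal

end Regular

variable {K : Type*} [Field K] {V : Type*} [AddCommGroup V] [Module K V]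

/-! ### Cartan homology of `E` and `E^*` with respect to a basis. -/

section Koszul

variable [FiniteDimensional K V]

/-- Removing the whole basis leaves the empty list acting on `FE`. Here `F` has top degree, so `F
E_j = 0` for `j ≠ 0`. -/
theorem cartanExact_extGrading {b : List V} (hb : LinearIndependent K b.get)
    (hlen : b.length = Module.finrank K V) {j : ℤ} (hj : j ≠ 0) :
    CartanExact b (extGrading K V) j := by
  have hg := isGradedModule_extGrading K V
  have key := ((regularSeq_exteriorAlgebra hb).graded hg).cartanExact_iff hg.smul_mem [] j
  rw [List.append_nil] at key
  rw [key, cartanExact_nil_iff, eq_bot_iff]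
  intro x hx
  obtain ⟨y, hy, rfl⟩ := mem_smulGrading.1 hx
  rw [add_sub_cancel_right] at hy
  rcases lt_or_gt_of_ne hj with hj | hj
  · rw [extGrading_of_neg hj, Submodule.mem_bot] at hy
    simp [hy]
  · have := hg.formProd_smul_mem b hy
    rwa [extGrading_eq_bot_of_gt (by omega)] at this

theorem regularSeq_quotient_bot {f : List V} (hf : RegularSeq K (ExteriorAlgebra K V) f) :
    RegularSeq K (ExteriorAlgebra K V ⧸ (⊥ : Ideal (ExteriorAlgebra K V))) f := by
  intro l₁ v l₂ h m hm
  obtain ⟨x, rfl⟩ := Submodule.Quotient.mk_surjective _ m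
  obtain ⟨y, hy⟩ := hf l₁ v l₂ h x (by
    rwa [← Submodule.Quotient.mk_smul, ← Submodule.Quotient.mk_smul,
      Submodule.Quotient.mk_eq_zero] at hm)
  exact ⟨Submodule.Quotient.mk y, congrArg Submodule.Quotient.mk hy⟩

theorem isHomogeneous_bot :
    (⊥ : Ideal (ExteriorAlgebra K V)).IsHomogeneous (fun p : ℕ => ⋀[K]^p V) :=
  Ideal.IsHomogeneous.bot _

/-- As for `E`, everything reduces to `F E^*`. The value `(F φ)(y) = φ (y F)` can be nonzero only
for `y` of degree `0`, which corresponds to `j = -b.length`. -/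
theorem cartanExact_quotientDual_bot {b : List V} (hb : LinearIndependent K b.get)
    (hlen : b.length = Module.finrank K V) {j : ℤ} (hj : j ≠ -b.length) :
    CartanExact b (quotientDualGrading (⊥ : Ideal (ExteriorAlgebra K V))) j := by
  have hI := isHomogeneous_bot (K := K) (V := V)
  have hg := isGradedModule_quotientDualGrading hI
  have key := ((regularSeq_quotient_bot (regularSeq_exteriorAlgebra hb)).quotientDual
    hI).cartanExact_iff hg.smul_mem [] j
  rw [List.append_nil] at key
  rw [key, cartanExact_nil_iff, eq_bot_iff]
  intro x hx
  obtain ⟨φ, hφ, rfl⟩ := mem_smulGrading.1 hx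
  rw [add_sub_cancel_right] at hφ
  rw [Submodule.mem_bot]
  refine quotientDual_eq_of_forall_mem hI (hg.formProd_smul_mem b hφ) (zero_mem _) fun y hy => ?_
  rw [quotientDual_smul_mk]
  suffices h : y * formProd K b = 0 by
    rw [h]
    exact LinearMap.map_zero (show Module.Dual K _ from φ)
  rcases lt_or_gt_of_ne (show -(j + (b.length : ℤ)) ≠ 0 by omega) with h | h
  · rw [extGrading_of_neg h, Submodule.mem_bot] at hy
    rw [hy, zero_mul]
  · have := mul_mem_extGrading hy (formProd_mem_extGrading b)
    rwa [extGrading_eq_bot_of_gt (by omega)] at this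

end Koszul

/-! ### Free modules. -/

section Free

variable (K V) in
/-- The grading of the free module `E^n`, with basis in degree `0`. -/
def piGrading (n : ℕ) (j : ℤ) : Submodule K (Fin n → ExteriorAlgebra K V) :=
  Submodule.pi Set.univ fun _ => extGrading K V j

theorem mem_piGrading {n : ℕ} {j : ℤ} {x : Fin n → ExteriorAlgebra K V} :
    x ∈ piGrading K V n j ↔ ∀ i, x i ∈ extGrading K V j := by
  simp [piGrading, Submodule.mem_pi]

theorem piGrading_of_neg {n : ℕ} {j : ℤ} (hj : j < 0) : piGrading K V n j = ⊥ := by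
  rw [eq_bot_iff]
  intro x hx
  ext i
  simpa [extGrading_of_neg hj] using mem_piGrading.1 hx i

theorem isGradedModule_piGrading [FiniteDimensional K V] (n : ℕ) :
    IsGradedModule V (piGrading K V n) := by
  refine ⟨fun v j x hx => mem_piGrading.2 fun i =>
      (isGradedModule_extGrading K V).smul_mem v j _ (mem_piGrading.1 hx i), ?_,
    fun j => ⟨(extProj K V j).compLeft (Fin n), fun x => mem_piGrading.2 fun i => extProj_mem _ _,
      fun x hx => funext fun i => extProj_of_mem (mem_piGrading.1 hx i),
      fun i hij x hx => funext fun k => extProj_of_mem_ne hij (mem_piGrading.1 hx k)⟩,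
    ⟨0, fun j hj => piGrading_of_neg hj⟩⟩
  rw [eq_top_iff]
  intro x _
  have h : x = ∑ p ∈ Finset.range (Module.finrank K V + 1), (extProj K V p).compLeft (Fin n) x := by
    ext i
    rw [Finset.sum_apply]
    exact (sum_extProj (x i)).symm
  rw [h]
  exact sum_mem fun p _ => Submodule.mem_iSup_of_mem (p : ℤ)
    (mem_piGrading.2 fun i => extProj_mem _ _)

theorem cartanExact_piGrading [FiniteDimensional K V] {b : List V}
    (hb : LinearIndependent K b.get) (hlen : b.length = Module.finrank K V) (n : ℕ) {j : ℤ}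
    (hj : j ≠ 0) : CartanExact b (piGrading K V n) j := by
  intro z hz hz0
  choose w hw hw' using fun i => cartanExact_extGrading hb hlen hj (fun a => z a i)
    (fun a => mem_piGrading.1 (hz a) i) (by
      have := cartanD_map (K := K) b (LinearMap.proj i : (Fin n → ExteriorAlgebra K V)
        →ₗ[ExteriorAlgebra K V] ExteriorAlgebra K V) z
      rw [hz0] at this
      exact this)
  refine ⟨fun a i => w i a, fun a => mem_piGrading.2 fun i => hw i a, ?_⟩
  ext a i
  have := congrFun (cartanD_map (K := K) b (LinearMap.proj i : (Fin n → ExteriorAlgebra K V)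
        →ₗ[ExteriorAlgebra K V] ExteriorAlgebra K V) (fun a i => w i a)) a
  exact this.symm.trans (congrFun (hw' i) a)

end Free

/-! ### Linear resolutions and Cartan homology concentrated in one degree. -/

section GradedModule

variable {M : Type*} [AddCommGroup M] [Module K M] [Module (ExteriorAlgebra K V) M]
  [IsScalarTower K (ExteriorAlgebra K V) M] {𝓜 : ℤ → Submodule K M}

theorem IsGradedModule.ext_smul_mem (h𝓜 : IsGradedModule V 𝓜) {j s : ℤ}
    {e : ExteriorAlgebra K V} (he : e ∈ extGrading K V j) {x : M} (hx : x ∈ 𝓜 s) :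
    e • x ∈ 𝓜 (j + s) := by
  rcases lt_or_ge j 0 with hj | hj
  · rw [extGrading_of_neg hj, Submodule.mem_bot] at he
    simp [he]
  lift j to ℕ using hj
  rw [extGrading_natCast] at he
  induction he using Submodule.pow_induction_on_left' with
  | algebraMap r =>
    rw [algebraMap_smul]
    simpa using Submodule.smul_mem _ r hx
  | add e f i _ _ he hf =>
    rw [add_smul]
    exact add_mem he hf
  | mem_mul m hm i e _ ih =>
    obtain ⟨v, rfl⟩ := hm
    rw [mul_smul, Nat.succ_eq_add_one, Nat.cast_add, Nat.cast_one,
      show (i : ℤ) + 1 + s = i + s + 1 by ring]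
    exact h𝓜.smul_mem v _ _ ih

theorem IsGradedModule.map_mem (h𝓜 : IsGradedModule V 𝓜) {n : ℕ}
    {ε : (Fin n → ExteriorAlgebra K V) →ₗ[ExteriorAlgebra K V] M} {s : ℤ}
    (hε : ∀ i, ε (Pi.single i 1) ∈ 𝓜 s) {j : ℤ} {x : Fin n → ExteriorAlgebra K V}
    (hx : x ∈ piGrading K V n j) : ε x ∈ 𝓜 (j + s) := by
  have h : x = ∑ i, x i • Pi.single i (1 : ExteriorAlgebra K V) := by
    ext k
    simp [Finset.sum_apply, Pi.single_apply]
  rw [h, map_sum]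
  refine sum_mem fun i _ => ?_
  rw [map_smul]
  exact h𝓜.ext_smul_mem (mem_piGrading.1 hx i) (hε i)

/-- Homogeneous lifts along a homogeneous map of a free module. -/
theorem IsGradedModule.exists_lift [FiniteDimensional K V] (h𝓜 : IsGradedModule V 𝓜) {n : ℕ}
    {ε : (Fin n → ExteriorAlgebra K V) →ₗ[ExteriorAlgebra K V] M} {s : ℤ}
    (hε : ∀ i, ε (Pi.single i 1) ∈ 𝓜 s) {j : ℤ} {x : Fin n → ExteriorAlgebra K V}
    (hx : ε x ∈ 𝓜 j) : ∃ y ∈ piGrading K V n (j - s), ε y = ε x :=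
  exists_homogeneous_preimage (isGradedModule_piGrading n).iSup_eq_top h𝓜.hasProjections
    (ε.restrictScalars K) (fun _ _ hx => h𝓜.map_mem hε hx) x (by rwa [sub_add_cancel])

section Truncation

theorem degree_add_single {r : ℕ} (a : Fin r →₀ ℕ) (i : Fin r) :
    (a + Finsupp.single i 1).degree = a.degree + 1 := by
  simp [map_add]

/-- The differential at `a` sees only exponents of total degree one higher. Replacing `z` by zero
above total degree `i` therefore yields an honest cycle. -/
theorem CartanExact.truncated {b : List V} {j : ℤ} (h : CartanExact b 𝓜 j) (i : ℕ)
    {z : (Fin b.length →₀ ℕ) → M} (hz : ∀ a, z a ∈ 𝓜 j)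
    (hz0 : ∀ a, a.degree < i → cartanD K b z a = 0) :
    ∃ w : (Fin b.length →₀ ℕ) → M, (∀ a, w a ∈ 𝓜 (j - 1)) ∧
      ∀ a, a.degree ≤ i → cartanD K b w a = z a := by
  classical
  obtain ⟨w, hw, hw'⟩ := h (fun a => if a.degree ≤ i then z a else 0) (fun a => by
    split_ifs
    · exact hz a
    · exact zero_mem _) (by
    ext a
    rw [cartanD_apply]
    simp only [degree_add_single]
    by_cases ha : a.degree < i
    · rw [Pi.zero_apply, ← hz0 a ha, cartanD_apply]
      exact Finset.sum_congr rfl fun k _ => by rw [if_pos (by omega)]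
    · exact Finset.sum_eq_zero fun k _ => by rw [if_neg (by omega), smul_zero])
  exact ⟨w, hw, fun a ha => by rw [hw']; exact if_pos ha⟩

end Truncation

variable [FiniteDimensional K V]

/-- A module with a linear free resolution has a Cartan complex with homology concentrated in one
internal degree. -/
theorem HasLinearFreeResolution.cartanExact (h𝓜 : IsGradedModule V 𝓜)
    (h : HasLinearFreeResolution (V := V) K 𝓜) {b : List V} (hb : LinearIndependent K b.get)
    (hlen : b.length = Module.finrank K V) : ∃ s : ℤ, ∀ j, j ≠ s → CartanExact b 𝓜 j := by
  obtain ⟨s, β, ε, δ, hε, hδ, hsurj, hex0, hex⟩ := h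
  have hδ' : ∀ d i, δ d (Pi.single i 1) ∈ piGrading K V (β d) 1 := fun d i =>
    mem_piGrading.2 fun k => by
      have := extGrading_natCast (K := K) (V := V) 1
      rw [Nat.cast_one] at this
      rw [this]
      exact hδ d i k
  have hpi := fun n => isGradedModule_piGrading (K := K) (V := V) n
  -- A chase in the double complex of the resolution and the Cartan complex. If `D z = δ y` at the
  -- levels below `i + 1`, then `D y` lies in the next kernel, and induction gives `u` with `y - D
  -- u` in the next image. Hence `z - δ u` is a cycle there, and it is bounded since free modules
  -- have homology in degree `0` only. Both `δ` and `D` raise the internal degree by one, so `j`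
  -- stays fixed.
  have claim : ∀ (i d : ℕ) (j : ℤ), j ≠ 0 →
      ∀ z : (Fin b.length →₀ ℕ) → Fin (β d) → ExteriorAlgebra K V,
      (∀ a, z a ∈ piGrading K V (β d) j) →
      (∀ a, a.degree < i → cartanD K b z a ∈ LinearMap.range (δ d)) →
      ∃ w : (Fin b.length →₀ ℕ) → Fin (β d) → ExteriorAlgebra K V,
        (∀ a, w a ∈ piGrading K V (β d) (j - 1)) ∧
        ∀ a, a.degree ≤ i → z a - cartanD K b w a ∈ LinearMap.range (δ d) := by
    intro i
    induction i with
    | zero =>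
      intro d j hj z hz _
      obtain ⟨w, hw, hw'⟩ := (cartanExact_piGrading hb hlen (β d) hj).truncated 0 hz
        (fun a ha => by omega)
      exact ⟨w, hw, fun a ha => by rw [hw' a ha, sub_self]; exact zero_mem _⟩
    | succ i ih =>
      intro d j hj z hz hz0
      have hy : ∀ a, ∃ y ∈ piGrading K V (β (d + 1)) j,
          a.degree < i + 1 → δ d y = cartanD K b z a := fun a => by
        by_cases ha : a.degree < i + 1
        · obtain ⟨y, hy⟩ := hz0 a ha
          have h1 := cartanD_mem (hpi _).smul_mem hz a
          rw [← hy] at h1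
          obtain ⟨y', hy', hyy⟩ := (hpi (β d)).exists_lift (hδ' d) h1
          rw [add_sub_cancel_right] at hy'
          exact ⟨y', hy', fun _ => hyy.trans hy⟩
        · exact ⟨0, zero_mem _, fun h => absurd h ha⟩
      choose y hy hy' using hy
      have hymap := fun a => congrFun (cartanD_map (K := K) b (δ d) y) a
      obtain ⟨u, hu, hu'⟩ := ih (d + 1) j hj y hy fun a ha => by
        refine (hex d _).1 ?_
        rw [← hymap, ← Pi.zero_apply (M := fun _ => Fin (β d) → ExteriorAlgebra K V) a,
          ← cartanD_cartanD (K := K) b z, cartanD_apply, cartanD_apply]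
        exact Finset.sum_congr rfl fun k _ => by
          rw [hy' _ (by rw [degree_add_single]; omega)]
      have humap := fun a => congrFun (cartanD_map (K := K) b (δ d) u) a
      have hδδ : ∀ x ∈ LinearMap.range (δ (d + 1)), δ d x = 0 := fun x hx => (hex d x).2 hx
      obtain ⟨w, hw, hw'⟩ := (cartanExact_piGrading hb hlen (β d) hj).truncated (i + 1)
        (z := z - fun a => δ d (u a)) (fun a => by
          refine sub_mem (hz a) ?_
          have := (hpi (β d)).map_mem (hδ' d) (hu a)
          rwa [sub_add_cancel] at this) (fun a ha => by
          rw [map_sub, Pi.sub_apply, humap, ← hy' a ha, ← map_sub]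
          exact hδδ _ (hu' a (by omega)))
      refine ⟨w, hw, fun a ha => ?_⟩
      rw [hw' a ha, Pi.sub_apply, sub_sub_cancel]
      exact ⟨_, rfl⟩
  refine ⟨s, fun j hj z hz hz0 => ?_⟩
  have hy : ∀ a, ∃ y ∈ piGrading K V (β 0) (j - s), ε y = z a := fun a => by
    obtain ⟨x, hx⟩ := hsurj (z a)
    obtain ⟨y, hy, hy'⟩ := h𝓜.exists_lift hε (x := x) (by rw [hx]; exact hz a)
    exact ⟨y, hy, hy'.trans hx⟩
  choose y hy hy' using hy
  have hεδ : ∀ x ∈ LinearMap.range (δ 0), ε x = 0 := fun x hx => (hex0 x).2 hx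
  choose w hw hw' using fun i => claim i 0 (j - s) (sub_ne_zero.2 hj) y hy fun a _ => by
    refine (hex0 _).1 ?_
    rw [← congrFun (cartanD_map (K := K) b ε y) a, funext hy', hz0]
    rfl
  -- The solution `w i` works only at levels up to `i`, so the solutions are glued: the value of `D`
  -- at level `n` uses `w` at level `n + 1`, which is taken from `w n`. The value chosen at level
  -- `0` never enters.
  refine ⟨fun a => ε (w (a.degree - 1) a), fun a => ?_, ?_⟩
  · have := h𝓜.map_mem hε (hw (a.degree - 1) a)
    rwa [show j - s - 1 + s = j - 1 by ring] at this
  · ext a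
    have h1 := hεδ _ (hw' a.degree a le_rfl)
    rw [map_sub, hy', sub_eq_zero, ← congrFun (cartanD_map (K := K) b ε _) a] at h1
    rw [h1, cartanD_apply, cartanD_apply]
    exact Finset.sum_congr rfl fun k _ => by rw [degree_add_single, Nat.add_sub_cancel]

/-- Exactness at position `0`, where every element is a cycle: there are no new generators in degree
`j`. -/
theorem CartanExact.exists_eq_sum {b : List V} {j : ℤ} (h : CartanExact b 𝓜 j) {x : M}
    (hx : x ∈ 𝓜 j) : ∃ w : Fin b.length → M, (∀ i, w i ∈ 𝓜 (j - 1)) ∧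
      x = ∑ i, ι K (b.get i) • w i := by
  obtain ⟨w, hw, hw'⟩ := h.truncated 0 (fun _ => hx) (fun a ha => absurd ha (by omega))
  refine ⟨fun i => w (0 + Finsupp.single i 1), fun i => hw _, ?_⟩
  rw [← hw' 0 (by simp), cartanD_apply]

theorem IsGradedModule.eq_bot_of_lt (h𝓜 : IsGradedModule V 𝓜) {b : List V} {s : ℤ}
    (h : ∀ j, j ≠ s → CartanExact b 𝓜 j) {j : ℤ} (hj : j < s) : 𝓜 j = ⊥ := by
  obtain ⟨j₀, hj₀⟩ := h𝓜.bddBelow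
  rcases lt_or_ge j j₀ with hlt | hle
  · exact hj₀ j hlt
  induction j, hle using Int.leInduction with
  | base =>
    rw [eq_bot_iff]
    intro x hx
    obtain ⟨w, hw, rfl⟩ := (h _ hj.ne).exists_eq_sum hx
    rw [Submodule.mem_bot]
    refine Finset.sum_eq_zero fun i _ => ?_
    have := hw i
    rw [hj₀ _ (by omega), Submodule.mem_bot] at this
    rw [this, smul_zero]
  | succ j hle ih =>
    rw [eq_bot_iff]
    intro x hx
    obtain ⟨w, hw, rfl⟩ := (h _ hj.ne).exists_eq_sum hx
    rw [Submodule.mem_bot]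
    refine Finset.sum_eq_zero fun i _ => ?_
    have := hw i
    rw [add_sub_cancel_right, ih (by omega), Submodule.mem_bot] at this
    rw [this, smul_zero]

theorem IsGradedModule.span_eq_top (h𝓜 : IsGradedModule V 𝓜) {b : List V} {s : ℤ}
    (h : ∀ j, j ≠ s → CartanExact b 𝓜 j) :
    Submodule.span (ExteriorAlgebra K V) (𝓜 s : Set M) = ⊤ := by
  have key : ∀ j, ∀ x ∈ 𝓜 j, x ∈ Submodule.span (ExteriorAlgebra K V) (𝓜 s : Set M) := by
    intro j
    rcases lt_or_ge j s with hlt | hle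
    · intro x hx
      rw [h𝓜.eq_bot_of_lt h hlt, Submodule.mem_bot] at hx
      rw [hx]
      exact zero_mem _
    induction j, hle using Int.leInduction with
    | base => exact fun x hx => Submodule.subset_span hx
    | succ j hle ih =>
      intro x hx
      obtain ⟨w, hw, rfl⟩ := (h _ (by omega)).exists_eq_sum hx
      refine sum_mem fun i _ => Submodule.smul_mem _ _ (ih _ ?_)
      simpa using hw i
  rw [← Submodule.restrictScalars_eq_top_iff K, eq_top_iff, ← h𝓜.iSup_eq_top]
  exact iSup_le key

/-- The grading of a graded submodule of a free module. -/
def subGrading {n : ℕ} (N : Submodule (ExteriorAlgebra K V) (Fin n → ExteriorAlgebra K V))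
    (j : ℤ) : Submodule K N :=
  (piGrading K V n j).comap (N.subtype.restrictScalars K)

theorem mem_subGrading {n : ℕ}
    {N : Submodule (ExteriorAlgebra K V) (Fin n → ExteriorAlgebra K V)} {j : ℤ} {x : N} :
    x ∈ subGrading N j ↔ (x : Fin n → ExteriorAlgebra K V) ∈ piGrading K V n j := Iff.rfl

theorem isGradedModule_subGrading {n : ℕ}
    {N : Submodule (ExteriorAlgebra K V) (Fin n → ExteriorAlgebra K V)}
    (hN : ∀ (j : ℤ), ∀ x ∈ N, (extProj K V j).compLeft (Fin n) x ∈ N) :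
    IsGradedModule V (subGrading N) := by
  let π : ℤ → N →ₗ[K] N := fun j =>
    { toFun := fun x => ⟨(extProj K V j).compLeft (Fin n) x, hN j x x.2⟩
      map_add' := fun x y => Subtype.ext (by simp)
      map_smul' := fun c x => Subtype.ext (by simp) }
  refine ⟨fun v j x hx => (isGradedModule_piGrading n).smul_mem v j _ hx, ?_,
    fun j => ⟨π j, fun x => mem_subGrading.2 (mem_piGrading.2 fun i => extProj_mem _ _),
      fun x hx => Subtype.ext (funext fun i => extProj_of_mem (mem_piGrading.1 hx i)),
      fun i hij x hx => Subtype.ext (funext fun k =>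
        extProj_of_mem_ne hij (mem_piGrading.1 hx k))⟩, ⟨0, fun j hj => ?_⟩⟩
  · rw [eq_top_iff]
    intro x _
    have h : x = ∑ p ∈ Finset.range (Module.finrank K V + 1), π p x := by
      refine Subtype.ext ?_
      rw [AddSubmonoidClass.coe_finsetSum]
      ext i
      rw [Finset.sum_apply]
      exact (sum_extProj _).symm
    rw [h]
    exact sum_mem fun p _ => Submodule.mem_iSup_of_mem (p : ℤ)
      (mem_subGrading.2 (mem_piGrading.2 fun i => extProj_mem _ _))
  · rw [eq_bot_iff]
    intro x hx
    rw [mem_subGrading, piGrading_of_neg hj, Submodule.mem_bot] at hx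
    exact Subtype.ext hx

/-- A basis of `𝓜 s` generates `M` minimally, so the kernel has no component in degree `0`. In the
other degrees, the long exact sequence of Cartan homology shifts the degree by one, because the
homology of the free module sits in degree `0`. -/
theorem exists_linear_cover [FiniteDimensional K M] (h𝓜 : IsGradedModule V 𝓜) {b : List V}
    (hb : LinearIndependent K b.get) (hlen : b.length = Module.finrank K V) {s : ℤ}
    (h : ∀ j, j ≠ s → CartanExact b 𝓜 j) :
    ∃ (n : ℕ) (ε : (Fin n → ExteriorAlgebra K V) →ₗ[ExteriorAlgebra K V] M),
      (∀ i, ε (Pi.single i 1) ∈ 𝓜 s) ∧ Function.Surjective ε ∧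
      IsGradedModule V (subGrading (LinearMap.ker ε)) ∧
      ∀ j, j ≠ 1 → CartanExact b (subGrading (LinearMap.ker ε)) j := by
  let c := Module.finBasis K (𝓜 s)
  let ε := Fintype.linearCombination (ExteriorAlgebra K V) (fun i => (c i : M))
  have hε : ∀ i, ε (Pi.single i 1) ∈ 𝓜 s := fun i => by
    rw [Fintype.linearCombination_apply_single, one_smul]
    exact (c i).2
  have hsurj : Function.Surjective ε := by
    rw [← LinearMap.range_eq_top, eq_top_iff, ← h𝓜.span_eq_top h, Submodule.span_le]
    intro x hx
    have h1 := congrArg Subtype.val (c.sum_repr ⟨x, hx⟩)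
    refine ⟨fun i => algebraMap K _ (c.repr ⟨x, hx⟩ i), ?_⟩
    rw [AddSubmonoidClass.coe_finsetSum] at h1
    refine Eq.trans ?_ h1
    simp only [ε, Fintype.linearCombination_apply, algebraMap_smul]
    rfl
  have hzero : ∀ x ∈ piGrading K V _ 0, ε x = 0 → x = 0 := by
    intro x hx hx0
    choose k hk using fun i => mem_extGrading_zero (mem_piGrading.1 hx i)
    have h1 : ∑ i, k i • c i = 0 := by
      refine Subtype.ext ?_
      rw [AddSubmonoidClass.coe_finsetSum]
      refine Eq.trans ?_ hx0
      simp only [ε, Fintype.linearCombination_apply, hk, algebraMap_smul]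
      rfl
    ext i
    rw [hk i, Fintype.linearIndependent_iff.1 c.linearIndependent k h1 i]
    simp
  have hgr : IsGradedModule V (subGrading (LinearMap.ker ε)) := by
    refine isGradedModule_subGrading fun j x hx => ?_
    obtain ⟨ρ, -, hρ, hρ'⟩ := h𝓜.hasProjections (j + s)
    have := map_proj_eq (isGradedModule_piGrading _).iSup_eq_top (ε.restrictScalars K)
      (fun _ _ hx => h𝓜.map_mem hε hx) (j := j) (π := (extProj K V j).compLeft (Fin _))
      ⟨fun x hx => funext fun i => extProj_of_mem (mem_piGrading.1 hx i),
      fun i hij x hx => funext fun k => extProj_of_mem_ne hij (mem_piGrading.1 hx k)⟩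
      ⟨hρ, hρ'⟩ x
    rw [LinearMap.mem_ker]
    refine this.trans ?_
    rw [LinearMap.restrictScalars_apply, LinearMap.mem_ker.1 hx, map_zero]
  refine ⟨_, ε, hε, hsurj, hgr, fun j hj => ?_⟩
  by_cases hj0 : j = 0
  · refine cartanExact_of_eq_bot ?_
    rw [eq_bot_iff]
    intro x hx
    subst hj0
    exact Subtype.ext (hzero _ hx x.2)
  intro z hz hz0
  have hz1 := cartanD_map (K := K) b (LinearMap.ker ε).subtype z
  rw [hz0] at hz1
  obtain ⟨w, hw, hw'⟩ := cartanExact_piGrading hb hlen _ hj0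
    (fun a => (LinearMap.ker ε).subtype (z a)) hz (hz1.trans (funext fun _ => map_zero _))
  have hw1 := cartanD_map (K := K) b ε w
  rw [hw'] at hw1
  -- The connecting map: a cycle `z` of the kernel is `D w` in the free module, and `ε w` is a cycle
  -- of `M` in a degree different from `s`, hence `D t`. With `u` lifting `t`, the family `w - D u`
  -- lies in the kernel and still bounds `z`.
  obtain ⟨t, ht, ht'⟩ := h (j - 1 + s) (by omega) (fun a => ε (w a))
    (fun a => h𝓜.map_mem hε (hw a)) (hw1.trans (funext fun a => (z a).2))
  have hu : ∀ a, ∃ u ∈ piGrading K V _ (j - 1 - 1), ε u = t a := fun a => by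
    obtain ⟨x, hx⟩ := hsurj (t a)
    obtain ⟨y, hy, hy'⟩ := h𝓜.exists_lift hε (x := x) (by rw [hx]; exact ht a)
    rw [show j - 1 + s - 1 - s = j - 1 - 1 by ring] at hy
    exact ⟨y, hy, hy'.trans hx⟩
  choose u hu hu' using hu
  have hu1 := cartanD_map (K := K) b ε u
  rw [funext hu', ht'] at hu1
  refine ⟨fun a => ⟨w a - cartanD K b u a, ?_⟩, fun a => ?_, ?_⟩
  · rw [LinearMap.mem_ker, map_sub, ← congrFun hu1 a, sub_self]
  · refine sub_mem (hw a) ?_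
    have := cartanD_mem (isGradedModule_piGrading _).smul_mem hu a
    rwa [sub_add_cancel] at this
  · ext a : 1
    refine Subtype.ext ?_
    have h1 := congrFun (cartanD_map (K := K) b (LinearMap.ker ε).subtype
      (fun a => (⟨w a - cartanD K b u a, by
        rw [LinearMap.mem_ker, map_sub, ← congrFun hu1 a, sub_self]⟩ : LinearMap.ker ε))) a
    refine h1.symm.trans ?_
    have h2 := congrFun (map_sub (cartanD K b) w (cartanD K b u)) a
    rw [cartanD_cartanD, hw', sub_zero] at h2
    exact h2

/-- Degrees in `N` are measured in a free module with basis in degree `0`, so generators of degree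
`1` are matrix columns with entries in `E_1`. The new kernel satisfies the same hypotheses as `N`,
so the construction can be iterated. -/
theorem exists_linear_presentation {b : List V} (hb : LinearIndependent K b.get)
    (hlen : b.length = Module.finrank K V) {n : ℕ}
    {N : Submodule (ExteriorAlgebra K V) (Fin n → ExteriorAlgebra K V)}
    (hN : IsGradedModule V (subGrading N)) (hN' : ∀ j, j ≠ 1 → CartanExact b (subGrading N) j) :
    ∃ (m : ℕ) (δ : (Fin m → ExteriorAlgebra K V) →ₗ[ExteriorAlgebra K V]
      (Fin n → ExteriorAlgebra K V)), (∀ i k, δ (Pi.single i 1) k ∈ ⋀[K]^1 V) ∧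
      LinearMap.range δ = N ∧ IsGradedModule V (subGrading (LinearMap.ker δ)) ∧
      ∀ j, j ≠ 1 → CartanExact b (subGrading (LinearMap.ker δ)) j := by
  have : FiniteDimensional K N := inferInstanceAs (FiniteDimensional K (N.restrictScalars K))
  obtain ⟨m, ε, hε, hsurj, hg, hc⟩ := exists_linear_cover hN hb hlen hN'
  have hker : LinearMap.ker (N.subtype ∘ₗ ε) = LinearMap.ker ε :=
    LinearMap.ker_comp_of_ker_eq_bot _ N.ker_subtype
  refine ⟨m, N.subtype ∘ₗ ε, fun i k => ?_, ?_, ?_⟩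
  · rw [← extGrading_natCast, Nat.cast_one]
    exact mem_piGrading.1 (mem_subGrading.1 (hε i)) k
  · ext x
    refine ⟨?_, fun hx => ?_⟩
    · rintro ⟨y, rfl⟩
      exact (ε y).2
    · obtain ⟨y, hy⟩ := hsurj ⟨x, hx⟩
      exact ⟨y, congrArg Subtype.val hy⟩
  · rw [hker]
    exact ⟨hg, hc⟩

/-- A module whose Cartan complex has homology concentrated in one internal degree has a linear
free resolution. -/
theorem hasLinearFreeResolution_of_cartanExact [FiniteDimensional K M] (h𝓜 : IsGradedModule V 𝓜)
    {b : List V} (hb : LinearIndependent K b.get) (hlen : b.length = Module.finrank K V) {s : ℤ}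
    (h : ∀ j, j ≠ s → CartanExact b 𝓜 j) : HasLinearFreeResolution (V := V) K 𝓜 := by
  let S := Σ n : ℕ, {N : Submodule (ExteriorAlgebra K V) (Fin n → ExteriorAlgebra K V) //
    IsGradedModule V (subGrading N) ∧ ∀ j, j ≠ 1 → CartanExact b (subGrading N) j}
  have step : ∀ S₀ : S, ∃ (S₁ : S) (δ : (Fin S₁.1 → ExteriorAlgebra K V) →ₗ[ExteriorAlgebra K V]
      (Fin S₀.1 → ExteriorAlgebra K V)), (∀ i k, δ (Pi.single i 1) k ∈ ⋀[K]^1 V) ∧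
      LinearMap.range δ = S₀.2.1 ∧ LinearMap.ker δ = S₁.2.1 := by
    rintro ⟨n, N, hN, hN'⟩
    obtain ⟨m, δ, hδ, hrange, hker⟩ := exists_linear_presentation hb hlen hN hN'
    exact ⟨⟨m, LinearMap.ker δ, hker⟩, δ, hδ, hrange, rfl⟩
  choose next δ hδ hrange hker using step
  obtain ⟨n, ε, hε, hsurj, hg, hc⟩ := exists_linear_cover h𝓜 hb hlen h
  let T : ℕ → S := fun d => Nat.rec ⟨n, LinearMap.ker ε, hg, hc⟩ (fun _ => next) d
  refine ⟨s, fun d => (T d).1, ε, fun d => δ (T d), hε, fun d => hδ (T d), hsurj, ?_, fun d => ?_⟩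
  · rw [LinearMap.exact_iff]
    exact (hrange (T 0)).symm
  · rw [LinearMap.exact_iff]
    exact (hker (T d)).trans (hrange (T (d + 1))).symm

end GradedModule

/-! ### Reduction to a power of the maximal ideal in terms of `FI` and `FE`. -/

section Power

variable {I : Ideal (ExteriorAlgebra K V)}

theorem setOf_mem_ofFn {s : ℕ} (f : Fin s → V) : {w | w ∈ List.ofFn f} = Set.range f := by
  ext w
  simp

theorem linearIndependent_get_ofFn {s : ℕ} {f : Fin s → V} :
    LinearIndependent K (List.ofFn f).get ↔ LinearIndependent K f := by
  have h : (List.ofFn f).get = f ∘ finCongr (List.length_ofFn (f := f)) := by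
    ext i
    rw [List.get_ofFn]
    rfl
  rw [h]
  exact linearIndependent_equiv _

theorem mem_linIdeal_iff {s : ℕ} {f : Fin s → V} (hf : LinearIndependent K f)
    {x : ExteriorAlgebra K V} :
    x ∈ linIdeal K (Set.range f) ↔ formProd K (List.ofFn f) * x = 0 := by
  have key := (regularSeq_exteriorAlgebra
    (linearIndependent_get_ofFn.2 hf)).formProd_smul_eq_zero_iff (x := x)
  rw [smul_eq_mul, setOf_mem_ofFn] at key
  rw [key]
  constructor
  · intro h
    have := Submodule.smul_mem_smul h (Submodule.mem_top (x := (1 : ExteriorAlgebra K V)))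
    rwa [smul_eq_mul x, mul_one] at this
  · intro h
    refine Submodule.smul_induction_on h (fun r hr m _ => ?_) fun _ _ hx hy => add_mem hx hy
    exact Ideal.mul_mem_right _ _ hr

theorem exists_sum_of_extProj_eq_zero [FiniteDimensional K V] {k : ℕ} {x : ExteriorAlgebra K V}
    (hx : ∀ p : ℤ, p < k → extProj K V p x = 0) :
    x = ∑ p ∈ (Finset.range (Module.finrank K V + 1)).filter (k ≤ ·), extProj K V p x := by
  conv_lhs => rw [← sum_extProj x]
  rw [Finset.sum_filter]
  refine Finset.sum_congr rfl fun p _ => ?_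
  split_ifs with h
  · rfl
  · exact hx _ (by omega)

/-- One direction holds because orders of vanishing add under multiplication, the other because `⋀^p
V` is spanned by products of `p` linear forms. -/
theorem mem_maxIdeal_map_pow_iff [FiniteDimensional K V] {J : Ideal (ExteriorAlgebra K V)}
    [J.IsTwoSided] {k : ℕ} {y : ExteriorAlgebra K V ⧸ J} :
    y ∈ ((maxIdeal K V).map (Ideal.Quotient.mk J)) ^ k ↔
      ∃ x, (∀ p : ℤ, p < k → extProj K V p x = 0) ∧ Ideal.Quotient.mk J x = y := by
  have hsurj : Function.Surjective (Ideal.Quotient.mk J) := Ideal.Quotient.mk_surjective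
  constructor
  · have hext : ∀ {p j : ℤ} {x y : ExteriorAlgebra K V}, x ∈ extGrading K V j →
        extProj K V p (x * y) = x * extProj K V (p - j) y := by
      intro p j x y hx
      refine (map_proj_eq iSup_extGrading (LinearMap.mulLeft K x)
        (𝓝 := extGrading K V) (d := j) (fun i y hy => by
        rw [add_comm i]; exact mul_mem_extGrading hx hy) (j := p - j) (π := extProj K V (p - j))
        ⟨fun _ => extProj_of_mem, fun _ h _ => extProj_of_mem_ne h⟩ (ρ := extProj K V p)
        ⟨fun z hz => extProj_of_mem (by rwa [sub_add_cancel] at hz),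
          fun i h z hz => extProj_of_mem_ne (by rwa [sub_add_cancel] at h) hz⟩ y).symm
    have hle : ∀ {k l : ℕ} {x y : ExteriorAlgebra K V}, (∀ p : ℤ, p < k → extProj K V p x = 0) →
        (∀ p : ℤ, p < l → extProj K V p y = 0) →
        ∀ p : ℤ, p < (k + l : ℕ) → extProj K V p (x * y) = 0 := by
      intro k l x y hx hy p hp
      rw [exists_sum_of_extProj_eq_zero hx, Finset.sum_mul, map_sum]
      refine Finset.sum_eq_zero fun i hi => ?_
      rw [Finset.mem_filter] at hi
      rw [hext (extProj_mem i x), hy _ (by omega), mul_zero]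
    induction k generalizing y with
    | zero =>
      intro _
      obtain ⟨x, rfl⟩ := hsurj y
      refine ⟨x, fun p hp => ?_, rfl⟩
      have := extProj_mem p x
      rwa [extGrading_of_neg (by exact_mod_cast hp)] at this
    | succ k ih =>
      intro hy
      rw [Submodule.pow_succ] at hy
      refine Submodule.mul_induction_on hy (fun a ha c hc => ?_) ?_
      · obtain ⟨x, hx, rfl⟩ := ih ha
        obtain ⟨z, hz, rfl⟩ := (Ideal.mem_map_iff_of_surjective _ hsurj).1 hc
        refine ⟨x * z, hle hx ?_, map_mul _ _ _⟩
        refine Submodule.span_induction ?_ (fun p _ => map_zero _) (fun a c _ _ ha hc p hp => by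
          rw [map_add, ha p hp, hc p hp, add_zero]) (fun a c _ hc p hp => ?_) hz
        · rintro _ ⟨v, rfl⟩ p hp
          exact extProj_of_mem_ne (by rintro rfl; simp at hp) (ι_mem_extGrading v)
        · refine hle (k := 0) (fun q hq => ?_) hc p (by simpa using hp)
          have := extProj_mem q a
          rwa [extGrading_of_neg (by exact_mod_cast hq)] at this
      · rintro _ _ ⟨x, hx, rfl⟩ ⟨z, hz, rfl⟩
        exact ⟨x + z, fun p hp => by rw [map_add, hx p hp, hz p hp, add_zero], map_add _ _ _⟩
  · rintro ⟨x, hx, rfl⟩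
    have key : ∀ (k p : ℕ), k ≤ p → ∀ x ∈ ⋀[K]^p V, Ideal.Quotient.mk J x ∈
        ((maxIdeal K V).map (Ideal.Quotient.mk J)) ^ k := by
      intro k p hp x hx
      induction hx using Submodule.pow_induction_on_right' generalizing k with
      | algebraMap r =>
        obtain rfl : k = 0 := by omega
        rw [Submodule.pow_zero, Ideal.one_eq_top]
        exact Submodule.mem_top
      | add x y i _ _ hx hy =>
        rw [map_add]
        exact add_mem (hx _ hp) (hy _ hp)
      | mul_mem i x _ ih m hm =>
        obtain ⟨v, rfl⟩ := hm
        cases k with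
        | zero =>
          rw [Submodule.pow_zero, Ideal.one_eq_top]
          exact Submodule.mem_top
        | succ k =>
          rw [Submodule.pow_succ, map_mul]
          exact Ideal.mul_mem_mul (ih _ (by omega))
            (Ideal.mem_map_of_mem _ (Ideal.subset_span ⟨v, rfl⟩))
    rw [exists_sum_of_extProj_eq_zero hx, map_sum]
    refine sum_mem fun p hp => ?_
    refine key k p (Finset.mem_filter.1 hp).2 _ ?_
    rw [← extGrading_natCast]
    exact extProj_mem _ _

/-- Modulo the linear forms with product `F`, the ideal `I` is the `k`-th power of the maximal
ideal. -/
def IsPowerModulo (I : Ideal (ExteriorAlgebra K V)) (F : ExteriorAlgebra K V) (k : ℕ) : Prop :=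
  (∀ p : ℤ, p < k → ∀ x ∈ I, x ∈ extGrading K V p → F * x = 0) ∧
    ∀ p : ℤ, k ≤ p → ∀ x ∈ extGrading K V p, ∃ y ∈ I, F * y = F * x

/-- Multiplication by `F` identifies `E/(f)` with `FE`. Since `I` and the powers of the maximal
ideal are homogeneous, the comparison can be made degree by degree. -/
theorem reducesToPower_iff [FiniteDimensional K V]
    (hI : I.IsHomogeneous (fun p : ℕ => ⋀[K]^p V)) {s : ℕ} {f : Fin s → V}
    (hf : LinearIndependent K f) :
    ReducesToPower I f ↔ ∃ k, IsPowerModulo I (formProd K (List.ofFn f)) k := by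
  have hsurj : Function.Surjective (Ideal.Quotient.mk (linIdeal K (Set.range f))) :=
    Ideal.Quotient.mk_surjective
  have hmk : ∀ x y, Ideal.Quotient.mk (linIdeal K (Set.range f)) x =
      Ideal.Quotient.mk (linIdeal K (Set.range f)) y ↔
      formProd K (List.ofFn f) * x = formProd K (List.ofFn f) * y := fun x y => by
    rw [Ideal.Quotient.eq, mem_linIdeal_iff hf, mul_sub, sub_eq_zero]
  refine exists_congr fun k => ⟨fun h => ⟨fun p hp x hx hxp => ?_, fun p hp x hx => ?_⟩,
    fun h => le_antisymm (fun y hy => ?_) fun y hy => ?_⟩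
  · have h1 := Ideal.mem_map_of_mem (Ideal.Quotient.mk (linIdeal K (Set.range f))) hx
    rw [h] at h1
    obtain ⟨z, hz, hz'⟩ := mem_maxIdeal_map_pow_iff.1 h1
    rw [hmk] at hz'
    have h2 := map_proj_eq iSup_extGrading (LinearMap.mulLeft K (formProd K (List.ofFn f)))
      (𝓝 := extGrading K V) (d := (List.ofFn f).length) (fun i y hy =>
        (isGradedModule_extGrading K V).formProd_smul_mem _ hy) (j := p) (π := extProj K V p)
        ⟨fun _ => extProj_of_mem, fun _ h _ => extProj_of_mem_ne h⟩
        (ρ := extProj K V (p + (List.ofFn f).length))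
        ⟨fun _ => extProj_of_mem, fun _ h _ => extProj_of_mem_ne h⟩ z
    rw [hz p hp, map_zero, LinearMap.mulLeft_apply, hz', extProj_of_mem] at h2
    · exact h2.symm
    · exact (isGradedModule_extGrading K V).formProd_smul_mem _ hxp
  · have h1 : Ideal.Quotient.mk (linIdeal K (Set.range f)) x ∈
        ((maxIdeal K V).map (Ideal.Quotient.mk (linIdeal K (Set.range f)))) ^ k :=
      mem_maxIdeal_map_pow_iff.2 ⟨x, fun q hq => extProj_of_mem_ne (by omega) hx, rfl⟩
    rw [← h] at h1
    obtain ⟨y, hy, hy'⟩ := (Ideal.mem_map_iff_of_surjective _ hsurj).1 h1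
    exact ⟨y, hy, (hmk _ _).1 hy'⟩
  · obtain ⟨x, hx, rfl⟩ := (Ideal.mem_map_iff_of_surjective _ hsurj).1 hy
    refine mem_maxIdeal_map_pow_iff.2
      ⟨∑ p ∈ (Finset.range (Module.finrank K V + 1)).filter (k ≤ ·), extProj K V p x,
      fun p hp => ?_, ?_⟩
    · rw [map_sum]
      refine Finset.sum_eq_zero fun q hq => extProj_of_mem_ne ?_ (extProj_mem _ _)
      have := (Finset.mem_filter.1 hq).2
      omega
    · rw [hmk]
      conv_rhs => rw [← sum_extProj x]
      rw [Finset.sum_filter, Finset.mul_sum, Finset.mul_sum]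
      refine Finset.sum_congr rfl fun p _ => ?_
      split_ifs with hpk
      · rfl
      · rw [mul_zero, h.1 p (by omega) _ (extProj_mem_ideal hI _ hx) (extProj_mem _ _)]
  · obtain ⟨x, hx, rfl⟩ := mem_maxIdeal_map_pow_iff.1 hy
    rw [exists_sum_of_extProj_eq_zero hx, map_sum]
    refine sum_mem fun p hp => ?_
    obtain ⟨y, hy, hy'⟩ := h.2 p (by exact_mod_cast (Finset.mem_filter.1 hp).2) _ (extProj_mem p x)
    rw [← (hmk _ _).2 hy']
    exact Ideal.mem_map_of_mem _ hy

end Power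

/-! ### Reduction to a power implies linear resolutions. -/

section Linear

variable [FiniteDimensional K V] {I : Ideal (ExteriorAlgebra K V)}

theorem ofFn_snoc {α : Type*} {s : ℕ} (f : Fin s → α) (v : α) :
    List.ofFn (Fin.snoc f v : Fin (s + 1) → α) = List.ofFn f ++ [v] := by
  rw [List.ofFn_succ_last]
  simp

theorem exists_basis_append {f : List V} (hf : LinearIndependent K f.get) :
    ∃ g : List V, LinearIndependent K (f ++ g).get ∧ (f ++ g).length = Module.finrank K V := by
  suffices H : ∀ (m s : ℕ) (f : Fin s → V), LinearIndependent K f → s + m = Module.finrank K V →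
      ∃ g : List V, LinearIndependent K (List.ofFn f ++ g).get ∧
        (List.ofFn f ++ g).length = Module.finrank K V by
    have hle : f.length ≤ Module.finrank K V := by
      simpa using hf.fintype_card_le_finrank
    have := H (Module.finrank K V - f.length) f.length f.get hf (by omega)
    rwa [List.ofFn_get] at this
  intro m
  induction m with
  | zero =>
    intro s f hf hs
    refine ⟨[], ?_, by simpa using hs⟩
    rw [List.append_nil]
    exact linearIndependent_get_ofFn.2 hf
  | succ m ih =>
    intro s f hf hs
    obtain ⟨v, hv⟩ := exists_linearIndependent_snoc_of_lt_finrank hf (by omega)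
    obtain ⟨g, hg⟩ := ih (s + 1) _ hv (by omega)
    rw [ofFn_snoc, List.append_assoc] at hg
    exact ⟨_, hg⟩

instance : FiniteDimensional K I :=
  inferInstanceAs (FiniteDimensional K (I.restrictScalars K))

theorem exists_mem_ideal_homogeneous (hI : I.IsHomogeneous (fun p : ℕ => ⋀[K]^p V)) (f : List V)
    {j : ℤ} {y : ExteriorAlgebra K V} (hy : y ∈ I)
    (hj : formProd K f * y ∈ extGrading K V (j + f.length)) :
    ∃ y' ∈ I, y' ∈ extGrading K V j ∧ formProd K f * y' = formProd K f * y := by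
  obtain ⟨z, hz, hz'⟩ := exists_homogeneous_preimage (isGradedModule_idealGrading hI).iSup_eq_top
    (hasProjections_extGrading (K := K) (V := V))
    (LinearMap.mulLeft K (formProd K f) ∘ₗ I.subtype.restrictScalars K) (d := f.length)
    (fun i x hx => (isGradedModule_extGrading K V).formProd_smul_mem f hx) ⟨y, hy⟩ hj
  exact ⟨z, z.2, hz, hz'⟩

variable (I) in
/-- The functionals on `E/I`, regarded as functionals on `E`. -/
def quotientDualInclusion [I.IsTwoSided] : QuotientDual I →ₗ[ExteriorAlgebra K V]
    QuotientDual (⊥ : Ideal (ExteriorAlgebra K V)) where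
  toFun φ := (show Module.Dual K (ExteriorAlgebra K V ⧸ I) from φ) ∘ₗ
    (Submodule.factor (bot_le : (⊥ : Ideal (ExteriorAlgebra K V)) ≤ I)).restrictScalars K
  map_add' _ _ := rfl
  map_smul' _ _ := quotientDual_ext fun _ => rfl

theorem quotientDualInclusion_mk [I.IsTwoSided] (φ : QuotientDual I) (x : ExteriorAlgebra K V) :
    quotientDualInclusion I φ (Submodule.Quotient.mk x) = φ (Submodule.Quotient.mk x) := rfl

theorem quotientDualInclusion_injective [I.IsTwoSided] :
    Function.Injective (quotientDualInclusion I) := fun φ ψ h => quotientDual_ext fun x => by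
  rw [← quotientDualInclusion_mk, h, quotientDualInclusion_mk]

/-- After removing `f`, the module `FI` is zero in the relevant degree if `j < k`. If `j > k`, it
contains all of `FE` in the preceding degree, and `FE` is exact there since `j ≠ 0`. -/
theorem IsPowerModulo.cartanExact_idealGrading (hI : I.IsHomogeneous (fun p : ℕ => ⋀[K]^p V))
    {f g : List V} (hfg : LinearIndependent K (f ++ g).get)
    (hlen : (f ++ g).length = Module.finrank K V) (hf : LinearIndependent K f.get)
    (hreg : RegularSeq K (ExteriorAlgebra K V ⧸ I) f) {k : ℕ}
    (h : IsPowerModulo I (formProd K f) k) {j : ℤ} (hj : j ≠ k) :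
    CartanExact (f ++ g) (idealGrading I) j := by
  have hE := isGradedModule_extGrading K V
  have hg := isGradedModule_idealGrading hI
  have hfE := regularSeq_exteriorAlgebra hf
  rw [((hreg.ideal hfE).graded hg).cartanExact_iff hg.smul_mem]
  rcases lt_or_gt_of_ne hj with hj | hj
  · refine cartanExact_of_eq_bot ?_
    rw [eq_bot_iff]
    intro x hx
    obtain ⟨y, hy, rfl⟩ := mem_smulGrading.1 hx
    rw [add_sub_cancel_right] at hy
    exact Subtype.ext (h.1 j hj y y.2 hy)
  · have key := (((hfE.graded hE).cartanExact_iff hE.smul_mem g j)).1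
      (cartanExact_extGrading hfg hlen (by omega))
    refine key.of_map I.subtype Subtype.val_injective ?_ ?_
    · intro x hx
      obtain ⟨y, hy, rfl⟩ := mem_smulGrading.1 hx
      exact mem_smulGrading.2 ⟨y, hy, rfl⟩
    · intro x hx
      obtain ⟨y, hy, rfl⟩ := mem_smulGrading.1 hx
      obtain ⟨z, hz, hz'⟩ := h.2 _ (by omega) y hy
      obtain ⟨u, hu, hu', hu''⟩ := exists_mem_ideal_homogeneous hI f (j := j + f.length - 1 -
        f.length) hz (by rw [hz']; exact hE.formProd_smul_mem f hy)
      exact ⟨formProd K f • ⟨u, hu⟩, mem_smulGrading.2 ⟨⟨u, hu⟩, hu', rfl⟩, hu''.trans hz'⟩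

/-- In degrees at most `-k` the module `F(E/I)^*` vanishes, since `F E_p ⊆ I` for `p ≥ k`. In
degrees at least `1 - k` it is all of `FE^*`: if `x` has degree less than `k` and `x F ∈ I`, then `x
F = 0`, so a functional on `E` induces one on `E/I`. The bound `hk` keeps the degree `-g.length`,
where `FE^*` has homology, out of the range of the comparison. -/
theorem IsPowerModulo.cartanExact_quotientDualGrading [I.IsTwoSided]
    (hI : I.IsHomogeneous (fun p : ℕ => ⋀[K]^p V))
    {f g : List V} (hfg : LinearIndependent K (f ++ g).get)
    (hlen : (f ++ g).length = Module.finrank K V) (hf : LinearIndependent K f.get)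
    (hreg : RegularSeq K (ExteriorAlgebra K V ⧸ I) f) {k : ℕ}
    (h : IsPowerModulo I (formProd K f) k) (hk : k ≤ g.length + 1) {j : ℤ}
    (hj : j ≠ 1 - k - f.length) :
    CartanExact (f ++ g) (quotientDualGrading I) j := by
  have hE := isGradedModule_extGrading K V
  have hg := isGradedModule_quotientDualGrading hI
  have hb := isHomogeneous_bot (K := K) (V := V)
  have hgb := isGradedModule_quotientDualGrading hb
  rw [(hreg.quotientDual hI).cartanExact_iff hg.smul_mem]
  rcases lt_or_ge (j + f.length) (1 - k) with hlt | hle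
  · refine cartanExact_of_eq_bot ?_
    rw [eq_bot_iff]
    intro φ hφ
    obtain ⟨ψ, hψ, rfl⟩ := mem_smulGrading.1 hφ
    rw [add_sub_cancel_right] at hψ
    rw [Submodule.mem_bot]
    refine quotientDual_eq_of_forall_mem hI (hg.formProd_smul_mem f hψ) (zero_mem _) fun x hx => ?_
    obtain ⟨c, -, hc⟩ := exists_mul_formProd_eq_smul (K := K) (-(j + f.length)) f
    obtain ⟨y, hy, hy'⟩ := h.2 _ (by omega) x hx
    rw [quotientDual_smul_mk, hc x hx, ← hy', (Submodule.Quotient.mk_eq_zero I).2]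
    · exact LinearMap.map_zero (show Module.Dual K _ from ψ)
    · exact (I.restrictScalars K).smul_mem c (I.mul_mem_left _ hy)
  · have key := ((((regularSeq_quotient_bot (regularSeq_exteriorAlgebra hf)).quotientDual
      hb).cartanExact_iff hgb.smul_mem g j)).1 (cartanExact_quotientDual_bot hfg hlen (by
        rw [List.length_append]; push_cast; omega))
    refine key.of_map (quotientDualInclusion I) quotientDualInclusion_injective ?_ ?_
    · intro φ hφ
      obtain ⟨ψ, hψ, rfl⟩ := mem_smulGrading.1 hφ
      refine mem_smulGrading.2 ⟨quotientDualInclusion I ψ, ?_, (map_smul _ _ _).symm⟩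
      exact mem_quotientDualGrading.2 fun i hi x hx => mem_quotientDualGrading.1 hψ i hi x hx
    · intro φ hφ
      obtain ⟨ψ, hψ, rfl⟩ := mem_smulGrading.1 hφ
      obtain ⟨θ, hθ, hθ'⟩ := exists_quotientDual_of_ker_le hI (i := j + f.length - 1)
        (j := j + f.length - 1 - f.length) ψ (formProd K f) (formProd K f)
        (fun x hx => by
          convert mul_mem_extGrading hx (formProd_mem_extGrading f) using 2
          ring) (fun x hx hxI => by
          obtain ⟨c, hc, hc'⟩ := exists_mul_formProd_eq_smul (K := K) (-(j + f.length - 1)) f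
          have hFx : formProd K f * x ∈ I := by
            have := (I.restrictScalars K).smul_mem c⁻¹ hxI
            rwa [hc' x hx, smul_smul, inv_mul_cancel₀ hc, one_smul] at this
          obtain ⟨y, hy, hy'⟩ := hreg.exists_mem_of_formProd_mul_mem hFx
          obtain ⟨z, hz, hz', hz''⟩ := exists_mem_ideal_homogeneous hI f hy
            (by rw [hy']; exact hE.formProd_smul_mem f hx)
          have h0 : x * formProd K f = 0 := by
            rw [hc' x hx, ← hy', ← hz'', h.1 _ (by omega) z hz hz', smul_zero]
          rw [h0]
          exact LinearMap.map_zero (show Module.Dual K _ from ψ))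
      refine ⟨formProd K f • θ, mem_smulGrading.2 ⟨θ, hθ, rfl⟩, ?_⟩
      have hmem := hgb.formProd_smul_mem f hψ
      rw [sub_add_cancel] at hmem
      have hmem' := hg.formProd_smul_mem f hθ
      rw [sub_add_cancel] at hmem'
      refine quotientDual_eq_of_forall_mem hb (mem_quotientDualGrading.2 fun i hi x hx =>
        mem_quotientDualGrading.1 hmem' i hi x hx) hmem fun x hx => ?_
      rw [quotientDualInclusion_mk, quotientDual_smul_mk, quotientDual_smul_mk]
      exact hθ' x hx

/-- As `F E_p = 0` for `p > g.length`, larger exponents describe the same situation; this supplies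
the bound on `k` needed for the dual. -/
theorem IsPowerModulo.min {f g : List V} (hlen : (f ++ g).length = Module.finrank K V) {k : ℕ}
    (h : IsPowerModulo I (formProd K f) k) :
    IsPowerModulo I (formProd K f) (min k (g.length + 1)) := by
  refine ⟨fun p hp => h.1 p (by omega), fun p hp x hx => ?_⟩
  rcases lt_or_ge p k with hpk | hpk
  · have h0 := (isGradedModule_extGrading K V).formProd_smul_mem f hx
    rw [List.length_append] at hlen
    rw [extGrading_eq_bot_of_gt (by omega), Submodule.mem_bot] at h0
    exact ⟨0, zero_mem _, by rw [mul_zero]; exact h0.symm⟩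
  · exact h.2 p hpk x hx

theorem bothLinear_of_isPowerModulo [I.IsTwoSided]
    (hI : I.IsHomogeneous (fun p : ℕ => ⋀[K]^p V)) {f : List V}
    (hf : LinearIndependent K f.get) (hreg : RegularSeq K (ExteriorAlgebra K V ⧸ I) f) {k : ℕ}
    (h : IsPowerModulo I (formProd K f) k) : BothLinear I := by
  obtain ⟨g, hfg, hlen⟩ := exists_basis_append hf
  exact ⟨hasLinearFreeResolution_of_cartanExact (isGradedModule_idealGrading hI) hfg hlen
    fun j hj => h.cartanExact_idealGrading hI hfg hlen hf hreg hj,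
    hasLinearFreeResolution_of_cartanExact (isGradedModule_quotientDualGrading hI) hfg hlen
    fun j hj => (h.min hlen).cartanExact_quotientDualGrading hI hfg hlen hf hreg
      (min_le_right _ _) hj⟩

theorem bothLinear_of_reducesForSome [I.IsTwoSided]
    (hI : I.IsHomogeneous (fun p : ℕ => ⋀[K]^p V)) (h : ReducesForSome I) : BothLinear I := by
  obtain ⟨s, f, hf, hred⟩ := h
  obtain ⟨hind, hreg⟩ := isRegularSequence_iff.1 hf.1
  obtain ⟨k, hk⟩ := (reducesToPower_iff hI hind).1 hred
  exact bothLinear_of_isPowerModulo hI (linearIndependent_get_ofFn.2 hind) hreg hk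

/-- Maximal regular sequences exist. -/
theorem exists_isMaximalRegularSequence (M : Type*) [AddCommGroup M]
    [Module (ExteriorAlgebra K V) M] :
    ∃ (s : ℕ) (f : Fin s → V), IsMaximalRegularSequence K M f := by
  classical
  let P : ℕ → Prop := fun s => ∃ f : Fin s → V, IsRegularSequence K M f
  have h0 : P 0 := ⟨Fin.elim0, linearIndependent_empty_type, fun i => i.elim0⟩
  obtain ⟨f, hf⟩ : P (Nat.findGreatest P (Module.finrank K V)) :=
    Nat.findGreatest_spec (Nat.zero_le _) h0
  refine ⟨_, f, hf, fun v hv => ?_⟩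
  have hle : Nat.findGreatest P (Module.finrank K V) + 1 ≤ Module.finrank K V := by
    simpa using hv.1.fintype_card_le_finrank
  exact Nat.findGreatest_is_greatest (Nat.lt_succ_self _) hle ⟨_, hv⟩

end Linear

/-! ### Multiplication by a generic linear form. -/

section GenericForm

variable {M : Type*} [AddCommGroup M] [Module K M] [Module (ExteriorAlgebra K V) M]
  [IsScalarTower K (ExteriorAlgebra K V) M] [FiniteDimensional K M]

/-- Exactness at the component of degree `j` of the complex given by multiplication by `v`. -/
def ExactAt (v : V) (𝓜 : ℤ → Submodule K M) (j : ℤ) : Prop :=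
  ∀ x ∈ 𝓜 j, ι K v • x = 0 → ∃ y ∈ 𝓜 (j - 1), ι K v • y = x

-- Exactness of the Cartan complex is the hypothesis of `exists_polynomial_of_sequence_exact` for
-- the multiplications by the forms of `g` on consecutive components, so it persists for one
-- combination of these forms with generic coefficients.
open MvPolynomial in
theorem CartanExact.exists_polynomial {𝓜 : ℤ → Submodule K M}
    (h𝓜 : ∀ (v : V) (j : ℤ), ∀ x ∈ 𝓜 j, ι K v • x ∈ 𝓜 (j + 1)) {g : List V} {j : ℤ}
    (h : CartanExact g 𝓜 j) :
    ∃ P : MvPolynomial (Fin g.length) K, P ≠ 0 ∧ ∀ c, eval c P ≠ 0 →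
      ExactAt (∑ i, c i • g.get i) 𝓜 j := by
  let A : Fin g.length → 𝓜 (j - 1) →ₗ[K] 𝓜 j := fun i =>
    ((Algebra.lsmul K K M (ι K (g.get i))) ∘ₗ (𝓜 (j - 1)).subtype).codRestrict _ fun x => by
      have := h𝓜 (g.get i) _ x x.2
      rwa [sub_add_cancel] at this
  let B : Fin g.length → 𝓜 j →ₗ[K] M := fun i =>
    Algebra.lsmul K K M (ι K (g.get i)) ∘ₗ (𝓜 j).subtype
  have hsum : ∀ (c : Fin g.length → K) (x : M),
      ι K (∑ i, c i • g.get i) • x = ∑ i, c i • ι K (g.get i) • x := fun c x => by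
    rw [map_sum, Finset.sum_smul]
    exact Finset.sum_congr rfl fun i _ => by rw [map_smul, smul_assoc]
  obtain ⟨P, hP, hP'⟩ := exists_polynomial_of_sequence_exact A B (fun z hz => by
    obtain ⟨w, hw, hw'⟩ := h (fun α => z α) (fun α => (z α).2) (funext hz)
    refine ⟨fun α => ⟨w α, hw α⟩, fun α => Subtype.ext ?_⟩
    rw [AddSubmonoidClass.coe_finsetSum]
    exact congrFun hw' α)
  refine ⟨P, hP, fun c hc x hx hx0 => ?_⟩
  obtain ⟨u, hu⟩ := hP' c hc ⟨x, hx⟩ (by rw [hsum] at hx0; exact hx0)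
  refine ⟨u, u.2, ?_⟩
  have h1 := congrArg Subtype.val hu
  rw [AddSubmonoidClass.coe_finsetSum] at h1
  rw [hsum]
  exact h1

open MvPolynomial in
theorem exists_polynomial_forall_exactAt {𝓜 : ℤ → Submodule K M}
    (h𝓜 : ∀ (v : V) (j : ℤ), ∀ x ∈ 𝓜 j, ι K v • x ∈ 𝓜 (j + 1)) {g : List V} (J : Finset ℤ)
    (h : ∀ j ∈ J, CartanExact g 𝓜 j) :
    ∃ P : MvPolynomial (Fin g.length) K, P ≠ 0 ∧ ∀ c, eval c P ≠ 0 →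
      ∀ j ∈ J, ExactAt (∑ i, c i • g.get i) 𝓜 j := by
  choose! P hP hP' using fun j hj => (h j hj).exists_polynomial h𝓜
  refine ⟨∏ j ∈ J, P j, Finset.prod_ne_zero_iff.2 hP, fun c hc j hj => hP' j hj c ?_⟩
  rw [map_prod, Finset.prod_ne_zero_iff] at hc
  exact hc j hj

end GenericForm

/-! ### Linear resolutions imply reduction to a power, over infinite fields. -/

section Converse

variable [FiniteDimensional K V] {I : Ideal (ExteriorAlgebra K V)}

theorem quotientDualProj_mk (hI : I.IsHomogeneous (fun p : ℕ => ⋀[K]^p V)) {p : ℤ}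
    (φ : QuotientDual I) {x : ExteriorAlgebra K V} (hx : x ∈ extGrading K V p) :
    quotientDualProj hI p φ (Submodule.Quotient.mk x) = φ (Submodule.Quotient.mk x) := by
  rw [quotientDualProj_apply, quotientProj_mk, extProj_of_mem hx]

theorem quotientDual_mk_smul (φ : QuotientDual I) (c : K) (x : ExteriorAlgebra K V) :
    φ (Submodule.Quotient.mk (c • x)) = c * φ (Submodule.Quotient.mk x) :=
  LinearMap.map_smul (show Module.Dual K (ExteriorAlgebra K V ⧸ I) from φ) c
    (Submodule.Quotient.mk x)

theorem quotientDual_mk_eq_zero (φ : QuotientDual I) {x : ExteriorAlgebra K V} (hx : x ∈ I) :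
    φ (Submodule.Quotient.mk x) = 0 := by
  rw [(Submodule.Quotient.mk_eq_zero I).2 hx]
  exact LinearMap.map_zero (show Module.Dual K (ExteriorAlgebra K V ⧸ I) from φ)

theorem mem_of_quotientDualGrading_eq_bot (hI : I.IsHomogeneous (fun p : ℕ => ⋀[K]^p V)) {p : ℤ}
    (h : quotientDualGrading I (-p) = ⊥) {x : ExteriorAlgebra K V} (hx : x ∈ extGrading K V p) :
    x ∈ I := by
  by_contra hxI
  obtain ⟨φ, hφ⟩ := Module.Projective.exists_dual_ne_zero K (x := (Submodule.Quotient.mk x :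
    ExteriorAlgebra K V ⧸ I)) (by rwa [Ne, Submodule.Quotient.mk_eq_zero])
  have h0 := quotientDualProj_mem hI p φ
  rw [h, Submodule.mem_bot] at h0
  have h1 := quotientDualProj_mk hI φ hx
  rw [h0] at h1
  exact hφ h1.symm

/-- Exactness of multiplication by `v` on `F (E/I)^*` gives exactness on `F (E/I)` in the dual
degree. -/
theorem ExactAt.of_quotientDual [I.IsTwoSided] (hI : I.IsHomogeneous (fun p : ℕ => ⋀[K]^p V))
    {f : List V} {v : V} {p : ℤ}
    (h : ExactAt v (smulGrading (formProd K f) f.length (quotientDualGrading I)) (-p))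
    {x : ExteriorAlgebra K V} (hx : x ∈ extGrading K V p)
    (hx0 : ι K v * (formProd K f * x) ∈ I) :
    ∃ y ∈ extGrading K V (p - 1), formProd K f * x - ι K v * (formProd K f * y) ∈ I := by
  have hE := isGradedModule_extGrading K V
  have hg := isGradedModule_quotientDualGrading hI
  let W : Submodule K (ExteriorAlgebra K V ⧸ I) := (extGrading K V (p - 1)).map
    (I.mkQ.restrictScalars K ∘ₗ LinearMap.mulLeft K (ι K v * formProd K f))
  by_cases hW : (Submodule.Quotient.mk (formProd K f * x) : ExteriorAlgebra K V ⧸ I) ∈ W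
  · obtain ⟨y, hy, hy'⟩ := hW
    refine ⟨y, hy, ?_⟩
    rw [← mul_assoc, ← Submodule.Quotient.eq]
    exact hy'.symm
  exfalso
  -- A functional separating `F x` from `v F E_{p-1}` modulo `I`, cut down to one degree, gives `φ`
  -- with `v F φ = 0`. By exactness `F φ = v F ψ`, and evaluation at `x` gives `φ (x F) = ψ (x v F)
  -- = 0` because `v F x ∈ I`. This contradicts the separation.
  obtain ⟨φ₀, hφ₀, hW'⟩ := Submodule.exists_dual_map_eq_bot_of_notMem hW inferInstance
  let φ : QuotientDual I := quotientDualProj hI (p + f.length) φ₀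
  have hφ : φ ∈ quotientDualGrading I (-p - f.length) := by
    rw [show -p - (f.length : ℤ) = -(p + f.length) by ring]
    exact quotientDualProj_mem hI _ φ₀
  have hφ' : ∀ y ∈ extGrading K V (p + f.length),
      φ (Submodule.Quotient.mk y) = φ₀ (Submodule.Quotient.mk y) := fun y hy =>
    quotientDualProj_mk hI φ₀ hy
  have hFx : formProd K f * x ∈ extGrading K V (p + f.length) := hE.formProd_smul_mem f hx
  have hFφ := hg.formProd_smul_mem f hφ
  rw [sub_add_cancel] at hFφ
  have h0 : ι K v • formProd K f • φ = 0 := by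
    refine quotientDual_eq_of_forall_mem hI (hg.smul_mem v _ _ hFφ) (zero_mem _) fun y hy => ?_
    rw [show -(-p + 1) = p - 1 by ring] at hy
    obtain ⟨c, -, hc⟩ := exists_mul_formProd_eq_smul (K := K) (p - 1) (f ++ [v])
    have hy' := hE.formProd_smul_mem (f ++ [v]) hy
    rw [List.length_append, List.length_singleton, Nat.cast_add, Nat.cast_one,
      show p - 1 + ((f.length : ℤ) + 1) = p + f.length by ring] at hy'
    rw [quotientDual_smul_mk, quotientDual_smul_mk, mul_assoc, ← formProd_concat, hc y hy,
      quotientDual_mk_smul, ← smul_eq_mul (formProd K _) y, hφ' _ hy']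
    have h1 : φ₀ (Submodule.Quotient.mk (formProd K (f ++ [v]) • y)) = 0 := by
      refine (Submodule.mem_bot K).1 (hW' ▸ Submodule.mem_map_of_mem ⟨y, hy, ?_⟩)
      rw [formProd_concat]
      rfl
    exact (congrArg (c * ·) h1).trans (mul_zero c)
  obtain ⟨θ, hθ, hθ'⟩ := h _ (mem_smulGrading.2 ⟨φ, hφ, rfl⟩) h0
  obtain ⟨ψ, -, rfl⟩ := mem_smulGrading.1 hθ
  have key := congrArg (fun χ : QuotientDual I => χ (Submodule.Quotient.mk x)) hθ'
  obtain ⟨c, hc, hc'⟩ := exists_mul_formProd_eq_smul (K := K) p f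
  obtain ⟨d, -, hd⟩ := exists_mul_formProd_eq_smul (K := K) p (f ++ [v])
  simp only [quotientDual_smul_mk] at key
  rw [mul_assoc, ← formProd_concat, hd x hx, quotientDual_mk_smul, quotientDual_mk_eq_zero ψ
    (by rwa [formProd_concat, mul_assoc]), mul_zero, hc' x hx, quotientDual_mk_smul,
    hφ' _ hFx] at key
  exact mul_ne_zero hc hφ₀ key.symm

/-- Exactness of multiplication by `v` on `F I` and on `F E` gives exactness on `F (E/I)`. -/
theorem ExactAt.of_ideal [I.IsTwoSided] (hI : I.IsHomogeneous (fun p : ℕ => ⋀[K]^p V))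
    {f : List V} (hreg : RegularSeq K (ExteriorAlgebra K V ⧸ I) f) {v : V} {p : ℤ}
    (h : ExactAt v (smulGrading (formProd K f) f.length (idealGrading I)) (p + 1 + f.length))
    (h' : ExactAt v (smulGrading (formProd K f) f.length (extGrading K V)) (p + f.length))
    {x : ExteriorAlgebra K V} (hx : x ∈ extGrading K V p)
    (hx0 : ι K v * (formProd K f * x) ∈ I) :
    ∃ y ∈ extGrading K V (p - 1), formProd K f * x - ι K v * (formProd K f * y) ∈ I := by
  have hE := isGradedModule_extGrading K V
  have hcomm : ι K v * (formProd K f * x) =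
      formProd K f * ((-1 : K) ^ f.length • (ι K v * x)) := by
    rw [← mul_assoc, ι_mul_formProd, smul_mul_assoc, mul_smul_comm, mul_assoc]
  have hdeg : ι K v * (formProd K f * x) ∈ extGrading K V (p + 1 + f.length) := by
    rw [add_right_comm]
    exact hE.smul_mem v _ _ (hE.formProd_smul_mem f hx)
  rw [hcomm] at hx0
  -- Since `I ∩ FE = FI`, one has `v F x = F u` with `u ∈ I`. It is killed by `v`, so exactness on
  -- `FI` gives `F u = v F z` with `z ∈ I`. Then `v` kills `F (x - z)`, which is `v F w` by
  -- exactness on `FE`.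
  obtain ⟨y, hy, hy'⟩ := hreg.exists_mem_of_formProd_mul_mem hx0
  rw [← hcomm] at hy'
  obtain ⟨u, hu, hup, hu'⟩ := exists_mem_ideal_homogeneous hI f hy (by rwa [hy'])
  rw [hy'] at hu'
  obtain ⟨z', hz', hz⟩ := h (formProd K f • ⟨u, hu⟩)
    (mem_smulGrading.2 ⟨⟨u, hu⟩, by rwa [add_sub_cancel_right], rfl⟩) (Subtype.ext (by
      change ι K v * (formProd K f * u) = 0
      rw [hu', ← mul_assoc, ExteriorAlgebra.ι_sq_zero, zero_mul]))
  obtain ⟨⟨z, hzI⟩, hzp, rfl⟩ := mem_smulGrading.1 hz'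
  have hz : ι K v * (formProd K f * z) = formProd K f * u := congrArg Subtype.val hz
  have hzp : z ∈ extGrading K V p := by
    have : z ∈ extGrading K V (p + 1 + f.length - 1 - f.length) := hzp
    rwa [show p + 1 + (f.length : ℤ) - 1 - f.length = p by ring] at this
  obtain ⟨y', hy', hyy⟩ := h' (formProd K f • (x - z))
    (mem_smulGrading.2 ⟨x - z, by rw [add_sub_cancel_right]; exact sub_mem hx hzp, rfl⟩) (by
      rw [smul_eq_mul, smul_eq_mul, mul_sub, mul_sub, hz, hu', sub_self])
  obtain ⟨w, hw, rfl⟩ := mem_smulGrading.1 hy'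
  rw [show p + (f.length : ℤ) - 1 - f.length = p - 1 by ring] at hw
  refine ⟨w, hw, ?_⟩
  have : ι K v * (formProd K f * w) = formProd K f * (x - z) := hyy
  rw [this, mul_sub, sub_sub_cancel]
  exact I.mul_mem_left _ hzI

theorem RegularSeq.concat_of_homogeneous (hI : I.IsHomogeneous (fun p : ℕ => ⋀[K]^p V))
    {f : List V} (hf : RegularSeq K (ExteriorAlgebra K V ⧸ I) f) {v : V}
    (h : ∀ p : ℤ, ∀ x ∈ extGrading K V p, ι K v * (formProd K f * x) ∈ I →
      ∃ y ∈ extGrading K V (p - 1), formProd K f * x - ι K v * (formProd K f * y) ∈ I) :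
    RegularSeq K (ExteriorAlgebra K V ⧸ I) (f ++ [v]) := by
  have hE := isGradedModule_extGrading K V
  refine forallSplit_concat.2 ⟨hf, fun m hm => ?_⟩
  obtain ⟨x, rfl⟩ := Submodule.Quotient.mk_surjective _ m
  rw [← Submodule.Quotient.mk_smul, ← Submodule.Quotient.mk_smul,
    Submodule.Quotient.mk_eq_zero] at hm
  have hproj : ∀ p : ℤ, ι K v * (formProd K f * extProj K V p x) ∈ I := fun p => by
    have h2 := map_proj_eq iSup_extGrading (LinearMap.mulLeft K (formProd K (f ++ [v])))
      (𝓝 := extGrading K V) (d := (f ++ [v]).length) (fun i y hy => hE.formProd_smul_mem _ hy)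
      (j := p) (π := extProj K V p) ⟨fun _ => extProj_of_mem, fun _ h _ => extProj_of_mem_ne h⟩
      (ρ := extProj K V (p + (f ++ [v]).length))
      ⟨fun _ => extProj_of_mem, fun _ h _ => extProj_of_mem_ne h⟩ x
    rw [LinearMap.mulLeft_apply, LinearMap.mulLeft_apply, formProd_concat, mul_assoc,
      mul_assoc] at h2
    rw [h2]
    exact extProj_mem_ideal hI _ hm
  choose y _ hy using fun p : ℤ => h p _ (extProj_mem p x) (hproj p)
  refine ⟨Submodule.Quotient.mk (∑ p ∈ Finset.range (Module.finrank K V + 1), y p), ?_⟩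
  rw [← Submodule.Quotient.mk_smul, ← Submodule.Quotient.mk_smul, ← Submodule.Quotient.mk_smul,
    eq_comm, Submodule.Quotient.eq]
  conv in formProd K f • x => rw [← sum_extProj x]
  rw [smul_eq_mul, smul_eq_mul, smul_eq_mul, Finset.mul_sum, Finset.mul_sum, Finset.mul_sum,
    ← Finset.sum_sub_distrib]
  exact sum_mem fun p _ => hy p

theorem ι_mul_formProd_of_mem_span {l : List V} {v : V} (hv : v ∈ Submodule.span K {w | w ∈ l}) :
    ι K v * formProd K l = 0 := by
  refine Submodule.span_induction (fun w hw => ι_mul_formProd_of_mem hw) ?_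
    (fun x y _ _ hx hy => ?_) (fun c x _ hx => ?_) hv
  · rw [map_zero, zero_mul]
  · rw [map_add, add_mul, hx, hy, add_zero]
  · rw [map_smul, smul_mul_assoc, hx, smul_zero]

/-- Over an infinite field, multiplication by a generic linear combination of linear forms is exact
in finitely many degrees in which the Cartan complexes of three graded modules are exact. -/
theorem exists_exactAt [Infinite K] {g : List V}
    {M₁ M₂ M₃ : Type*} [AddCommGroup M₁] [Module K M₁] [Module (ExteriorAlgebra K V) M₁]
    [IsScalarTower K (ExteriorAlgebra K V) M₁] [FiniteDimensional K M₁]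
    [AddCommGroup M₂] [Module K M₂] [Module (ExteriorAlgebra K V) M₂]
    [IsScalarTower K (ExteriorAlgebra K V) M₂] [FiniteDimensional K M₂]
    [AddCommGroup M₃] [Module K M₃] [Module (ExteriorAlgebra K V) M₃]
    [IsScalarTower K (ExteriorAlgebra K V) M₃] [FiniteDimensional K M₃]
    {𝓜₁ : ℤ → Submodule K M₁} {𝓜₂ : ℤ → Submodule K M₂} {𝓜₃ : ℤ → Submodule K M₃}
    (h₁ : ∀ (v : V) (j : ℤ), ∀ x ∈ 𝓜₁ j, ι K v • x ∈ 𝓜₁ (j + 1))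
    (h₂ : ∀ (v : V) (j : ℤ), ∀ x ∈ 𝓜₂ j, ι K v • x ∈ 𝓜₂ (j + 1))
    (h₃ : ∀ (v : V) (j : ℤ), ∀ x ∈ 𝓜₃ j, ι K v • x ∈ 𝓜₃ (j + 1))
    {s₁ s₂ s₃ : ℤ} (hs₁ : ∀ j, j ≠ s₁ → CartanExact g 𝓜₁ j)
    (hs₂ : ∀ j, j ≠ s₂ → CartanExact g 𝓜₂ j) (hs₃ : ∀ j, j ≠ s₃ → CartanExact g 𝓜₃ j)
    (J : Finset ℤ) :
    ∃ v : V, (∀ j ∈ J, j ≠ s₁ → ExactAt v 𝓜₁ j) ∧ (∀ j ∈ J, j ≠ s₂ → ExactAt v 𝓜₂ j) ∧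
      ∀ j ∈ J, j ≠ s₃ → ExactAt v 𝓜₃ j := by
  obtain ⟨P₁, hP₁, hP₁'⟩ := exists_polynomial_forall_exactAt h₁ (J.filter (· ≠ s₁))
    fun j hj => hs₁ j (Finset.mem_filter.1 hj).2
  obtain ⟨P₂, hP₂, hP₂'⟩ := exists_polynomial_forall_exactAt h₂ (J.filter (· ≠ s₂))
    fun j hj => hs₂ j (Finset.mem_filter.1 hj).2
  obtain ⟨P₃, hP₃, hP₃'⟩ := exists_polynomial_forall_exactAt h₃ (J.filter (· ≠ s₃))
    fun j hj => hs₃ j (Finset.mem_filter.1 hj).2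
  obtain ⟨c, hc⟩ : ∃ c, MvPolynomial.eval c (P₁ * P₂ * P₃) ≠ 0 := by
    by_contra! h
    exact mul_ne_zero (mul_ne_zero hP₁ hP₂) hP₃ (MvPolynomial.funext fun c => by
      rw [h c, map_zero])
  rw [map_mul, map_mul] at hc
  have hc₃ := right_ne_zero_of_mul hc
  have hc₂ := right_ne_zero_of_mul (left_ne_zero_of_mul hc)
  have hc₁ := left_ne_zero_of_mul (left_ne_zero_of_mul hc)
  exact ⟨_, fun j hj hj' => hP₁' c hc₁ j (Finset.mem_filter.2 ⟨hj, hj'⟩),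
    fun j hj hj' => hP₂' c hc₂ j (Finset.mem_filter.2 ⟨hj, hj'⟩),
    fun j hj hj' => hP₃' c hc₃ j (Finset.mem_filter.2 ⟨hj, hj'⟩)⟩

/-- If `I` and `(E/I)^*` are generated in degrees `k` and `t` and have linear resolutions, then a regular
sequence `f` on `E/I` can be prolonged, except in two cases. -/
theorem RegularSeq.exists_concat [Infinite K] [I.IsTwoSided]
    (hI : I.IsHomogeneous (fun p : ℕ => ⋀[K]^p V)) {f g : List V}
    (hfg : LinearIndependent K (f ++ g).get) (hlen : (f ++ g).length = Module.finrank K V)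
    (hf : LinearIndependent K f.get) (hreg : RegularSeq K (ExteriorAlgebra K V ⧸ I) f) {k t : ℤ}
    (hk : ∀ j, j ≠ k → CartanExact (f ++ g) (idealGrading I) j)
    (ht : ∀ j, j ≠ t → CartanExact (f ++ g) (quotientDualGrading I) j)
    (h₁ : -t ≠ f.length) (h₂ : -t ≠ k + f.length - 1) :
    ∃ v : V, RegularSeq K (ExteriorAlgebra K V ⧸ I) (f ++ [v]) := by
  have hE := isGradedModule_extGrading K V
  have hgI := isGradedModule_idealGrading hI
  have hgN := isGradedModule_quotientDualGrading hI
  have hfE := regularSeq_exteriorAlgebra hf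
  have hshift : ∀ j s : ℤ, j ≠ s + f.length → j - f.length ≠ s := fun j s h => by omega
  obtain ⟨v, hN, hII, hEE⟩ := exists_exactAt (g := g) (s₁ := t + f.length) (s₂ := k + f.length)
    (s₃ := f.length)
    (ι_smul_mem_smulGrading hgN.smul_mem f) (ι_smul_mem_smulGrading hgI.smul_mem f)
    (ι_smul_mem_smulGrading hE.smul_mem f)
    (fun j hj => by
      have := ((hreg.quotientDual hI).cartanExact_iff hgN.smul_mem g _).1 (ht _ (hshift j t hj))
      rwa [sub_add_cancel] at this)
    (fun j hj => by
      have := (((hreg.ideal hfE).graded hgI).cartanExact_iff hgI.smul_mem g _).1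
        (hk _ (hshift j k hj))
      rwa [sub_add_cancel] at this)
    (fun j hj => by
      have := ((hfE.graded hE).cartanExact_iff hE.smul_mem g (j - f.length)).1
        (cartanExact_extGrading hfg hlen (by omega))
      rwa [sub_add_cancel] at this)
    -- A finite window suffices: the degrees used are `-p`, `p + |f|` and `p + 1 + |f|` with `p` and
    -- `|f|` between `0` and `dim V`.
    (Finset.Icc (-Module.finrank K V : ℤ) (2 * Module.finrank K V + 1))
  refine ⟨v, hreg.concat_of_homogeneous hI fun p x hx hx0 => ?_⟩
  have hlen' : (f.length : ℤ) ≤ Module.finrank K V := by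
    rw [← hlen, List.length_append]
    omega
  rcases eq_or_ne x 0 with rfl | hxne
  · exact ⟨0, zero_mem _, by simp⟩
  have hp0 : 0 ≤ p := by
    by_contra! hp
    rw [extGrading_of_neg hp] at hx
    exact hxne hx
  have hpn : p ≤ Module.finrank K V := by
    by_contra! hp
    rw [extGrading_eq_bot_of_gt hp] at hx
    exact hxne hx
  -- Duality fails only for `p = -t - |f|`. There the argument through `I` and `E` requires `p ≠ k -
  -- 1` and `p ≠ 0`, which are `h₂` and `h₁`.
  rcases eq_or_ne (-p) (t + f.length) with hp | hp
  · exact ExactAt.of_ideal hI hreg (hII _ (Finset.mem_Icc.2 (by omega)) (by omega))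
      (hEE _ (Finset.mem_Icc.2 (by omega)) (by omega)) hx hx0
  · exact ExactAt.of_quotientDual hI (hN _ (Finset.mem_Icc.2 (by omega)) hp) hx hx0

theorem exists_isPowerModulo_of_bothLinear [Infinite K] [I.IsTwoSided]
    (hI : I.IsHomogeneous (fun p : ℕ => ⋀[K]^p V)) (h : BothLinear I) {s : ℕ} {f : Fin s → V}
    (hf : IsMaximalRegularSequence K (ExteriorAlgebra K V ⧸ I) f) :
    ∃ k, IsPowerModulo I (formProd K (List.ofFn f)) k := by
  obtain ⟨hind, hreg⟩ := isRegularSequence_iff.1 hf.1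
  have hgI := isGradedModule_idealGrading hI
  have hgN := isGradedModule_quotientDualGrading hI
  have hind' := linearIndependent_get_ofFn.2 hind
  obtain ⟨g, hfg, hlen⟩ := exists_basis_append hind'
  obtain ⟨k, hk⟩ := h.1.cartanExact hgI hfg hlen
  obtain ⟨t, ht⟩ := h.2.cartanExact hgN hfg hlen
  have hfs : (List.ofFn f).length = s := List.length_ofFn
  set F := formProd K (List.ofFn f) with hF
  have hFx : ∀ {p : ℤ} {x : ExteriorAlgebra K V}, x ∈ extGrading K V p →
      F * x ∈ extGrading K V (p + s) := fun {p x} hx => by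
    have := (isGradedModule_extGrading K V).formProd_smul_mem (List.ofFn f) hx
    rwa [hfs] at this
  have hlow : ∀ p : ℤ, p < k → ∀ x ∈ I, x ∈ extGrading K V p → x = 0 := fun p hp x hx hxp => by
    have h0 : (⟨x, hx⟩ : I) ∈ idealGrading I p := hxp
    rw [hgI.eq_bot_of_lt hk hp, Submodule.mem_bot] at h0
    exact congrArg Subtype.val h0
  have hhigh : ∀ p : ℤ, -t < p → ∀ x ∈ extGrading K V p, x ∈ I := fun p hp x hx =>
    mem_of_quotientDualGrading_eq_bot hI (hgN.eq_bot_of_lt ht (by omega)) hx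
  have hlift : ∀ x, F * x ∈ I → ∃ y ∈ I, F * y = F * x := fun x hx =>
    hreg.exists_mem_of_formProd_mul_mem hx
  -- If `F ∈ I`, then `FE ⊆ I` and so `FI = FE`: the ideal reduces to the whole ring, the power with
  -- exponent `0`.
  by_cases hFI : F ∈ I
  · exact ⟨0, fun p hp x _ hx => by
      rw [extGrading_of_neg (by exact_mod_cast hp), Submodule.mem_bot] at hx
      rw [hx, mul_zero], fun p _ x _ => hlift x (I.mul_mem_right _ hFI)⟩
  -- All elements of degree greater than `-t = s` lie in `I`, so `F E_p ⊆ I` for `p ≥ 1`; since `F ∉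
  -- I`, the ideal contains no nonzero constant. The exponent is `1`.
  by_cases h₁ : -t = s
  · refine ⟨1, fun p hp x hxI hx => ?_, fun p hp x hx => hlift x (hhigh _ ?_ _ (hFx hx))⟩
    · rcases lt_or_eq_of_le (show p ≤ 0 by omega) with hp | rfl
      · rw [extGrading_of_neg hp, Submodule.mem_bot] at hx
        rw [hx, mul_zero]
      · obtain ⟨c, rfl⟩ := mem_extGrading_zero hx
        rcases eq_or_ne c 0 with rfl | hc
        · rw [map_zero, mul_zero]
        · refine absurd ?_ hFI
          have := I.mul_mem_left (F * algebraMap K _ c⁻¹) hxI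
          rwa [mul_assoc, ← map_mul, inv_mul_cancel₀ hc, map_one, mul_one] at this
    · push_cast at hp
      omega
  -- Nothing in `I` has degree less than `k`, while `F E_p` with `p ≥ k` lies in degrees greater
  -- than `-t` and hence in `I`. The exponent is `k`, which is positive because otherwise `F` itself
  -- would have degree greater than `-t`.
  by_cases h₂ : -t = k + s - 1
  · have hk1 : 1 ≤ k := by
      by_contra! hk1
      refine hFI (hhigh s (by omega) _ ?_)
      simpa using hFx one_mem_extGrading
    refine ⟨k.toNat, fun p hp x hxI hx => ?_, fun p hp x hx =>
      hlift x (hhigh _ (by omega) _ (hFx hx))⟩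
    rw [hlow p (by omega) x hxI hx, mul_zero]
  obtain ⟨v, hv⟩ := hreg.exists_concat hI hfg hlen hind' hk ht (by rwa [hfs]) (by rwa [hfs])
  -- The prolongation contradicts maximality once `v` is independent of `f`. If it were not, then `v
  -- F = 0`, and regularity applied to the class of `1` would give `F ∈ I`.
  refine absurd (isRegularSequence_iff.2 ⟨linearIndependent_finSnoc.2 ⟨hind, fun hvs => hFI ?_⟩,
    by rwa [ofFn_snoc]⟩) (hf.2 v)
  rw [← setOf_mem_ofFn] at hvs
  obtain ⟨m, hm⟩ := (forallSplit_concat.1 hv).2 (Submodule.Quotient.mk 1) (by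
    rw [smul_smul, ι_mul_formProd_of_mem_span hvs, zero_smul])
  rw [smul_smul, ι_mul_formProd_of_mem_span hvs, zero_smul, ← Submodule.Quotient.mk_smul,
    smul_eq_mul, mul_one, eq_comm, Submodule.Quotient.mk_eq_zero] at hm
  exact hm

theorem reducesForAll_of_bothLinear [Infinite K] [I.IsTwoSided]
    (hI : I.IsHomogeneous (fun p : ℕ => ⋀[K]^p V)) (h : BothLinear I) : ReducesForAll I :=
  fun _ _ hf => (reducesToPower_iff hI hf.1.1).2 (exists_isPowerModulo_of_bothLinear hI h hf)

theorem ReducesForAll.reducesForSome (h : ReducesForAll I) : ReducesForSome I := by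
  obtain ⟨s, f, hf⟩ := exists_isMaximalRegularSequence (K := K) (V := V) (ExteriorAlgebra K V ⧸ I)
  exact ⟨s, f, hf, h s f hf⟩

end Converse

end ExteriorLinear

open ExteriorLinear in
theorem theorem3p4 {K : Type*} [Field K] {V : Type*} [AddCommGroup V] [Module K V]
    [FiniteDimensional K V] (I : Ideal (ExteriorAlgebra K V)) [I.IsTwoSided]
    (hI : I.IsHomogeneous (fun p : ℕ => ⋀[K]^p V)) :
    ((ReducesForSome I → BothLinear I) ∧ (ReducesForAll I → BothLinear I)) ∧
    (Infinite K →
      (BothLinear I ↔ ReducesForSome I) ∧ (BothLinear I ↔ ReducesForAll I)) := by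
  have h₁ : ReducesForSome I → BothLinear I := bothLinear_of_reducesForSome hI
  have h₂ : ReducesForAll I → ReducesForSome I := ReducesForAll.reducesForSome
  refine ⟨⟨h₁, fun h => h₁ (h₂ h)⟩, fun _ => ?_⟩
  have h₃ : BothLinear I → ReducesForAll I := reducesForAll_of_bothLinear hI
  exact ⟨⟨fun h => h₂ (h₃ h), h₁⟩, ⟨h₃, fun h => h₁ (h₂ h)⟩⟩
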